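/- **Setting.** Let $\mathfrak g$ be a simple complex Lie algebra of simply-laced type, $I$ the vertex set of its Dynkin diagram, $n=|I|$, $\alpha_i$ the simple roots, $\Phi_+$ the set of positive roots, $N=|\Phi_+|$, $h=2N/n$ the (dual) Coxeter number, $w_0$ the longest element of the Weyl group $W$, and $i\mapsto i^*$ the involution with $w_0(\alpha_i)=-\alpha_{i^*}$. Let $Q$ be an orientation of the Dynkin diagram and $\xi:I\to\mathbb Z$ a height function adapted to $Q$, i.e. $\xi(j)=\xi(i)-1$ whenever $i\to j$ in $Q$. A word $(i_1,i_2,\dots)$ is adapted to $Q$ if $i_1$ is a source of $Q$, $i_2$ is a source of the quiver $s_{i_1}(Q)$ obtained by reversing all arrows at $i_1$, and so on; $\tau_Q\in W$ is the unique Coxeter element having reduced expressions adapted to $Q$. Fix a reduced expression $(i_1,\dots,i_N)$ of $w_0$ adapted to $Q$ and extend it to an infinite sequence by setting, for $1\le k\le N$ and $m\ge 0$, $i_{k+Nm}=i_k$ if $m$ is even and $i_{k+Nm}=i_k^*$ if $m$ is odd. Put $I^{\le\xi}=\{(i,p)\mid i\in I,\ p\in\xi(i)+2\mathbb Z_{\le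 0}\}$ and let $\varphi:I^{\le\xi}\to\mathbb Z_{\ge1}$ be the bijection with inverse $\varphi^{-1}(t)=(i_t,\ \xi(i_t)-2N_Q(t)+2)$, where $N_Q(t)=\#\{k\le t\mid i_k=i_t\}$. Let $\gamma_j$ be the sum of the $\alpha_k$ over all $k$ admitting a (possibly trivial) path from $k$ to $j$ in $Q$; define positive roots $\beta_t$, $t\ge1$, by $\beta_{\varphi(j,\xi(j))}=\gamma_j$ and $\beta_{\varphi(j,s-2)}=\pm\tau_Q(\beta_{\varphi(j,s)})$, the sign being the one that gives a positive root. Let $C(z)$ be the quantum Cartan matrix ($C_{ii}(z)=z+z^{-1}$, $C_{ij}(z)=-1$ if $i,j$ are adjacent, $0$ otherwise); for $m\geq 1$ let $\tilde C_{ij}(m)$ be the coefficient of $z^m$ in the expansion of the $(i,j)$ entry of $C(z)^{-1}$ as a power series in $z$, and let $\tilde C_{ij}(m)=0$ for $m\le0$. Let $\mathcal Y^{\le\xi}=\mathbb Z[Y_{i,p}^{\pm1},(i,p)\in I^{\le\xi}]$ and let $\widetilde D_\xi:\mathbb C\otimes\mathcal Y^{\le\xi}\to\mathbb C(\alpha_1,\dots,\alpha_n)$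 be the $\mathbb{C}$-algebra morphism with $$\widetilde D_\xi(Y_{i,p})=\prod_{(j,s)\in I^{\le\xi}}\beta_{\varphi(j,s)}^{\tilde C_{ij}(s-p-1)-\tilde C_{ij}(s-p+1)}\qquad((i,p)\in I^{\le\xi}).$$ Let $q\in\mathbb C^\times$ be not a root of unity. For $(i,p)\in I^{\le\xi}$ let $X_{i,p}=L(Y_{i,p}Y_{i,p+2}\cdots Y_{i,\xi(i)})$ be the Kirillov–Reshetikhin module, i.e. the finite-dimensional simple module over the quantum affine algebra (with trivial central charge) with this highest $l$-weight, where $Y_{i,p}=Y_{i,q^p}$. Let $\widetilde\chi_q$ be the truncated $q$-character: $\widetilde\chi_q(V)=\sum_m\dim(V_m)\,m$, summed over the monomials $m$ of $\mathcal Y^{\le\xi}$, where $V_m$ is the $l$-weight space of $V$ of $l$-weight $m$. For $t\ge1$ let $x_t=[X_{\varphi^{-1}(t)}]$ (the $t$-th initial cluster variable of Hernandez–Leclerc's cluster structure on $\mathbb C\otimes K_0(\mathcal C^{\le\xi})$), and let $\iota$ be the embedding given by the truncated $q$-character, so that $\iota(x_t)=\widetilde\chi_q(X_{\varphi^{-1}(t)})$.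 **Statement.** (1) For every $(i,p)\in I^{\le\xi}$ with $p\le\xi(i)-2h+2$ one has $$\widetilde D_\xi\big(Y_{i,p}Y_{i,p+2}\cdots Y_{i,p+2h-2}\big)=1.$$ (2) For every $t\ge1$ one has $\widetilde D_\xi(\iota(x_{t+2N}))=\widetilde D_\xi(\iota(x_t))$. -/

import Mathlib

noncomputable section

namespace HernandezLeclerc

/-! # The set `I^{≤ ξ}` -/

/-- `(i, p) ∈ I^{≤ ξ}`, that is `p ∈ ξ(i) + 2 ℤ_{≤ 0}`. -/
def MemLE {I : Type*} (ξ : I → ℤ) (i : I) (p : ℤ) : Prop := ∃ k : ℕ, p = ξ i - 2 * k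

/-- The set `I^{≤ ξ}`. -/
abbrev ILE {I : Type*} (ξ : I → ℤ) := {y : I × ℤ // MemLE ξ y.1 y.2}

/-- If `(i, p) ∈ I^{≤ ξ}` and `p ≤ ξ(i) - 2h + 2`, then `(i, p + 2k) ∈ I^{≤ ξ}` for `k < h`. -/
theorem MemLE.shift {I : Type*} {ξ : I → ℤ} {i : I} {p : ℤ} {h k : ℕ} (hp : MemLE ξ i p)
    (hle : p ≤ ξ i - 2 * h + 2) (hk : k < h) : MemLE ξ i (p + 2 * k) := by
  obtain ⟨d, hd⟩ := hp
  exact ⟨d - k, by omega⟩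

/-! # Dynkin data -/

section Dynkin

variable {I : Type*} [Fintype I] [DecidableEq I]

/-- The Cartan matrix of a simply-laced diagram: `2` on the diagonal, `-1` for neighbours. -/
def cartan (G : SimpleGraph I) [DecidableRel G.Adj] : Matrix I I ℤ :=
  fun i j => if i = j then 2 else if G.Adj i j then -1 else 0

/-- `G` is the Dynkin diagram of a simple complex Lie algebra of simply-laced type (types
`A`, `D`, `E`): it is connected (in particular non-empty) and its Cartan matrix is positive
definite. -/
def IsSimplyLacedDynkin (G : SimpleGraph I) [DecidableRel G.Adj] : Prop :=
  G.Connected ∧ ((cartan G).map (Int.cast : ℤ → ℝ)).PosDef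

/-- The simple root `α_i`, in the root lattice `Γ = ⨁ ℤ α_i` identified with `I → ℤ`. -/
def simpleRoot (i : I) : I → ℤ := Pi.single i 1

/-- The simple coroot, as a linear form on the root lattice: `v ↦ (α_i, v)`. -/
def simpleCoroot (G : SimpleGraph I) [DecidableRel G.Adj] (i : I) : Module.Dual ℤ (I → ℤ) :=
  (LinearMap.proj i).comp (cartan G).mulVecLin

theorem simpleCoroot_simpleRoot (G : SimpleGraph I) [DecidableRel G.Adj] (i : I) :
    simpleCoroot G i (simpleRoot i) = 2 := by
  simp [simpleCoroot, simpleRoot, cartan]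

/-- The simple reflection `s_i`, acting on the root lattice by `v ↦ v - (α_i, v) α_i`. -/
def simpleReflection (G : SimpleGraph I) [DecidableRel G.Adj] (i : I) :
    (I → ℤ) ≃ₗ[ℤ] (I → ℤ) :=
  Module.reflection (simpleCoroot_simpleRoot G i)

/-- The Weyl group `W`, acting on the root lattice. -/
def weylGroup (G : SimpleGraph I) [DecidableRel G.Adj] :
    Subgroup ((I → ℤ) ≃ₗ[ℤ] (I → ℤ)) :=
  Subgroup.closure (Set.range (simpleReflection G))

/-- The set `Φ` of roots: the `W`-conjugates of the simple roots. -/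
def roots (G : SimpleGraph I) [DecidableRel G.Adj] : Set (I → ℤ) :=
  {β | ∃ w ∈ weylGroup G, ∃ i, β = w (simpleRoot i)}

/-- The set `Φ₊` of positive roots. -/
def positiveRoots (G : SimpleGraph I) [DecidableRel G.Adj] : Set (I → ℤ) :=
  {β | β ∈ roots G ∧ ∀ i, 0 ≤ β i}

/-- The number `N` of positive roots. -/
def numPos (G : SimpleGraph I) [DecidableRel G.Adj] : ℕ := Nat.card (positiveRoots G)

/-- The (dual) Coxeter number `h = 2N/n` (the division is exact for a Dynkin diagram). -/
def coxeterNumber (G : SimpleGraph I) [DecidableRel G.Adj] : ℕ :=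
  2 * numPos G / Fintype.card I

/-- `w` is the longest element `w₀` of `W`: the element which makes all positive roots negative. -/
def IsLongest (G : SimpleGraph I) [DecidableRel G.Adj] (w : (I → ℤ) ≃ₗ[ℤ] (I → ℤ)) : Prop :=
  w ∈ weylGroup G ∧ ∀ β ∈ positiveRoots G, -(w β) ∈ positiveRoots G

/-- The vertex `i*` such that `w₀(α_i) = -α_{i*}`. -/
def dualVertex (G : SimpleGraph I) [DecidableRel G.Adj] (i : I) : I :=
  @Classical.epsilon I ⟨i⟩ fun j => ∃ w, IsLongest G w ∧ w (simpleRoot i) = -simpleRoot j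

/-- The product `s_{i_1} s_{i_2} ⋯ s_{i_k}` attached to a word. -/
def wordProd (G : SimpleGraph I) [DecidableRel G.Adj] (l : List I) :
    (I → ℤ) ≃ₗ[ℤ] (I → ℤ) :=
  (l.map (simpleReflection G)).prod

/-! ## Orientations and adapted words -/

/-- `Q` is an orientation of the graph `G`: every edge carries exactly one arrow. -/
def IsOrientation (G : SimpleGraph I) (Q : Digraph I) : Prop :=
  (∀ i j, Q.Adj i j → G.Adj i j) ∧ ∀ i j, G.Adj i j → (Q.Adj i j ↔ ¬ Q.Adj j i)

/-- `i` is a source of `Q`: no arrow ends at `i`. -/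
def IsSource (Q : Digraph I) (i : I) : Prop := ∀ j, ¬ Q.Adj j i

/-- The quiver `s_i(Q)`: all arrows with source or target `i` are reversed. -/
def reflectQuiver (i : I) (Q : Digraph I) : Digraph I where
  Adj a b := if a = i ∨ b = i then Q.Adj b a else Q.Adj a b

/-- The word `(i_1, …, i_k)` is adapted to `Q`: `i_1` is a source of `Q`, `i_2` is a source of
`s_{i_1}(Q)`, and so on. -/
def IsAdapted : Digraph I → List I → Prop
  | _, [] => True
  | Q, i :: l => IsSource Q i ∧ IsAdapted (reflectQuiver i Q) l

/-- `τ` is a Coxeter element having a reduced expression adapted to `Q`. -/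
def IsAdaptedCoxeter (G : SimpleGraph I) [DecidableRel G.Adj] (Q : Digraph I)
    (τ : (I → ℤ) ≃ₗ[ℤ] (I → ℤ)) : Prop :=
  ∃ l : List I, l.Nodup ∧ (∀ i, i ∈ l) ∧ IsAdapted Q l ∧ τ = wordProd G l

/-- The Coxeter element `τ_Q`: the unique one having reduced expressions adapted to `Q`. -/
def coxeter (G : SimpleGraph I) [DecidableRel G.Adj] (Q : Digraph I) :
    (I → ℤ) ≃ₗ[ℤ] (I → ℤ) :=
  Classical.epsilon (IsAdaptedCoxeter G Q)

/-- `(w 1, …, w N)` is a reduced expression of `w₀` adapted to `Q` (as `N` is the length of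
`w₀`, every word of length `N` representing `w₀` is reduced).  The values of `w` outside
`1, …, N` play no role. -/
def IsAdaptedReducedWord (G : SimpleGraph I) [DecidableRel G.Adj] (Q : Digraph I)
    (w : ℕ → I) : Prop :=
  IsLongest G (wordProd G ((List.range (numPos G)).map fun k => w (k + 1))) ∧
    IsAdapted Q ((List.range (numPos G)).map fun k => w (k + 1))

/-- The infinite word `(i_1, i_2, …)` extending `(w 1, …, w N)`: `i_{k + N m}` is `i_k` if `m` is
even and `i_k*` if `m` is odd, for `1 ≤ k ≤ N`. (Only the values at `t ≥ 1` are meaningful.) -/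
def hatWord (G : SimpleGraph I) [DecidableRel G.Adj] (w : ℕ → I) (t : ℕ) : I :=
  if Even ((t - 1) / numPos G) then w ((t - 1) % numPos G + 1)
  else dualVertex G (w ((t - 1) % numPos G + 1))

/-- `N_Q(t)`, the number of occurrences of the letter `i_t` among `i_1, …, i_t`. -/
def occurrences (G : SimpleGraph I) [DecidableRel G.Adj] (w : ℕ → I) (t : ℕ) : ℕ :=
  ((Finset.Icc 1 t).filter fun k => hatWord G w k = hatWord G w t).card

/-! ## The roots attached to the elements of `I^{≤ ξ}` -/

/-- The element `(i, ξ(i) - 2d)` of `I^{≤ ξ}`. -/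
def atDepth (ξ : I → ℤ) (i : I) (d : ℕ) : ILE ξ := ⟨(i, ξ i - 2 * d), d, rfl⟩

/-- The number `d = (ξ(i) - p) / 2` attached to `(i, p) ∈ I^{≤ ξ}`. -/
def depth {ξ : I → ℤ} (y : ILE ξ) : ℕ := ((ξ y.1.1 - y.1.2) / 2).toNat

/-- The bijection `φ⁻¹` from the positive integers to `I^{≤ ξ}`:
`φ⁻¹(t) = (i_t, ξ(i_t) - 2 N_Q(t) + 2)`. -/
def phiInv (G : SimpleGraph I) [DecidableRel G.Adj] (ξ : I → ℤ) (w : ℕ → I) (t : ℕ) : ILE ξ :=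
  atDepth ξ (hatWord G w t) (occurrences G w t - 1)

open Classical in
/-- The root `γ_i`, the sum of the `α_j` over all `j` admitting a path from `j` to `i` in `Q`. -/
def gammaRoot (Q : Digraph I) (i : I) : I → ℤ :=
  fun j => if Relation.ReflTransGen Q.Adj j i then 1 else 0

open Classical in
/-- The positive roots `β_{φ(j, ξ(j) - 2m)}`, for `m = 0, 1, 2, …`: one starts with `γ_j`, applies
`τ_Q`, and changes the sign whenever the result is not a positive root. -/
def betaSeq (G : SimpleGraph I) [DecidableRel G.Adj] (Q : Digraph I) (j : I) : ℕ → I → ℤ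
  | 0 => gammaRoot Q j
  | m + 1 =>
    if coxeter G Q (betaSeq G Q j m) ∈ positiveRoots G then coxeter G Q (betaSeq G Q j m)
    else -coxeter G Q (betaSeq G Q j m)

/-- The root `β_{φ(j,s)}`, for `(j, s) ∈ I^{≤ ξ}`. -/
def beta (G : SimpleGraph I) [DecidableRel G.Adj] (Q : Digraph I) {ξ : I → ℤ} (y : ILE ξ) :
    I → ℤ :=
  betaSeq G Q y.1.1 (depth y)

theorem betaSeq_ne_zero (G : SimpleGraph I) [DecidableRel G.Adj] (Q : Digraph I) (j : I) (m : ℕ) :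
    betaSeq G Q j m ≠ 0 := by
  induction m with
  | zero =>
    intro h
    have := congrFun h j
    simp [betaSeq, gammaRoot, Relation.ReflTransGen.refl] at this
  | succ m ih =>
    have h : coxeter G Q (betaSeq G Q j m) ≠ 0 := by simpa using ih
    rw [betaSeq]
    split_ifs
    · exact h
    · simpa using ih

/-! ## The inverse quantum Cartan matrix -/

/-- The quantum Cartan matrix `C(z)`, with entries in the ring of Laurent series in `z`. -/
def quantumCartan (G : SimpleGraph I) [DecidableRel G.Adj] : Matrix I I (LaurentSeries ℤ) :=
  fun i j => if i = j then HahnSeries.single 1 1 + HahnSeries.single (-1) 1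
    else if G.Adj i j then -1 else 0

/-- The integers `C̃_{ij}(m)`: for `m ≥ 1`, the coefficient of `z ^ m` in the entry `(i, j)` of the
inverse of `C(z)`; for `m ≤ 0`, zero. -/
def cTilde (G : SimpleGraph I) [DecidableRel G.Adj] (i j : I) (m : ℤ) : ℤ :=
  if 1 ≤ m then ((quantumCartan G)⁻¹ i j).coeff m else 0

/-! ## The morphism `D̃_ξ` -/

/-- The field `ℂ(α_1, …, α_n)`. -/
abbrev RatField (I : Type*) := FractionRing (MvPolynomial I ℂ)

/-- The root lattice inside `ℂ(α_1, …, α_n)`. -/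
def linForm (β : I → ℤ) : RatField I :=
  algebraMap (MvPolynomial I ℂ) (RatField I) (∑ i, MvPolynomial.C (β i : ℂ) * MvPolynomial.X i)

theorem linForm_ne_zero {β : I → ℤ} (h : β ≠ 0) : linForm β ≠ 0 := by
  obtain ⟨i, hi⟩ := Function.ne_iff.1 h
  intro h0
  rw [linForm, map_eq_zero_iff _ (IsFractionRing.injective _ _)] at h0
  have := congrArg (MvPolynomial.eval (Pi.single i (1 : ℂ))) h0
  simp [Pi.single_apply] at this
  exact hi (by simpa using this)

/-- The non-zero element `β_{φ(j,s)}` of `ℂ(α_1, …, α_n)`. -/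
def betaUnit (G : SimpleGraph I) [DecidableRel G.Adj] (Q : Digraph I) {ξ : I → ℤ} (y : ILE ξ) :
    (RatField I)ˣ :=
  Units.mk0 (linForm (beta G Q y)) (linForm_ne_zero (betaSeq_ne_zero G Q _ _))

/-- The value of `D̃_ξ` on `Y_{i,p}`.  The product has only finitely many factors different
from `1`, as those with `s < p` are trivial. -/
def dTildeY (G : SimpleGraph I) [DecidableRel G.Adj] (Q : Digraph I) (ξ : I → ℤ) (x : ILE ξ) :
    (RatField I)ˣ :=
  ∏ᶠ y : ILE ξ, betaUnit G Q y ^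
    (cTilde G x.1.1 y.1.1 (y.1.2 - x.1.2 - 1) - cTilde G x.1.1 y.1.1 (y.1.2 - x.1.2 + 1))

/-- The complexified torus `ℂ ⊗ 𝒴^{≤ ξ}`: Laurent polynomials with complex coefficients in the
variables `Y_{i,p}`, `(i, p) ∈ I^{≤ ξ}`; a monomial is given by its exponents. -/
abbrev Torus (ξ : I → ℤ) := AddMonoidAlgebra ℂ (ILE ξ →₀ ℤ)

/-- The variable `Y_{i,p}`. -/
def Y {ξ : I → ℤ} (y : ILE ξ) : Torus ξ := AddMonoidAlgebra.single (Finsupp.single y 1) 1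

/-- The algebra morphism `D̃_ξ : ℂ ⊗ 𝒴^{≤ ξ} → ℂ(α_1, …, α_n)`, the one given by `dTildeY` on the
variables. -/
def dTilde (G : SimpleGraph I) [DecidableRel G.Adj] (Q : Digraph I) (ξ : I → ℤ) :
    Torus ξ →ₐ[ℂ] RatField I :=
  AddMonoidAlgebra.lift ℂ (RatField I) (ILE ξ →₀ ℤ)
    ((Units.coeHom (RatField I)).comp
      (AddMonoidHom.toMultiplicativeLeft (Finsupp.liftAddHom fun y =>
        zmultiplesHom (Additive (RatField I)ˣ) (Additive.ofMul (dTildeY G Q ξ y)))))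

theorem dTilde_Y (G : SimpleGraph I) [DecidableRel G.Adj] (Q : Digraph I) (ξ : I → ℤ)
    (y : ILE ξ) : dTilde G Q ξ (Y y) = dTildeY G Q ξ y := by
  simp [dTilde, Y]

end Dynkin

/-! # Quantum affine algebras and (truncated) `q`-characters -/

section Quantum

variable {I : Type*} [Fintype I] [DecidableEq I]

/-- The quantum integer `[n]_q = (q^n - q^{-n}) / (q - q^{-1})`. -/
def qInt (q : ℂˣ) (n : ℤ) : ℂ :=
  (((q ^ n : ℂˣ) : ℂ) - ((q ^ (-n) : ℂˣ) : ℂ)) / ((q : ℂ) - ((q⁻¹ : ℂˣ) : ℂ))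

/-- Generators of the quantum affine algebra in Drinfeld's realization.  A sign `ε = ±1` selects
between the two members of a family: `x ε i r` is `x^ε_{i,r}`, `k ε i` is `k_i^ε`, and `φ ε i r` is
`φ^ε_{i,r}`. -/
inductive Gen (I : Type*) : Type _
  | x (ε : ℤˣ) (i : I) (r : ℤ)
  | k (ε : ℤˣ) (i : I)
  | h (i : I) (r : ℤ)
  | φ (ε : ℤˣ) (i : I) (r : ℤ)

section Rel

/-- The generators inside the free algebra. -/
abbrev gx (ε : ℤˣ) (i : I) (r : ℤ) : FreeAlgebra ℂ (Gen I) := FreeAlgebra.ι ℂ (Gen.x ε i r)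
/-- The generators inside the free algebra. -/
abbrev gk (ε : ℤˣ) (i : I) : FreeAlgebra ℂ (Gen I) := FreeAlgebra.ι ℂ (Gen.k ε i)
/-- The generators inside the free algebra. -/
abbrev gh (i : I) (r : ℤ) : FreeAlgebra ℂ (Gen I) := FreeAlgebra.ι ℂ (Gen.h i r)
/-- The generators inside the free algebra. -/
abbrev gφ (ε : ℤˣ) (i : I) (r : ℤ) : FreeAlgebra ℂ (Gen I) := FreeAlgebra.ι ℂ (Gen.φ ε i r)

/-- The expression whose symmetrization in `r₁, r₂` is the cubic Serre relation. -/
def serreTerm (q : ℂˣ) (ε : ℤˣ) (i j : I) (r₁ r₂ s : ℤ) : FreeAlgebra ℂ (Gen I) :=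
  gx ε i r₁ * gx ε i r₂ * gx ε j s - qInt q 2 • (gx ε i r₁ * gx ε j s * gx ε i r₂)
    + gx ε j s * gx ε i r₁ * gx ε i r₂

/-- Drinfeld's relations for the quantum affine algebra with trivial central charge (the
quantum loop algebra), in simply-laced type. -/
inductive Rel (G : SimpleGraph I) [DecidableRel G.Adj] (q : ℂˣ) :
    FreeAlgebra ℂ (Gen I) → FreeAlgebra ℂ (Gen I) → Prop
  /-- `k_i` and `k_i⁻¹` are inverse to each other. -/
  | k_inv (ε : ℤˣ) (i : I) : Rel G q (gk ε i * gk (-ε) i) 1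
  | k_comm (ε ε' : ℤˣ) (i j : I) : Rel G q (gk ε i * gk ε' j) (gk ε' j * gk ε i)
  /-- There is no generator `h_{i,0}`. -/
  | h_zero (i : I) : Rel G q (gh i 0) 0
  | k_h_comm (ε : ℤˣ) (i j : I) (r : ℤ) : Rel G q (gk ε i * gh j r) (gh j r * gk ε i)
  | h_comm (i j : I) (r s : ℤ) : Rel G q (gh i r * gh j s) (gh j s * gh i r)
  /-- The four families below say that
  `∑_{r ≥ 0} φ^ε_{i, ε r} u^r = k_i^ε exp(ε (q - q⁻¹) ∑_{r ≥ 1} h_{i, ε r} u^r)`,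
  through its constant term and its logarithmic derivative. -/
  | φ_vanish (ε : ℤˣ) (i : I) (r : ℤ) (hr : (ε : ℤ) * r < 0) : Rel G q (gφ ε i r) 0
  | φ_zero (ε : ℤˣ) (i : I) : Rel G q (gφ ε i 0) (gk ε i)
  | φ_succ (ε : ℤˣ) (i : I) (r : ℕ) :
      Rel G q (((r : ℂ) + 1) • gφ ε i ((ε : ℤ) * (r + 1)))
        ((((ε : ℤ) : ℂ) * ((q : ℂ) - ((q⁻¹ : ℂˣ) : ℂ))) •
          ∑ s ∈ Finset.range (r + 1),
            ((s : ℂ) + 1) • (gh i ((ε : ℤ) * (s + 1)) * gφ ε i ((ε : ℤ) * ((r : ℤ) - s))))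
  | k_x (ε ε' : ℤˣ) (i j : I) (r : ℤ) :
      Rel G q (gk ε i * gx ε' j r)
        (((q ^ ((ε : ℤ) * ε' * cartan G i j) : ℂˣ) : ℂ) • (gx ε' j r * gk ε i))
  | h_x (ε : ℤˣ) (i j : I) (r s : ℤ) (hr : r ≠ 0) :
      Rel G q (gh i r * gx ε j s - gx ε j s * gh i r)
        ((((ε : ℤ) : ℂ) * (qInt q (r * cartan G i j) / (r : ℂ))) • gx ε j (r + s))
  | x_x (ε : ℤˣ) (i j : I) (r s : ℤ) :
      Rel G q
        (gx ε i (r + 1) * gx ε j s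
          - ((q ^ ((ε : ℤ) * cartan G i j) : ℂˣ) : ℂ) • (gx ε j s * gx ε i (r + 1)))
        (((q ^ ((ε : ℤ) * cartan G i j) : ℂˣ) : ℂ) • (gx ε i r * gx ε j (s + 1))
          - gx ε j (s + 1) * gx ε i r)
  | xp_xm (i j : I) (r s : ℤ) :
      Rel G q (gx 1 i r * gx (-1) j s - gx (-1) j s * gx 1 i r)
        (if i = j then
          ((q : ℂ) - ((q⁻¹ : ℂˣ) : ℂ))⁻¹ • (gφ 1 i (r + s) - gφ (-1) i (r + s)) else 0)
  /-- The Drinfeld–Serre relation for neighbours. -/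
  | serre_adj (ε : ℤˣ) (i j : I) (r₁ r₂ s : ℤ) (hij : G.Adj i j) :
      Rel G q (serreTerm q ε i j r₁ r₂ s + serreTerm q ε i j r₂ r₁ s) 0
  /-- The Drinfeld–Serre relation for distinct vertices which are not neighbours. -/
  | serre_nonadj (ε : ℤˣ) (i j : I) (r s : ℤ) (hne : i ≠ j) (hij : ¬ G.Adj i j) :
      Rel G q (gx ε i r * gx ε j s) (gx ε j s * gx ε i r)

end Rel

/-- The quantum affine algebra (with trivial central charge). -/
abbrev QAff (G : SimpleGraph I) [DecidableRel G.Adj] (q : ℂˣ) : Type _ := RingQuot (Rel G q)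

/-- The image of a generator in the quantum affine algebra. -/
def QAff.gen (G : SimpleGraph I) [DecidableRel G.Adj] (q : ℂˣ) (g : Gen I) : QAff G q :=
  RingQuot.mkAlgHom ℂ (Rel G q) (FreeAlgebra.ι ℂ g)

/-- Monomials in the `Y_{i,a}^{±1}`, `i ∈ I`, `a ∈ ℂˣ`, given by their exponents. -/
abbrev LMonomial (I : Type*) := I × ℂˣ →₀ ℤ

/-- The eigenvalue of `k_i` attached to the monomial `∏ Y_{i,a}^{u_{i,a}}`, namely
`q ^ (∑_a u_{i,a})`. -/
def kValue (q : ℂˣ) (m : LMonomial I) (i : I) : ℂ :=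
  ((q ^ (m.sum fun y u => if y.1 = i then u else 0) : ℂˣ) : ℂ)

/-- The eigenvalue of `h_{i,r}` attached to the monomial `∏ Y_{i,a}^{u_{i,a}}`, namely
`([r]_q / r) ∑_a u_{i,a} a^r`.  Equivalently, both series `φ^±_i(z) = ∑_r φ^±_{i,r} z^r` have as
eigenvalue the rational function `∏_a (q (1 - a q⁻¹ z) / (1 - a q z)) ^ u_{i,a}`, expanded at `0`
respectively at `∞`. -/
def hValue (q : ℂˣ) (m : LMonomial I) (i : I) (r : ℤ) : ℂ :=
  qInt q r / (r : ℂ) * m.sum fun y u => if y.1 = i then (u : ℂ) * ((y.2 ^ r : ℂˣ) : ℂ) else 0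

section Modules

variable (G : SimpleGraph I) [DecidableRel G.Adj] (q : ℂˣ)
  (V : Type*) [AddCommGroup V] [Module ℂ V] [Module (QAff G q) V] [IsScalarTower ℂ (QAff G q) V]

/-- The action of a generator on a module. -/
def act (g : Gen I) : Module.End ℂ V := Algebra.lsmul ℂ ℂ V (QAff.gen G q g)

/-- The `l`-weight space `V_m`: the common generalized eigenspace of the loop-Cartan
subalgebra (generated by the `k_i^{±1}` and the `h_{i,r}`) with the eigenvalues attached to `m`. -/
def lWeightSpace (m : LMonomial I) : Submodule ℂ V :=
  (⨅ i : I, (act G q V (Gen.k 1 i)).maxGenEigenspace (kValue q m i)) ⊓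
    ⨅ (i : I) (r : ℤ) (_ : r ≠ 0), (act G q V (Gen.h i r)).maxGenEigenspace (hValue q m i r)

/-- `V` is (a copy of) the simple module `L(m)`: the finite-dimensional simple module with
highest `l`-weight `m`. -/
structure IsSimpleOfHighestLWeight (m : LMonomial I) : Prop where
  finiteDimensional : FiniteDimensional ℂ V
  simple : IsSimpleModule (QAff G q) V
  exists_highest : ∃ v : V, v ≠ 0 ∧
    (∀ i r, act G q V (Gen.x 1 i r) v = 0) ∧
    (∀ i, act G q V (Gen.k 1 i) v = kValue q m i • v) ∧
    (∀ i r, r ≠ 0 → act G q V (Gen.h i r) v = hValue q m i r • v)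

/-- A monomial in the `Y_{i,p}^{±1}`, `(i, p) ∈ I^{≤ ξ}`, as a monomial in the `Y_{i,a}^{±1}`,
through `Y_{i,p} = Y_{i,q^p}`. -/
def toLMonomial {ξ : I → ℤ} (m : ILE ξ →₀ ℤ) : LMonomial I :=
  m.mapDomain fun y => (y.1.1, q ^ y.1.2)

/-- The truncated `q`-character `χ̃_q(V) = ∑_m dim(V_m) m`, where the sum is restricted to the
monomials `m` belonging to `𝒴^{≤ ξ}`; only finitely many terms are non-zero when `V` is
finite-dimensional. -/
def truncatedQChar (ξ : I → ℤ) : Torus ξ :=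
  ∑ᶠ m : ILE ξ →₀ ℤ,
    AddMonoidAlgebra.single m (Module.finrank ℂ (lWeightSpace G q V (toLMonomial q m)) : ℂ)

/-- The monomial `Y_{i,p} Y_{i,p+2} ⋯ Y_{i,ξ(i)}`, for `(i, p) ∈ I^{≤ ξ}`. -/
def krMonomial {ξ : I → ℤ} (y : ILE ξ) : ILE ξ →₀ ℤ :=
  ∑ d ∈ Finset.range (depth y + 1), Finsupp.single (atDepth ξ y.1.1 d) 1

/-- `V` is (a copy of) the Kirillov–Reshetikhin module
`X_{i,p} = L(Y_{i,p} Y_{i,p+2} ⋯ Y_{i,ξ(i)})`. -/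
def IsKR {ξ : I → ℤ} (y : ILE ξ) : Prop :=
  IsSimpleOfHighestLWeight G q V (toLMonomial q (krMonomial y))

end Modules

end Quantum

end HernandezLeclerc

end

/-!
Reversing the arrows at the successive letters of an adapted word acts on heights and roots by mesh
mutations, so that the roots `τ_Q^d(γ_j)` satisfy the mesh relations of the repetition quiver, and
those with `0 ≤ d < h` are all the roots. Extended to an odd function of `m`, the coefficients
`C̃_{ij}(m)` satisfy the same mesh relations; hence, up to a shift depending on `p`, they are the
values of a linear form at the roots `τ_Q^d(γ_j)`. The product of the `D̃_ξ(Y_{i,p+2k})`, `k < h`,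
telescopes to a product over `h` consecutive values of `d`, in which each positive root occurs
twice, with opposite exponents.

Every `l`-weight of `X_{i,p}` other than the highest one is its product with factors `A_{j,b}^{-1}`,
one of them with `(j, b) = (i, q^{ξ(i)+1})`, and therefore involves a variable outside `𝒴^{≤ ξ}`. So
the truncated `q`-character of `X_{i,p}` is its highest monomial. As `i` and `i*` together occur `h`
times in `(i_1, …, i_N)`, replacing `t` by `t + 2N` multiplies this monomial by
`Y_{i,p'} Y_{i,p'+2} ⋯ Y_{i,p'+2h-2}` for some `p'`, on which `D̃_ξ` is `1`.
-/

noncomputable section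

namespace HernandezLeclerc

section Roots

open Matrix Module

variable {I : Type*} [DecidableEq I]

theorem simpleRoot_injective : Function.Injective (simpleRoot : I → I → ℤ) := fun i j h => by
  by_contra hij
  simpa [simpleRoot, hij] using congrFun h i

theorem simpleRoot_nonneg (i : I) : 0 ≤ simpleRoot i :=
  Pi.single_nonneg.2 zero_le_one

variable {G : SimpleGraph I} [DecidableRel G.Adj]

theorem cartan_transpose : (cartan G)ᵀ = cartan G := by
  ext i j
  simp [cartan, eq_comm, G.adj_comm]

variable [Fintype I]

theorem sum_smul_simpleRoot (x : I → ℤ) : ∑ i, x i • simpleRoot i = x := by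
  ext j
  simp [simpleRoot, Pi.single_apply]

/-- `G` is a disjoint union of simply-laced Dynkin diagrams. -/
def IsFiniteType (G : SimpleGraph I) [DecidableRel G.Adj] : Prop :=
  ((cartan G).map (Int.cast : ℤ → ℝ)).PosDef

/-- The symmetric bilinear form on the root lattice given by the Cartan matrix. -/
def form (G : SimpleGraph I) [DecidableRel G.Adj] : LinearMap.BilinForm ℤ (I → ℤ) :=
  toBilin' (cartan G)

theorem form_apply (x y : I → ℤ) : form G x y = x ⬝ᵥ cartan G *ᵥ y :=
  toBilin'_apply' (cartan G) x y

theorem form_comm (x y : I → ℤ) : form G x y = form G y x := by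
  rw [form_apply, form_apply, dotProduct_mulVec, ← mulVec_transpose, cartan_transpose,
    dotProduct_comm]

theorem form_simpleRoot_left (i : I) (x : I → ℤ) :
    form G (simpleRoot i) x = (cartan G *ᵥ x) i := by
  simp [form_apply, simpleRoot]

theorem form_simpleRoot_simpleRoot (i j : I) :
    form G (simpleRoot i) (simpleRoot j) = cartan G i j := by
  rw [form_simpleRoot_left]
  simp [simpleRoot]

theorem form_simpleRoot_self (i : I) : form G (simpleRoot i) (simpleRoot i) = 2 := by
  simp [form_simpleRoot_simpleRoot, cartan]

theorem form_self_add (x y : I → ℤ) :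
    form G (x + y) (x + y) = form G x x + form G y y + 2 * form G x y := by
  simp only [map_add, LinearMap.add_apply, form_comm y x]
  ring

theorem form_self_sub (x y : I → ℤ) :
    form G (x - y) (x - y) = form G x x + form G y y - 2 * form G x y := by
  simp only [map_sub, LinearMap.sub_apply, form_comm y x]
  ring

theorem even_form_self (x : I → ℤ) : Even (form G x x) := by
  rw [← sum_smul_simpleRoot x]
  refine Finset.sum_induction _ (fun y => Even (form G y y)) (fun a b ha hb => ?_) (by simp)
    fun i _ => ?_
  · rw [form_self_add]
    exact (ha.add hb).add (even_two_mul _)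
  · simp only [map_smul, LinearMap.smul_apply, form_simpleRoot_self, smul_eq_mul]
    exact (even_two.mul_left _).mul_left _

theorem form_self_pos (hG : IsFiniteType G) {x : I → ℤ} (hx : x ≠ 0) : 0 < form G x x := by
  have hx' : (fun i => (x i : ℝ)) ≠ 0 := fun h =>
    hx (funext fun i => by simpa using congrFun h i)
  have hcast : ((form G x x : ℤ) : ℝ) = star (fun i => (x i : ℝ)) ⬝ᵥ
      ((cartan G).map (Int.cast : ℤ → ℝ)) *ᵥ fun i => (x i : ℝ) := by
    simp [form_apply, dotProduct, mulVec]
  exact_mod_cast hcast ▸ hG.dotProduct_mulVec_pos hx'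

theorem two_le_form_self (hG : IsFiniteType G) {x : I → ℤ} (hx : x ≠ 0) :
    2 ≤ form G x x := by
  have hpos := form_self_pos hG hx
  obtain ⟨k, hk⟩ := even_form_self (G := G) x
  lia

theorem cartan_mulVec_injective (hG : IsFiniteType G) :
    Function.Injective fun x : I → ℤ => cartan G *ᵥ x :=
  (injective_iff_map_eq_zero (cartan G).mulVecLin).2 fun x hx => by
    by_contra h0
    have hpos := form_self_pos hG h0
    rw [form_apply, ← mulVecLin_apply, hx, dotProduct_zero] at hpos
    exact hpos.false

/-! ## Reflections and roots -/

theorem simpleReflection_apply (i : I) (x : I → ℤ) :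
    simpleReflection G i x = x - form G (simpleRoot i) x • simpleRoot i := by
  rw [form_simpleRoot_left, simpleReflection, reflection_apply]
  simp [simpleCoroot]

theorem simpleReflection_apply_of_ne {i j : I} (h : j ≠ i) (x : I → ℤ) :
    simpleReflection G i x j = x j := by
  simp [simpleReflection_apply, simpleRoot, h]

theorem simpleReflection_simpleRoot_self (i : I) :
    simpleReflection G i (simpleRoot i) = -simpleRoot i :=
  reflection_apply_self (simpleCoroot_simpleRoot G i)

theorem simpleReflection_simpleRoot_of_ne {i j : I} (h : j ≠ i) :
    simpleReflection G i (simpleRoot j) =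
      simpleRoot j + if G.Adj i j then simpleRoot i else 0 := by
  rw [simpleReflection_apply, form_simpleRoot_simpleRoot, cartan, if_neg h.symm]
  split_ifs <;> simp

theorem simpleReflection_involutive (i : I) : Function.Involutive (simpleReflection G i) :=
  involutive_reflection (simpleCoroot_simpleRoot G i)

theorem simpleReflection_mul_self (i : I) : simpleReflection G i * simpleReflection G i = 1 :=
  LinearEquiv.ext (simpleReflection_involutive i)

theorem simpleReflection_inv (i : I) : (simpleReflection G i)⁻¹ = simpleReflection G i :=
  inv_eq_of_mul_eq_one_left (simpleReflection_mul_self i)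

theorem simpleReflection_mem_weylGroup (i : I) : simpleReflection G i ∈ weylGroup G :=
  Subgroup.subset_closure ⟨i, rfl⟩

theorem form_simpleReflection (i : I) (x y : I → ℤ) :
    form G (simpleReflection G i x) (simpleReflection G i y) = form G x y := by
  simp only [simpleReflection_apply, map_sub, LinearMap.sub_apply, map_smul, LinearMap.smul_apply,
    form_simpleRoot_self, form_comm x (simpleRoot i), smul_eq_mul]
  ring

theorem wordProd_nil : wordProd G ([] : List I) = 1 := rfl

theorem wordProd_cons (i : I) (l : List I) :
    wordProd G (i :: l) = simpleReflection G i * wordProd G l := by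
  simp [wordProd]

theorem wordProd_append (l l' : List I) :
    wordProd G (l ++ l') = wordProd G l * wordProd G l' := by
  simp [wordProd]

theorem wordProd_singleton (i : I) : wordProd G [i] = simpleReflection G i := by
  simp [wordProd]

theorem wordProd_reverse (l : List I) : wordProd G l.reverse = (wordProd G l)⁻¹ := by
  induction l with
  | nil => simp [wordProd_nil]
  | cons i l ih =>
    rw [List.reverse_cons, wordProd_append, ih, wordProd_singleton, wordProd_cons,
      _root_.mul_inv_rev, simpleReflection_inv]

theorem wordProd_mem_weylGroup (l : List I) : wordProd G l ∈ weylGroup G :=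
  Subgroup.list_prod_mem _ fun _ h => by
    obtain ⟨i, -, rfl⟩ := List.mem_map.1 h
    exact simpleReflection_mem_weylGroup i

variable {x y : (I → ℤ) ≃ₗ[ℤ] (I → ℤ)}

theorem exists_wordProd_eq (hx : x ∈ weylGroup G) : ∃ l : List I, wordProd G l = x := by
  induction hx using Subgroup.closure_induction with
  | mem x h =>
    obtain ⟨i, rfl⟩ := h
    exact ⟨[i], wordProd_singleton i⟩
  | one => exact ⟨[], rfl⟩
  | mul x y _ _ hx hy =>
    obtain ⟨l, rfl⟩ := hx
    obtain ⟨l', rfl⟩ := hy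
    exact ⟨l ++ l', wordProd_append l l'⟩
  | inv x _ hx =>
    obtain ⟨l, rfl⟩ := hx
    exact ⟨l.reverse, wordProd_reverse l⟩

theorem form_apply_apply (hx : x ∈ weylGroup G) (u v : I → ℤ) :
    form G (x u) (x v) = form G u v := by
  obtain ⟨l, rfl⟩ := exists_wordProd_eq hx
  clear hx
  induction l with
  | nil => rfl
  | cons i l ih =>
    rw [wordProd_cons, LinearEquiv.mul_apply, LinearEquiv.mul_apply, form_simpleReflection, ih]

theorem simpleReflection_mul_of_apply_eq (hx : x ∈ weylGroup G) {i j : I}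
    (h : x (simpleRoot i) = simpleRoot j) :
    simpleReflection G j * x = x * simpleReflection G i := by
  ext1 v
  simp only [LinearEquiv.mul_apply, simpleReflection_apply, map_sub, map_smul, ← h,
    form_apply_apply hx]

theorem simpleRoot_mem_roots (i : I) : simpleRoot i ∈ roots G := ⟨1, one_mem _, i, rfl⟩

theorem apply_mem_roots (hx : x ∈ weylGroup G) {β : I → ℤ} (h : β ∈ roots G) :
    x β ∈ roots G := by
  obtain ⟨y, hy, i, rfl⟩ := h
  exact ⟨x * y, mul_mem hx hy, i, rfl⟩

theorem neg_mem_roots {β : I → ℤ} (h : β ∈ roots G) : -β ∈ roots G := by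
  obtain ⟨x, hx, i, rfl⟩ := h
  exact ⟨x * simpleReflection G i, mul_mem hx (simpleReflection_mem_weylGroup i), i, by
    rw [LinearEquiv.mul_apply, simpleReflection_simpleRoot_self, map_neg]⟩

theorem form_self_of_mem_roots {β : I → ℤ} (h : β ∈ roots G) : form G β β = 2 := by
  obtain ⟨x, hx, i, rfl⟩ := h
  rw [form_apply_apply hx, form_simpleRoot_self]

theorem ne_zero_of_mem_roots {β : I → ℤ} (h : β ∈ roots G) : β ≠ 0 := by
  rintro rfl
  simpa using form_self_of_mem_roots h

theorem simpleRoot_mem_positiveRoots (i : I) : simpleRoot i ∈ positiveRoots G :=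
  ⟨simpleRoot_mem_roots i, simpleRoot_nonneg i⟩

theorem form_posPart_negPart_nonpos (x : I → ℤ) : form G x⁺ x⁻ ≤ 0 := by
  simp only [form_apply, dotProduct, mulVec, Finset.mul_sum]
  refine Finset.sum_nonpos fun i _ => Finset.sum_nonpos fun j _ => ?_
  have hi : 0 ≤ x⁺ i := posPart_nonneg x i
  have hj : 0 ≤ x⁻ j := negPart_nonneg x j
  by_cases hij : i = j
  · subst hij
    have : x⁺ i * x⁻ i = 0 := by
      rw [Pi.posPart_apply, Pi.negPart_apply]
      rcases le_total 0 (x i) with h | h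
      · rw [negPart_eq_zero.2 h, mul_zero]
      · rw [posPart_eq_zero.2 h, zero_mul]
    rw [mul_left_comm, this, mul_zero]
  · have : cartan G i j ≤ 0 := by
      simp only [cartan, hij, if_false]
      split_ifs <;> simp
    exact mul_nonpos_of_nonneg_of_nonpos hi (mul_nonpos_of_nonpos_of_nonneg this hj)

theorem nonneg_or_nonpos_of_mem_roots (hG : IsFiniteType G) {β : I → ℤ} (h : β ∈ roots G) :
    0 ≤ β ∨ β ≤ 0 := by
  by_contra! hβ
  have hpos := two_le_form_self hG (mt posPart_eq_zero.1 hβ.2)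
  have hneg := two_le_form_self hG (mt negPart_eq_zero.1 hβ.1)
  have hmixed := form_posPart_negPart_nonpos (G := G) β
  have hself := form_self_of_mem_roots h
  rw [← posPart_sub_negPart β, form_self_sub] at hself
  linarith

theorem mem_positiveRoots_or_neg_mem (hG : IsFiniteType G) {β : I → ℤ} (h : β ∈ roots G) :
    β ∈ positiveRoots G ∨ -β ∈ positiveRoots G :=
  (nonneg_or_nonpos_of_mem_roots hG h).imp (fun h' => ⟨h, h'⟩)
    fun h' => ⟨neg_mem_roots h, neg_nonneg.2 h'⟩

theorem neg_notMem_positiveRoots {β : I → ℤ} (h : β ∈ positiveRoots G) :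
    -β ∉ positiveRoots G := fun h' =>
  ne_zero_of_mem_roots h.1 (le_antisymm (neg_nonneg.1 h'.2) h.2)

/-! ## The exchange property -/

theorem eq_simpleRoot_of_neg_simpleReflection_mem {i : I} {β : I → ℤ} (h : β ∈ positiveRoots G)
    (h' : -simpleReflection G i β ∈ positiveRoots G) : β = simpleRoot i := by
  have hβ : β = β i • simpleRoot i := by
    ext j
    rcases eq_or_ne j i with rfl | hj
    · simp [simpleRoot]
    · have hneg := h'.2 j
      rw [Pi.neg_apply, simpleReflection_apply_of_ne hj] at hneg
      simpa [simpleRoot, hj] using le_antisymm (neg_nonneg.1 hneg) (h.2 j)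
  have hself := form_self_of_mem_roots h.1
  rw [hβ, map_smul, map_smul, LinearMap.smul_apply, form_simpleRoot_self] at hself
  have hone : β i = 1 := by
    simp only [smul_eq_mul] at hself
    nlinarith [h.2 i]
  rw [hβ, hone, one_smul]

theorem exists_eq_append_of_neg_mem (hG : IsFiniteType G) (l : List I) {β : I → ℤ}
    (h : β ∈ positiveRoots G) (h' : -(wordProd G l)⁻¹ β ∈ positiveRoots G) :
    ∃ l₁ i l₂, l = l₁ ++ i :: l₂ ∧ β = wordProd G l₁ (simpleRoot i) := by
  induction l generalizing β with
  | nil => exact (neg_notMem_positiveRoots h (by simpa [wordProd_nil] using h')).elim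
  | cons i l ih =>
    rcases mem_positiveRoots_or_neg_mem hG (apply_mem_roots (simpleReflection_mem_weylGroup i) h.1)
      with hs | hs
    · obtain ⟨l₁, j, l₂, rfl, hj⟩ := ih hs
        (by simpa [wordProd_cons, simpleReflection_inv] using h')
      refine ⟨i :: l₁, j, l₂, rfl, ?_⟩
      rw [wordProd_cons, LinearEquiv.mul_apply, ← hj, simpleReflection_involutive i β]
    · exact ⟨[], i, l, rfl, eq_simpleRoot_of_neg_simpleReflection_mem h hs⟩

theorem exists_wordProd_append_singleton_eq (hG : IsFiniteType G) {l : List I} {i : I}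
    (h : -wordProd G l (simpleRoot i) ∈ positiveRoots G) :
    ∃ l' : List I, l'.length < l.length ∧ wordProd G (l ++ [i]) = wordProd G l' := by
  obtain ⟨l₁, j, l₂, hl, hj⟩ := exists_eq_append_of_neg_mem hG l.reverse
    (simpleRoot_mem_positiveRoots i) (by rwa [wordProd_reverse, inv_inv])
  have hl' : l = l₂.reverse ++ j :: l₁.reverse := by
    rw [← List.reverse_reverse l, hl]
    simp
  have hj' : wordProd G l₁.reverse (simpleRoot i) = simpleRoot j := by
    rw [hj, wordProd_reverse, ← LinearEquiv.mul_apply, inv_mul_cancel]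
    rfl
  refine ⟨l₂.reverse ++ l₁.reverse, by simp [hl'], ?_⟩
  rw [hl', wordProd_append, wordProd_append, wordProd_cons, wordProd_append, wordProd_singleton,
    simpleReflection_mul_of_apply_eq (wordProd_mem_weylGroup _) hj', mul_assoc, mul_assoc,
    simpleReflection_mul_self, mul_one]

theorem eq_one_of_forall_mem_positiveRoots (hG : IsFiniteType G) (hx : x ∈ weylGroup G)
    (h : ∀ β ∈ positiveRoots G, x β ∈ positiveRoots G) : x = 1 := by
  obtain ⟨l, rfl⟩ := exists_wordProd_eq hx
  clear hx
  induction hn : l.length using Nat.strong_induction_on generalizing l with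
  | _ n ih =>
    rcases List.eq_nil_or_concat' l with rfl | ⟨l, i, rfl⟩
    · rfl
    have hneg : -wordProd G l (simpleRoot i) ∈ positiveRoots G := by
      simpa [wordProd_append, wordProd_singleton, simpleReflection_simpleRoot_self]
        using h _ (simpleRoot_mem_positiveRoots i)
    obtain ⟨l', hlt, heq⟩ := exists_wordProd_append_singleton_eq hG hneg
    rw [heq] at h ⊢
    exact ih _ (by simp [← hn]; lia) _ h rfl

/-! ## The longest element -/

theorem IsLongest.mul_eq_one (hG : IsFiniteType G) (hx : IsLongest G x) (hy : IsLongest G y) :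
    x * y = 1 :=
  eq_one_of_forall_mem_positiveRoots hG (mul_mem hx.1 hy.1) fun β hβ => by
    simpa using hx.2 _ (hy.2 β hβ)

theorem IsLongest.involutive (hG : IsFiniteType G) (hx : IsLongest G x) :
    Function.Involutive x :=
  LinearEquiv.congr_fun (hx.mul_eq_one hG hx)

theorem one_le_sum_of_mem_positiveRoots {β : I → ℤ} (h : β ∈ positiveRoots G) :
    1 ≤ ∑ i, β i := by
  have hne : ∑ i, β i ≠ 0 := fun h0 => ne_zero_of_mem_roots h.1 <| funext fun i =>
    (Finset.sum_eq_zero_iff_of_nonneg fun i _ => h.2 i).1 h0 i (Finset.mem_univ i)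
  have hnonneg := Finset.sum_nonneg fun i (_ : i ∈ Finset.univ) => h.2 i
  lia

theorem exists_eq_simpleRoot_of_sum_eq_one {β : I → ℤ} (h : 0 ≤ β) (hsum : ∑ i, β i = 1) :
    ∃ i, β = simpleRoot i := by
  obtain ⟨i, -, hi⟩ := Finset.exists_ne_zero_of_sum_ne_zero (hsum.trans_ne one_ne_zero)
  have hi' : 1 ≤ β i := by
    have : 0 ≤ β i := h i
    lia
  have hrest : ∑ j, (β - simpleRoot i) j = 0 := by simp [hsum, simpleRoot]
  have hle : 0 ≤ β - simpleRoot i := fun j => by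
    rcases eq_or_ne j i with rfl | hj
    · simpa [simpleRoot] using hi'
    · simpa [simpleRoot, hj] using h j
  exact ⟨i, sub_eq_zero.1 ((Fintype.sum_eq_zero_iff_of_nonneg hle).1 hrest)⟩

theorem IsLongest.sum_le_sum_neg (hx : IsLongest G x) {v : I → ℤ} (hv : 0 ≤ v) :
    ∑ i, v i ≤ ∑ i, (-x v) i := by
  have hxv : -x v = ∑ j, v j • -x (simpleRoot j) := by
    conv_lhs => rw [← sum_smul_simpleRoot v, map_sum, ← Finset.sum_neg_distrib]
    simp only [map_smul, smul_neg]
  simp only [hxv, Finset.sum_apply, Pi.smul_apply, smul_eq_mul]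
  rw [Finset.sum_comm]
  refine Finset.sum_le_sum fun j _ => ?_
  rw [← Finset.mul_sum]
  exact le_mul_of_one_le_right (hv j)
    (one_le_sum_of_mem_positiveRoots (hx.2 _ (simpleRoot_mem_positiveRoots j)))

theorem IsLongest.exists_apply_simpleRoot_eq (hG : IsFiniteType G) (hx : IsLongest G x) (i : I) :
    ∃ j, x (simpleRoot i) = -simpleRoot j := by
  have hpos := hx.2 _ (simpleRoot_mem_positiveRoots i)
  have hle := hx.sum_le_sum_neg hpos.2
  have hsum : ∑ k, simpleRoot i k = 1 := by simp [simpleRoot]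
  rw [map_neg, neg_neg, hx.involutive hG, hsum] at hle
  obtain ⟨j, hj⟩ := exists_eq_simpleRoot_of_sum_eq_one hpos.2
    (le_antisymm hle (one_le_sum_of_mem_positiveRoots hpos))
  exact ⟨j, neg_eq_iff_eq_neg.1 hj⟩

theorem IsLongest.apply_simpleRoot (hG : IsFiniteType G) (hx : IsLongest G x) (i : I) :
    x (simpleRoot i) = -simpleRoot (dualVertex G i) := by
  obtain ⟨j, hj⟩ := hx.exists_apply_simpleRoot_eq hG i
  obtain ⟨y, hy, hyi⟩ := @Classical.epsilon_spec_aux I ⟨i⟩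
    (fun j => ∃ y, IsLongest G y ∧ y (simpleRoot i) = -simpleRoot j) ⟨j, x, hx, hj⟩
  have hxy : x = y := by
    rw [← mul_left_inj x, hx.mul_eq_one hG hx, hy.mul_eq_one hG hx]
  rw [hxy, hyi]
  rfl

theorem IsLongest.dualVertex_involutive (hG : IsFiniteType G) (hx : IsLongest G x) :
    Function.Involutive (dualVertex G) := fun i => by
  have h := hx.involutive hG (simpleRoot i)
  rw [hx.apply_simpleRoot hG, map_neg, hx.apply_simpleRoot hG, neg_neg] at h
  exact simpleRoot_injective h

end Roots

section Quivers

variable {I : Type*} {G : SimpleGraph I}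

/-! ## Firing sources of a quiver -/

/-- `η` is a height function adapted to some orientation of `G`. -/
def IsHeight (G : SimpleGraph I) (η : I → ℤ) : Prop :=
  ∀ i j, G.Adj i j → η j = η i - 1 ∨ η i = η j - 1

/-- The orientation of `G` to which the height function `η` is adapted. -/
def heightQuiver (G : SimpleGraph I) (η : I → ℤ) : Digraph I where
  Adj i j := G.Adj i j ∧ η j = η i - 1

instance [DecidableRel G.Adj] (η : I → ℤ) : DecidableRel (heightQuiver G η).Adj :=
  inferInstanceAs (DecidableRel fun i j => G.Adj i j ∧ η j = η i - 1)

theorem isHeight_of_isOrientation {Q : Digraph I} (hQ : IsOrientation G Q) {ξ : I → ℤ}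
    (hξ : ∀ i j, Q.Adj i j → ξ j = ξ i - 1) : IsHeight G ξ := fun i j h =>
  (em (Q.Adj j i)).elim (fun hji => .inr (hξ j i hji)) fun hji => .inl (hξ i j ((hQ.2 i j h).2 hji))

theorem eq_heightQuiver {Q : Digraph I} (hQ : IsOrientation G Q) {ξ : I → ℤ}
    (hξ : ∀ i j, Q.Adj i j → ξ j = ξ i - 1) : Q = heightQuiver G ξ := by
  ext i j
  refine ⟨fun h => ⟨hQ.1 i j h, hξ i j h⟩, fun ⟨h, h'⟩ => (hQ.2 i j h).2 fun hji => ?_⟩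
  have := hξ j i hji
  lia

theorem isSource_heightQuiver_iff {η : I → ℤ} (hη : IsHeight G η) {i : I} :
    IsSource (heightQuiver G η) i ↔ ∀ k, G.Adj i k → η k = η i - 1 :=
  ⟨fun h k hk => (hη i k hk).resolve_right fun h' => h k ⟨hk.symm, h'⟩, fun h k hk => by
    have := h k hk.1.symm
    have := hk.2
    lia⟩

theorem height_induction [Finite I] (η : I → ℤ) {p : I → Prop}
    (h : ∀ j, (∀ k, η k = η j + 1 → p k) → p j) (j : I) : p j := by
  have hwf : WellFounded fun a b : I => η b < η a :=
    @Finite.wellFounded_of_trans_of_irrefl I _ _ ⟨fun _ _ _ hab hbc => hbc.trans hab⟩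
      ⟨fun _ => lt_irrefl _⟩
  induction j using hwf.induction with
  | _ j ih => exact h j fun k hk => ih k (by lia)

variable [DecidableEq I]

/-- The height function of the quiver obtained by reversing the arrows at the successive letters of
a word, each of which is supposed to be a source when its turn comes. -/
def lowered (η : I → ℤ) (l : List I) : I → ℤ := fun j => η j - 2 * (l.count j : ℤ)

theorem lowered_nil (η : I → ℤ) : lowered η [] = η := by
  ext j
  simp [lowered]

theorem lowered_append (η : I → ℤ) (l l' : List I) :
    lowered η (l ++ l') = lowered (lowered η l) l' := by
  ext j
  simp only [lowered, List.count_append]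
  push_cast
  ring

theorem lowered_cons (η : I → ℤ) (i : I) (l : List I) :
    lowered η (i :: l) = lowered (lowered η [i]) l :=
  lowered_append η [i] l

theorem lowered_singleton_self (η : I → ℤ) (i : I) : lowered η [i] i = η i - 2 := by
  simp [lowered]

theorem lowered_singleton_of_ne (η : I → ℤ) {i j : I} (h : j ≠ i) : lowered η [i] j = η j := by
  simp [lowered, h.symm]

/-- The height function analogue of `IsAdapted`: each letter of the word is at its turn a local
maximum, and is then lowered by `2`. -/
inductive IsFirable (G : SimpleGraph I) : (I → ℤ) → List I → Prop
  | nil (η : I → ℤ) : IsFirable G η []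
  | cons {η : I → ℤ} {i : I} {l : List I} (hi : ∀ k, G.Adj i k → η k = η i - 1)
      (hl : IsFirable G (lowered η [i]) l) : IsFirable G η (i :: l)

variable {η : I → ℤ}

theorem isFirable_append_iff {l l' : List I} :
    IsFirable G η (l ++ l') ↔ IsFirable G η l ∧ IsFirable G (lowered η l) l' := by
  induction l generalizing η with
  | nil => simp [lowered_nil, IsFirable.nil]
  | cons i l ih =>
    rw [List.cons_append, lowered_cons]
    refine ⟨fun h => ?_, fun h => ?_⟩
    · cases h with
      | cons hi hl => exact ⟨.cons hi (ih.1 hl).1, (ih.1 hl).2⟩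
    · obtain ⟨h, h'⟩ := h
      cases h with
      | cons hi hl => exact .cons hi (ih.2 ⟨hl, h'⟩)

theorem IsFirable.lowered_eq_of_adj {l₁ l₂ : List I} {i k : I}
    (h : IsFirable G η (l₁ ++ i :: l₂)) (hk : G.Adj i k) : lowered η l₁ k = lowered η l₁ i - 1 := by
  cases (isFirable_append_iff.1 h).2 with
  | cons hi _ => exact hi k hk

theorem isHeight_lowered_singleton (hη : IsHeight G η) {i : I}
    (hi : ∀ k, G.Adj i k → η k = η i - 1) : IsHeight G (lowered η [i]) := fun a b hab => by
  rcases eq_or_ne a i with rfl | ha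
  · rw [lowered_singleton_self, lowered_singleton_of_ne η hab.ne', hi b hab]
    lia
  rcases eq_or_ne b i with rfl | hb
  · rw [lowered_singleton_self, lowered_singleton_of_ne η ha, hi a hab.symm]
    lia
  · rw [lowered_singleton_of_ne η ha, lowered_singleton_of_ne η hb]
    exact hη a b hab

theorem IsFirable.isHeight_lowered {l : List I} (h : IsFirable G η l) (hη : IsHeight G η) :
    IsHeight G (lowered η l) := by
  induction h with
  | nil η => rwa [lowered_nil]
  | cons hi _ ih =>
    rw [lowered_cons]
    exact ih (isHeight_lowered_singleton hη hi)

theorem reflectQuiver_heightQuiver {i : I} (hi : ∀ k, G.Adj i k → η k = η i - 1) :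
    reflectQuiver i (heightQuiver G η) = heightQuiver G (lowered η [i]) := by
  ext a b
  have hadj : G.Adj a b ↔ G.Adj b a := G.adj_comm a b
  have ha := hi a
  have hb := hi b
  simp only [reflectQuiver, heightQuiver]
  rcases eq_or_ne i a with rfl | hai <;> rcases eq_or_ne i b with rfl | hbi <;>
    grind [lowered_singleton_self, lowered_singleton_of_ne]

theorem isAdapted_heightQuiver_iff (hη : IsHeight G η) {l : List I} :
    IsAdapted (heightQuiver G η) l ↔ IsFirable G η l := by
  induction l generalizing η with
  | nil => exact ⟨fun _ => .nil η, fun _ => trivial⟩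
  | cons i l ih =>
    rw [IsAdapted, isSource_heightQuiver_iff hη]
    constructor
    · rintro ⟨hi, hl⟩
      rw [reflectQuiver_heightQuiver hi, ih (isHeight_lowered_singleton hη hi)] at hl
      exact .cons hi hl
    · rintro (_ | ⟨hi, hl⟩)
      rw [reflectQuiver_heightQuiver hi, ih (isHeight_lowered_singleton hη hi)]
      exact ⟨hi, hl⟩

theorem isFirable_of_pairwise (hη : IsHeight G η) {l : List I} (hnd : l.Nodup)
    (hl : l.Pairwise fun i j => η j ≤ η i)
    (hout : ∀ i ∈ l, ∀ k ∉ l, G.Adj i k → η k = η i - 1) : IsFirable G η l := by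
  induction l generalizing η with
  | nil => exact .nil η
  | cons i l ih =>
    rw [List.nodup_cons] at hnd
    rw [List.pairwise_cons] at hl
    have hi : ∀ k, G.Adj i k → η k = η i - 1 := fun k hk => by
      by_cases hkl : k ∈ l
      · have := hl.1 k hkl
        have := hη i k hk
        lia
      · exact hout i List.mem_cons_self k (by simp [hkl, hk.ne']) hk
    have hlow : ∀ j ∈ l, lowered η [i] j = η j := fun j hj =>
      lowered_singleton_of_ne η (ne_of_mem_of_not_mem hj hnd.1)
    refine .cons hi (ih (isHeight_lowered_singleton hη hi) hnd.2
      (hl.2.imp_of_mem fun ha hb hab => by rwa [hlow _ ha, hlow _ hb]) fun j hj k hk hjk => ?_)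
    rw [hlow j hj]
    rcases eq_or_ne k i with rfl | hki
    · rw [lowered_singleton_self, hi j hjk.symm]
      ring
    · rw [lowered_singleton_of_ne η hki]
      exact hout j (List.mem_cons_of_mem _ hj) k (by simp [hki, hk]) hjk

theorem exists_nodup_isFirable [Finite I] (hη : IsHeight G η) :
    ∃ l : List I, l.Nodup ∧ (∀ i, i ∈ l) ∧ IsFirable G η l := by
  have := Fintype.ofFinite I
  set l := (Finset.univ : Finset I).toList.mergeSort fun i j => η j ≤ η i
  have hmem : ∀ i, i ∈ l := fun i => by simp [l]
  have hnd : l.Nodup := (List.mergeSort_perm _ _).nodup_iff.2 (Finset.nodup_toList _)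
  refine ⟨l, hnd, hmem, isFirable_of_pairwise hη hnd ?_ fun _ _ k hk => (hk (hmem k)).elim⟩
  simpa only [decide_eq_true_eq] using List.pairwise_mergeSort (le := fun i j => η j ≤ η i)
    (fun a b c => by simpa using fun hab hbc => hbc.trans hab)
    (fun a b => by simpa using le_total _ _) Finset.univ.toList

/-! ## Mesh mutations -/

variable [Fintype I] [DecidableRel G.Adj] {M : Type*} [AddCommGroup M]

/-- The mesh mutation at `i` of a family attached to the vertices. -/
def fire (G : SimpleGraph I) [DecidableRel G.Adj] (i : I) (u : I → M) : I → M :=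
  Function.update u i (-u i + ∑ k ∈ G.neighborFinset i, u k)

/-- The successive mesh mutations at the letters of a word. -/
def fireList (G : SimpleGraph I) [DecidableRel G.Adj] (l : List I) (u : I → M) : I → M :=
  l.foldl (fun u i => fire G i u) u

theorem fireList_append (l l' : List I) (u : I → M) :
    fireList G (l ++ l') u = fireList G l' (fireList G l u) :=
  List.foldl_append

theorem fireList_cons (i : I) (l : List I) (u : I → M) :
    fireList G (i :: l) u = fireList G l (fire G i u) := rfl

theorem fireList_of_notMem (l : List I) (u : I → M) {j : I} (hj : j ∉ l) :
    fireList G l u j = u j := by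
  induction l generalizing u with
  | nil => rfl
  | cons i l ih =>
    rw [List.mem_cons, not_or] at hj
    rw [fireList_cons, ih _ hj.2, fire, Function.update_of_ne hj.1]

theorem IsFirable.add_fireList {l : List I} (h : IsFirable G η l) (hnd : l.Nodup) (u : I → M)
    {j : I} (hj : j ∈ l) :
    u j + fireList G l u j =
      ∑ k ∈ G.neighborFinset j, if η k = η j + 1 then fireList G l u k else u k := by
  obtain ⟨l₁, l₂, rfl⟩ := List.append_of_mem hj
  obtain ⟨hnd₁, hnd₂, hdisj⟩ := List.nodup_append.1 hnd
  have hj₁ : j ∉ l₁ := fun hj₁ => hdisj j hj₁ j List.mem_cons_self rfl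
  have hmut : fireList G (l₁ ++ j :: l₂) u j =
      -u j + ∑ k ∈ G.neighborFinset j, fireList G l₁ u k := by
    rw [fireList_append, fireList_cons, fireList_of_notMem l₂ _ (List.nodup_cons.1 hnd₂).1, fire,
      Function.update_self, fireList_of_notMem l₁ u hj₁]
  rw [hmut, add_neg_cancel_left]
  refine Finset.sum_congr rfl fun k hk => ?_
  have hlow := h.lowered_eq_of_adj ((G.mem_neighborFinset j k).1 hk)
  rw [lowered, lowered, List.count_eq_zero_of_not_mem hj₁] at hlow
  by_cases hk₁ : k ∈ l₁
  · rw [List.count_eq_one_of_mem hnd₁ hk₁] at hlow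
    have hk₂ : k ∉ j :: l₂ := fun hk₂ => hdisj k hk₁ k hk₂ rfl
    rw [if_pos (by lia), fireList_append, fireList_of_notMem _ _ hk₂]
  · rw [List.count_eq_zero_of_not_mem hk₁] at hlow
    rw [if_neg (by lia), fireList_of_notMem l₁ u hk₁]

/-- The mesh relations of the repetition quiver, `B j d` standing for the value at
`(j, ξ(j) - 2d)`. -/
def IsMesh (G : SimpleGraph I) [DecidableRel G.Adj] (ξ : I → ℤ) (B : I → ℕ → M) : Prop :=
  ∀ j d, B j d + B j (d + 1) =
    ∑ k ∈ G.neighborFinset j, if ξ k = ξ j + 1 then B k (d + 1) else B k d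

theorem IsMesh.fireList_eq {ξ : I → ℤ} {B : I → ℕ → M} (hB : IsMesh G ξ B) (hξ : IsHeight G ξ)
    {l : List I} (hl : IsFirable G ξ l) :
    fireList G l (fun j => B j 0) = fun j => B j (l.count j) := by
  induction l using List.reverseRecOn with
  | nil => rfl
  | append_singleton l i ih =>
    ext1 j
    rw [fireList_append, ih (isFirable_append_iff.1 hl).1]
    rcases eq_or_ne j i with rfl | hj
    · rw [fireList_cons, fire, List.count_append, List.count_singleton_self]
      simp only [fireList, List.foldl_nil, Function.update_self]
      rw [neg_add_eq_iff_eq_add, hB j]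
      refine Finset.sum_congr rfl fun k hk => ?_
      rw [SimpleGraph.mem_neighborFinset] at hk
      have hlow := hl.lowered_eq_of_adj hk
      have hadj := hξ j k hk
      rw [lowered, lowered] at hlow
      split_ifs
      · rw [show l.count k = l.count j + 1 by lia]
      · rw [show l.count k = l.count j by lia]
    · rw [fireList_of_notMem _ _ (by simpa using hj)]
      simp [hj.symm]

/-! ## Families of roots attached to a quiver -/

/-- `u j` is the image under `W` of the sum of the `α_k` over all paths from `k` to `j` in the
quiver of `η`. -/
def IsRootFamily (G : SimpleGraph I) [DecidableRel G.Adj] (η : I → ℤ)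
    (W : (I → ℤ) ≃ₗ[ℤ] (I → ℤ)) (u : I → I → ℤ) : Prop :=
  ∀ j, u j = W (simpleRoot j) + ∑ k with (heightQuiver G η).Adj k j, u k

variable {W : (I → ℤ) ≃ₗ[ℤ] (I → ℤ)} {u u' : I → I → ℤ}

theorem IsRootFamily.eq_of_forall_adj (h : IsRootFamily G η W u) {i : I}
    (hi : ∀ k, G.Adj i k → η k = η i - 1) : u i = W (simpleRoot i) := by
  rw [h i, Finset.sum_eq_zero, add_zero]
  intro k hk
  obtain ⟨hadj, hlt⟩ := (Finset.mem_filter.1 hk).2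
  have := hi k hadj.symm
  lia

theorem IsRootFamily.unique (h : IsRootFamily G η W u) (h' : IsRootFamily G η W u') : u = u' := by
  ext1 j
  induction j using height_induction η with
  | h j ih =>
    rw [h j, h' j]
    congr 1
    exact Finset.sum_congr rfl fun k hk => ih k (by have := (Finset.mem_filter.1 hk).2.2; lia)

theorem IsRootFamily.map (h : IsRootFamily G η W u) (x : (I → ℤ) ≃ₗ[ℤ] (I → ℤ)) :
    IsRootFamily G η (x * W) fun j => x (u j) := fun j => by
  conv_lhs => beta_reduce; rw [h j]
  rw [map_add, map_sum, LinearEquiv.mul_apply]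

theorem filter_heightQuiver_adj_lowered_self {i : I} (hi : ∀ k, G.Adj i k → η k = η i - 1) :
    ({k | (heightQuiver G (lowered η [i])).Adj k i} : Finset I) = G.neighborFinset i := by
  ext k
  rw [Finset.mem_filter_univ, SimpleGraph.mem_neighborFinset]
  refine ⟨fun hk => hk.1.symm, fun hk => ⟨hk.symm, ?_⟩⟩
  rw [lowered_singleton_self, lowered_singleton_of_ne η hk.ne', hi k hk]
  ring

theorem sum_heightQuiver_adj_eq_add {i j : I} (hi : ∀ k, G.Adj i k → η k = η i - 1) (hj : j ≠ i)
    (u : I → M) :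
    ∑ k with (heightQuiver G η).Adj k j, u k =
      (if G.Adj i j then u i else 0) + ∑ k with (heightQuiver G (lowered η [i])).Adj k j, u k := by
  have herase : ({k | (heightQuiver G (lowered η [i])).Adj k j} : Finset I) =
      ({k | (heightQuiver G η).Adj k j} : Finset I).erase i := by
    ext k
    rw [Finset.mem_erase, Finset.mem_filter_univ, Finset.mem_filter_univ]
    simp only [heightQuiver, lowered_singleton_of_ne η hj]
    rcases eq_or_ne k i with rfl | hk
    · rw [lowered_singleton_self]
      have := hi j
      grind
    · simp [hk, lowered_singleton_of_ne η hk]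
  rw [herase]
  split_ifs with hij
  · exact (Finset.add_sum_erase _ u (by simpa using ⟨hij, hi j hij⟩)).symm
  · rw [zero_add, Finset.erase_eq_of_notMem (by simpa using fun h => hij h.1)]

theorem IsRootFamily.fire (h : IsRootFamily G η W u) {i : I}
    (hi : ∀ k, G.Adj i k → η k = η i - 1) :
    IsRootFamily G (lowered η [i]) (W * simpleReflection G i) (fire G i u) := fun j => by
  have hui := h.eq_of_forall_adj hi
  have hfire : ∀ k ≠ i, HernandezLeclerc.fire G i u k = u k := fun k hk =>
    Function.update_of_ne hk ..
  rw [LinearEquiv.mul_apply]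
  rcases eq_or_ne j i with rfl | hj
  · rw [filter_heightQuiver_adj_lowered_self hi, simpleReflection_simpleRoot_self, map_neg, ← hui,
      HernandezLeclerc.fire, Function.update_self]
    exact congrArg _ (Finset.sum_congr rfl fun k hk =>
      (hfire k ((G.mem_neighborFinset j k).1 hk).ne').symm)
  · have hsum : ∑ k with (heightQuiver G (lowered η [i])).Adj k j, HernandezLeclerc.fire G i u k =
        ∑ k with (heightQuiver G (lowered η [i])).Adj k j, u k := by
      refine Finset.sum_congr rfl fun k hk => hfire k ?_
      rintro rfl
      obtain ⟨hkj, hlow⟩ := (Finset.mem_filter.1 hk).2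
      rw [lowered_singleton_of_ne η hj, lowered_singleton_self, hi j hkj] at hlow
      lia
    rw [hfire j hj, h j, sum_heightQuiver_adj_eq_add hi hj, hsum,
      simpleReflection_simpleRoot_of_ne hj, map_add, apply_ite W, map_zero, ← hui, add_assoc]

theorem IsRootFamily.fireList {l : List I} (hl : IsFirable G η l) (h : IsRootFamily G η W u) :
    IsRootFamily G (lowered η l) (W * wordProd G l) (fireList G l u) := by
  induction hl generalizing W u with
  | nil η => rwa [lowered_nil, wordProd_nil, mul_one]
  | cons hi _ ih =>
    rw [lowered_cons, wordProd_cons, ← mul_assoc]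
    exact ih (h.fire hi)

end Quivers

section Repetition

open Relation

variable {I : Type*} {G : SimpleGraph I} {η : I → ℤ}

/-! ## The roots `γ_j` and the Coxeter element -/

theorem height_le_of_reflTransGen {i j : I} (h : ReflTransGen (heightQuiver G η).Adj i j) :
    η j ≤ η i := by
  induction h with
  | refl => rfl
  | tail _ h ih =>
    have := h.2
    lia

theorem eq_of_reflTransGen_of_le {i j : I} (h : ReflTransGen (heightQuiver G η).Adj i j)
    (hle : η i ≤ η j) : i = j := by
  rcases h.cases_head with h | ⟨k, hik, hkj⟩
  · exact h
  · have := height_le_of_reflTransGen hkj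
    have := hik.2
    lia

theorem not_reflTransGen_of_adj {i j : I} (h : (heightQuiver G η).Adj i j) :
    ¬ ReflTransGen (heightQuiver G η).Adj j i := fun hji => by
  have := height_le_of_reflTransGen hji
  have := h.2
  lia

theorem gammaRoot_apply_of_reflTransGen {Q : Digraph I} {i j : I} (h : ReflTransGen Q.Adj i j) :
    gammaRoot Q j i = 1 :=
  if_pos h

theorem gammaRoot_apply_of_not_reflTransGen {Q : Digraph I} {i j : I}
    (h : ¬ ReflTransGen Q.Adj i j) : gammaRoot Q j i = 0 :=
  if_neg h

theorem gammaRoot_self (Q : Digraph I) (j : I) : gammaRoot Q j j = 1 :=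
  gammaRoot_apply_of_reflTransGen .refl

theorem gammaRoot_nonneg (Q : Digraph I) (j : I) : 0 ≤ gammaRoot Q j := fun i => by
  rw [gammaRoot]
  split_ifs <;> simp

theorem reflTransGen_of_gammaRoot_ne_zero {Q : Digraph I} {i j : I} (h : gammaRoot Q j i ≠ 0) :
    ReflTransGen Q.Adj i j :=
  of_not_not fun hij => h (gammaRoot_apply_of_not_reflTransGen hij)

theorem gammaRoot_injective : Function.Injective (gammaRoot (heightQuiver G η)) := fun i j h => by
  have hij : ReflTransGen (heightQuiver G η).Adj i j :=
    reflTransGen_of_gammaRoot_ne_zero (by rw [← h, gammaRoot_self]; exact one_ne_zero)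
  have hji : ReflTransGen (heightQuiver G η).Adj j i :=
    reflTransGen_of_gammaRoot_ne_zero (by rw [h, gammaRoot_self]; exact one_ne_zero)
  exact eq_of_reflTransGen_of_le hij (height_le_of_reflTransGen hji)

variable [DecidableEq I] [DecidableRel G.Adj]

theorem cartan_eq_sub_sub (hη : IsHeight G η) (i j : I) :
    cartan G i j = (if i = j then 2 else 0) - (if (heightQuiver G η).Adj j i then 1 else 0) -
      if (heightQuiver G η).Adj i j then 1 else 0 := by
  have hij := hη i j
  have hadj : G.Adj i j ↔ G.Adj j i := G.adj_comm i j
  rcases eq_or_ne i j with rfl | hne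
  · simp [cartan, heightQuiver]
  · simp only [cartan, heightQuiver, hne, if_false]
    grind

theorem form_sum_simpleRoot [Fintype I] (hη : IsHeight G η) (s : Finset I) :
    form G (∑ i ∈ s, simpleRoot i) (∑ i ∈ s, simpleRoot i) =
      2 * (s.card - ∑ j ∈ s, ∑ i ∈ s, if (heightQuiver G η).Adj i j then 1 else 0) := by
  have hcomm : ∑ i ∈ s, ∑ j ∈ s, (if (heightQuiver G η).Adj i j then (1 : ℤ) else 0) =
      ∑ j ∈ s, ∑ i ∈ s, if (heightQuiver G η).Adj i j then 1 else 0 := Finset.sum_comm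
  simp only [map_sum, LinearMap.sum_apply, form_simpleRoot_simpleRoot, cartan_eq_sub_sub hη,
    Finset.sum_sub_distrib, hcomm]
  simp
  ring

/-- Finite type forbids cycles: there are fewer arrows than vertices. -/
theorem sum_adj_lt_card [Finite I] (hG : IsFiniteType G) (hη : IsHeight G η) {s : Finset I}
    (hs : s.Nonempty) :
    ∑ j ∈ s, ∑ i ∈ s, (if (heightQuiver G η).Adj i j then (1 : ℤ) else 0) < s.card := by
  cases nonempty_fintype I
  obtain ⟨l, hl⟩ := hs
  have hpos : 0 < form G (∑ i ∈ s, simpleRoot i) (∑ i ∈ s, simpleRoot i) := by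
    refine form_self_pos hG fun h => ?_
    simpa [simpleRoot, Finset.sum_apply, Pi.single_apply, hl] using congrFun h l
  rw [form_sum_simpleRoot hη] at hpos
  lia

/-- The vertices reachable from `l` span a quiver in which every vertex other than `l` is the
target of an arrow; two arrows into the same vertex would make too many of them. -/
theorem eq_of_reflTransGen_of_adj [Finite I] (hG : IsFiniteType G) (hη : IsHeight G η)
    {j k k' l : I} (hk : (heightQuiver G η).Adj k j) (hk' : (heightQuiver G η).Adj k' j)
    (hl : ReflTransGen (heightQuiver G η).Adj l k)
    (hl' : ReflTransGen (heightQuiver G η).Adj l k') : k = k' := by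
  classical
  cases nonempty_fintype I
  by_contra hne
  set s : Finset I := {i | ReflTransGen (heightQuiver G η).Adj l i}
  set arrowsTo : I → ℤ := fun j => ∑ i ∈ s, if (heightQuiver G η).Adj i j then 1 else 0
  have hterm : ∀ i j, (0 : ℤ) ≤ if (heightQuiver G η).Adj i j then 1 else 0 := fun i j => by
    split_ifs <;> simp
  have hnonneg : ∀ j, 0 ≤ arrowsTo j := fun j => Finset.sum_nonneg fun i _ => hterm i j
  have hone : ∀ i ∈ s, i ≠ l → 1 ≤ arrowsTo i := fun i hi hil => by
    obtain ⟨c, hlc, hci⟩ := ((Finset.mem_filter_univ i).1 hi).cases_tail.resolve_left hil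
    refine le_trans ?_ (Finset.single_le_sum (fun c _ => hterm c i)
      ((Finset.mem_filter_univ c).2 hlc))
    rw [if_pos hci]
  have htwo : 2 ≤ arrowsTo j := by
    refine le_trans ?_ (Finset.add_le_sum (fun c _ => hterm c j)
      ((Finset.mem_filter_univ k).2 hl) ((Finset.mem_filter_univ k').2 hl') hne)
    rw [if_pos hk, if_pos hk']
    rfl
  have hls : l ∈ s := (Finset.mem_filter_univ l).2 .refl
  have hjs : j ∈ s := (Finset.mem_filter_univ j).2 (hl.tail hk)
  have hcard : (s.card : ℤ) ≤ ∑ i ∈ s, arrowsTo i := by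
    calc (s.card : ℤ)
        = ∑ i ∈ s, (1 - (if i = l then 1 else 0) + if i = j then 1 else 0) := by
          simp [Finset.sum_add_distrib, hls, hjs]
      _ ≤ _ := Finset.sum_le_sum fun i hi => by
          have hlj : l ≠ j := by
            rintro rfl
            exact not_reflTransGen_of_adj hk hl
          have := hnonneg i
          have := hone i hi
          grind
  exact (sum_adj_lt_card hG hη ⟨l, hls⟩).not_ge hcard

variable [Fintype I]

theorem isRootFamily_gammaRoot (hG : IsFiniteType G) (hη : IsHeight G η) :
    IsRootFamily G η 1 (gammaRoot (heightQuiver G η)) := fun j => by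
  ext l
  rw [Pi.add_apply, Finset.sum_apply, LinearEquiv.coe_one, id]
  by_cases hl : ∃ k, (heightQuiver G η).Adj k j ∧ ReflTransGen (heightQuiver G η).Adj l k
  · obtain ⟨k, hkj, hlk⟩ := hl
    have hlj : j ≠ l := by
      rintro rfl
      exact not_reflTransGen_of_adj hkj hlk
    rw [gammaRoot_apply_of_reflTransGen (hlk.tail hkj), Finset.sum_eq_single_of_mem k (by simpa),
      gammaRoot_apply_of_reflTransGen hlk, simpleRoot, Pi.single_eq_of_ne hlj.symm, zero_add]
    exact fun k' hk' hne => gammaRoot_apply_of_not_reflTransGen fun hlk' =>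
      hne (eq_of_reflTransGen_of_adj hG hη (Finset.mem_filter.1 hk').2 hkj hlk' hlk)
  · rw [Finset.sum_eq_zero fun k hk => gammaRoot_apply_of_not_reflTransGen fun hlk =>
      hl ⟨k, (Finset.mem_filter.1 hk).2, hlk⟩, add_zero]
    rcases eq_or_ne l j with rfl | hlj
    · simp [gammaRoot_self, simpleRoot]
    · rw [simpleRoot, Pi.single_eq_of_ne hlj, gammaRoot_apply_of_not_reflTransGen fun h =>
        hl ((h.cases_tail.resolve_left hlj.symm).imp fun _ => And.symm)]

theorem fireList_gammaRoot (hG : IsFiniteType G) (hη : IsHeight G η) {l : List I}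
    (hl : IsFirable G η l) :
    fireList G l (gammaRoot (heightQuiver G η)) =
      fun j => wordProd G l (gammaRoot (heightQuiver G (lowered η l)) j) := by
  have hfire := (isRootFamily_gammaRoot hG hη).fireList hl
  rw [one_mul] at hfire
  have hmap := (isRootFamily_gammaRoot hG (hl.isHeight_lowered hη)).map (wordProd G l)
  rw [mul_one] at hmap
  exact hfire.unique hmap

theorem exists_coxeter_eq_wordProd (hη : IsHeight G η) :
    ∃ l : List I, l.Nodup ∧ (∀ i, i ∈ l) ∧ IsFirable G η l ∧
      coxeter G (heightQuiver G η) = wordProd G l := by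
  obtain ⟨l, hnd, hmem, hl⟩ := exists_nodup_isFirable hη
  obtain ⟨l', hnd', hmem', hl', heq⟩ := Classical.epsilon_spec
    (p := IsAdaptedCoxeter G (heightQuiver G η))
    ⟨_, l, hnd, hmem, (isAdapted_heightQuiver_iff hη).2 hl, rfl⟩
  exact ⟨l', hnd', hmem', (isAdapted_heightQuiver_iff hη).1 hl', heq⟩

theorem coxeter_mem_weylGroup (hη : IsHeight G η) :
    coxeter G (heightQuiver G η) ∈ weylGroup G := by
  obtain ⟨l, -, -, -, hτ⟩ := exists_coxeter_eq_wordProd hη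
  exact hτ ▸ wordProd_mem_weylGroup l

/-- The root `τ_Q^d(γ_j)`. -/
def rootAt (G : SimpleGraph I) [DecidableRel G.Adj] (Q : Digraph I) (j : I) (d : ℕ) : I → ℤ :=
  (coxeter G Q ^ d) (gammaRoot Q j)

theorem rootAt_zero (Q : Digraph I) (j : I) : rootAt G Q j 0 = gammaRoot Q j := rfl

theorem rootAt_succ (Q : Digraph I) (j : I) (d : ℕ) :
    rootAt G Q j (d + 1) = coxeter G Q (rootAt G Q j d) := by
  rw [rootAt, pow_succ']
  rfl

theorem isMesh_rootAt (hG : IsFiniteType G) (hη : IsHeight G η) :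
    IsMesh G η (rootAt G (heightQuiver G η)) := fun j d => by
  induction d with
  | zero =>
    obtain ⟨l, hnd, hmem, hl, hτ⟩ := exists_coxeter_eq_wordProd hη
    have hlow : heightQuiver G (lowered η l) = heightQuiver G η := by
      ext i k
      simp only [heightQuiver, lowered, List.count_eq_one_of_mem hnd (hmem _)]
      lia
    have h := hl.add_fireList hnd (gammaRoot (heightQuiver G η)) (hmem j)
    rw [fireList_gammaRoot hG hη hl, hlow, ← hτ] at h
    exact h
  | succ d ih =>
    rw [rootAt_succ _ j d, rootAt_succ _ j (d + 1), ← map_add, ih, map_sum]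
    simp only [apply_ite (coxeter G (heightQuiver G η)), ← rootAt_succ]

theorem rootAt_count_eq_fireList (hG : IsFiniteType G) (hη : IsHeight G η) {l : List I}
    (hl : IsFirable G η l) (j : I) :
    rootAt G (heightQuiver G η) j (l.count j) =
      fireList G l (gammaRoot (heightQuiver G η)) j :=
  (congrFun ((isMesh_rootAt hG hη).fireList_eq hη hl) j).symm

theorem wordProd_gammaRoot (hG : IsFiniteType G) (hη : IsHeight G η) {l : List I}
    (hl : IsFirable G η l) (j : I) :
    wordProd G l (gammaRoot (heightQuiver G (lowered η l)) j) =
      rootAt G (heightQuiver G η) j (l.count j) := by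
  rw [rootAt_count_eq_fireList hG hη hl, fireList_gammaRoot hG hη hl]

theorem wordProd_simpleRoot (hG : IsFiniteType G) (hη : IsHeight G η) {l₁ l₂ : List I} {i : I}
    (hl : IsFirable G η (l₁ ++ i :: l₂)) :
    wordProd G l₁ (simpleRoot i) = rootAt G (heightQuiver G η) i (l₁.count i) := by
  have hl₁ := (isFirable_append_iff.1 hl).1
  rw [← wordProd_gammaRoot hG hη hl₁, (isRootFamily_gammaRoot hG
    (hl₁.isHeight_lowered hη)).eq_of_forall_adj fun _ => hl.lowered_eq_of_adj]
  rfl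

theorem gammaRoot_mem_positiveRoots (hG : IsFiniteType G) (hη : IsHeight G η) (j : I) :
    gammaRoot (heightQuiver G η) j ∈ positiveRoots G := by
  obtain ⟨l, -, hmem, hl, -⟩ := exists_coxeter_eq_wordProd hη
  obtain ⟨l₁, l₂, rfl, hj⟩ := List.eq_append_cons_of_mem (hmem j)
  have h := wordProd_simpleRoot hG hη hl
  rw [List.count_eq_zero_of_not_mem hj, rootAt_zero] at h
  exact ⟨h ▸ apply_mem_roots (wordProd_mem_weylGroup l₁) (simpleRoot_mem_roots j),
    gammaRoot_nonneg _ j⟩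

theorem exists_eq_gammaRoot_of_neg_coxeter_inv_mem (hG : IsFiniteType G) (hη : IsHeight G η)
    {β : I → ℤ} (hβ : β ∈ positiveRoots G)
    (hneg : -(coxeter G (heightQuiver G η))⁻¹ β ∈ positiveRoots G) :
    ∃ i, β = gammaRoot (heightQuiver G η) i := by
  obtain ⟨l, hnd, -, hl, hτ⟩ := exists_coxeter_eq_wordProd hη
  rw [hτ] at hneg
  obtain ⟨l₁, i, l₂, rfl, rfl⟩ := exists_eq_append_of_neg_mem hG l hβ hneg
  have hi : i ∉ l₁ := fun h => (List.nodup_append.1 hnd).2.2 i h i List.mem_cons_self rfl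
  exact ⟨i, by rw [wordProd_simpleRoot hG hη hl, List.count_eq_zero_of_not_mem hi, rootAt_zero]⟩

/-! ## Adapted reduced words of the longest element -/

theorem wordProd_simpleRoot_mem_positiveRoots (hG : IsFiniteType G) {l₁ l₂ : List I} {i : I}
    (hw : IsLongest G (wordProd G (l₁ ++ i :: l₂)))
    (hlen : (l₁ ++ i :: l₂).length = numPos G) :
    wordProd G l₁ (simpleRoot i) ∈ positiveRoots G := by
  set l := l₁ ++ i :: l₂ with hl
  set root : Fin l.length → I → ℤ := fun t => wordProd G (l.take t) (simpleRoot l[t]) with hroot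
  have hsub : positiveRoots G ⊆ Set.range root := fun β hβ => by
    obtain ⟨m₁, k, m₂, hm, rfl⟩ := exists_eq_append_of_neg_mem hG l hβ
      (by rw [inv_eq_of_mul_eq_one_left (hw.mul_eq_one hG hw)]; exact hw.2 β hβ)
    exact ⟨⟨m₁.length, by simp [hm]⟩, by simp [hroot, hm]⟩
  have heq : positiveRoots G = Set.range root := by
    refine Set.eq_of_subset_of_ncard_le hsub ?_ (Set.finite_range root)
    rw [← Nat.card_coe_set_eq (positiveRoots G)]
    refine le_trans ?_ hlen.le
    rw [← Set.image_univ]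
    exact (Set.ncard_image_le Set.finite_univ).trans_eq (by simp [Set.ncard_univ])
  rw [heq]
  exact ⟨⟨l₁.length, by simp [hl]⟩, by simp [hroot, hl]⟩

variable {l : List I}

theorem neg_rootAt_count_mem_positiveRoots (hG : IsFiniteType G) (hη : IsHeight G η)
    (hl : IsFirable G η l) (hw : IsLongest G (wordProd G l)) (j : I) :
    -rootAt G (heightQuiver G η) j (l.count j) ∈ positiveRoots G := by
  rw [← wordProd_gammaRoot hG hη hl]
  exact hw.2 _ (gammaRoot_mem_positiveRoots hG (hl.isHeight_lowered hη) j)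

theorem mem_of_isLongest (hG : IsFiniteType G) (hη : IsHeight G η) (hl : IsFirable G η l)
    (hw : IsLongest G (wordProd G l)) (j : I) : j ∈ l := by
  by_contra hj
  have h := neg_rootAt_count_mem_positiveRoots hG hη hl hw j
  rw [List.count_eq_zero_of_not_mem hj, rootAt_zero] at h
  exact neg_notMem_positiveRoots (gammaRoot_mem_positiveRoots hG hη j) h

theorem exists_rootAt_count_eq (hG : IsFiniteType G) (hη : IsHeight G η) (hl : IsFirable G η l)
    (hw : IsLongest G (wordProd G l)) (hlen : l.length = numPos G) (j : I) :
    ∃ i, rootAt G (heightQuiver G η) j (l.count j) = -gammaRoot (heightQuiver G η) i := by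
  -- split `l` at the last occurrence of `j`
  obtain ⟨r₂, r₁, hr, hj₂⟩ := List.eq_append_cons_of_mem
    (List.mem_reverse.2 (mem_of_isLongest hG hη hl hw j))
  have hsplit : l = r₁.reverse ++ j :: r₂.reverse := by
    rw [← List.reverse_reverse l, hr]
    simp
  have hcount : l.count j = r₁.reverse.count j + 1 := by
    rw [hsplit]
    simp [List.count_eq_zero_of_not_mem hj₂]
  have hpos : rootAt G (heightQuiver G η) j (r₁.reverse.count j) ∈ positiveRoots G := by
    rw [← wordProd_simpleRoot hG hη (hsplit ▸ hl)]
    exact wordProd_simpleRoot_mem_positiveRoots hG (hsplit ▸ hw) (hsplit ▸ hlen)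
  obtain ⟨i, hi⟩ := exists_eq_gammaRoot_of_neg_coxeter_inv_mem hG hη
    (neg_rootAt_count_mem_positiveRoots hG hη hl hw j) (by
      rw [hcount, rootAt_succ, map_neg, neg_neg, ← LinearEquiv.mul_apply, inv_mul_cancel]
      exact hpos)
  exact ⟨i, neg_eq_iff_eq_neg.1 hi⟩

theorem IsLongest.map_apply {x : (I → ℤ) ≃ₗ[ℤ] (I → ℤ)} (hG : IsFiniteType G)
    (hx : IsLongest G x) (v : I → ℤ) (i : I) : x v (dualVertex G i) = -v i := by
  conv_lhs => rw [← sum_smul_simpleRoot v]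
  simp only [map_sum, map_smul, hx.apply_simpleRoot hG, Finset.sum_apply, Pi.smul_apply,
    Pi.neg_apply, smul_eq_mul]
  rw [Finset.sum_eq_single_of_mem i (Finset.mem_univ i)]
  · simp [simpleRoot]
  · intro k _ hk
    simp [simpleRoot, (hx.dualVertex_involutive hG).injective.ne hk.symm]

theorem IsLongest.adj_dualVertex {x : (I → ℤ) ≃ₗ[ℤ] (I → ℤ)} (hG : IsFiniteType G)
    (hx : IsLongest G x) {i j : I} (h : G.Adj i j) :
    G.Adj (dualVertex G i) (dualVertex G j) := by
  have hform := form_apply_apply hx.1 (simpleRoot i) (simpleRoot j)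
  rw [hx.apply_simpleRoot hG, hx.apply_simpleRoot hG, map_neg, map_neg, LinearMap.neg_apply,
    neg_neg, form_simpleRoot_simpleRoot, form_simpleRoot_simpleRoot, cartan, cartan,
    if_neg h.ne, if_pos h] at hform
  grind

theorem rootAt_count_eq_neg_gammaRoot (hG : IsFiniteType G) (hη : IsHeight G η)
    (hl : IsFirable G η l) (hw : IsLongest G (wordProd G l)) (hlen : l.length = numPos G)
    (j : I) :
    rootAt G (heightQuiver G η) j (l.count j) =
      -gammaRoot (heightQuiver G η) (dualVertex G j) := by
  choose σ hσ using exists_rootAt_count_eq hG hη hl hw hlen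
  have hwγ : ∀ j, wordProd G l (gammaRoot (heightQuiver G (lowered η l)) j) =
      -gammaRoot (heightQuiver G η) (σ j) := fun j => by rw [wordProd_gammaRoot hG hη hl, hσ]
  have hinj : Function.Injective σ := fun i j hij => by
    have h := (hwγ i).trans (hij ▸ (hwγ j).symm)
    exact gammaRoot_injective ((wordProd G l).injective h)
  have hpath : ∀ j, ReflTransGen (heightQuiver G η).Adj (dualVertex G j) (σ j) := fun j => by
    have h := hw.map_apply hG (gammaRoot (heightQuiver G (lowered η l)) j) j
    rw [hwγ, gammaRoot_self, Pi.neg_apply, neg_inj] at h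
    exact reflTransGen_of_gammaRoot_ne_zero (h ▸ one_ne_zero)
  -- both `σ` and `dualVertex G` permute the vertices, so the heights have the same sum
  have hsum : ∑ j, η (σ j) = ∑ j, η (dualVertex G j) :=
    ((Equiv.ofBijective σ (Finite.injective_iff_bijective.1 hinj)).sum_comp η).trans
      (Equiv.sum_comp (hw.dualVertex_involutive hG).toPerm η).symm
  have hheight := (Finset.sum_eq_sum_iff_of_le fun j _ =>
    height_le_of_reflTransGen (hpath j)).1 hsum j (Finset.mem_univ j)
  rw [hσ, eq_of_reflTransGen_of_le (hpath j) hheight.ge]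

theorem gammaRoot_dualVertex_apply (hG : IsFiniteType G) (hη : IsHeight G η)
    (hl : IsFirable G η l) (hw : IsLongest G (wordProd G l)) (hlen : l.length = numPos G)
    (i j : I) :
    gammaRoot (heightQuiver G η) (dualVertex G j) (dualVertex G i) =
      gammaRoot (heightQuiver G (lowered η l)) j i := by
  rw [← neg_inj, ← hw.map_apply hG (gammaRoot (heightQuiver G (lowered η l)) j) i,
    wordProd_gammaRoot hG hη hl,
    rootAt_count_eq_neg_gammaRoot hG hη hl hw hlen, Pi.neg_apply]

theorem heightQuiver_adj_dualVertex (hG : IsFiniteType G) (hη : IsHeight G η)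
    (hl : IsFirable G η l) (hw : IsLongest G (wordProd G l)) (hlen : l.length = numPos G)
    {i j : I} (h : (heightQuiver G (lowered η l)).Adj i j) :
    (heightQuiver G η).Adj (dualVertex G i) (dualVertex G j) := by
  have hadj := hw.adj_dualVertex hG h.1
  have hpath : ReflTransGen (heightQuiver G η).Adj (dualVertex G i) (dualVertex G j) :=
    reflTransGen_of_gammaRoot_ne_zero (by
      rw [gammaRoot_dualVertex_apply hG hη hl hw hlen,
        gammaRoot_apply_of_reflTransGen (.single h)]
      exact one_ne_zero)
  have hle := height_le_of_reflTransGen hpath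
  exact ⟨hadj, (hη _ _ hadj).resolve_right (by lia)⟩

theorem count_add_count_dualVertex_eq (hG : IsSimplyLacedDynkin G) (hη : IsHeight G η)
    (hl : IsFirable G η l) (hw : IsLongest G (wordProd G l)) (hlen : l.length = numPos G)
    (i j : I) : l.count i + l.count (dualVertex G i) = l.count j + l.count (dualVertex G j) := by
  have hstep : ∀ a b, G.Adj a b →
      η (dualVertex G a) - lowered η l a = η (dualVertex G b) - lowered η l b := fun a b hab => by
    rcases hl.isHeight_lowered hη a b hab with h | h
    · have := (heightQuiver_adj_dualVertex hG.2 hη hl hw hlen ⟨hab, h⟩).2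
      lia
    · have := (heightQuiver_adj_dualVertex hG.2 hη hl hw hlen ⟨hab.symm, h⟩).2
      lia
  have hconst : ∀ a b,
      η (dualVertex G a) - lowered η l a = η (dualVertex G b) - lowered η l b := fun a b => by
    obtain ⟨p⟩ := hG.1.preconnected a b
    induction p with
    | nil => rfl
    | cons h _ ih => exact (hstep _ _ h).trans ih
  have hij := hconst i j
  have hij' := hconst (dualVertex G i) (dualVertex G j)
  rw [hw.dualVertex_involutive hG.2, hw.dualVertex_involutive hG.2] at hij'
  simp only [lowered] at hij hij'
  lia

theorem count_add_count_dualVertex (hG : IsSimplyLacedDynkin G) (hη : IsHeight G η)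
    (hl : IsFirable G η l) (hw : IsLongest G (wordProd G l)) (hlen : l.length = numPos G)
    (j : I) : l.count j + l.count (dualVertex G j) = coxeterNumber G := by
  have hsum : ∑ i, l.count i = numPos G := by
    rw [← hlen, ← Multiset.coe_card, ← Multiset.sum_count_eq_card (s := Finset.univ)]
    · simp
    · simp
  have hsum' : ∑ i, l.count (dualVertex G i) = numPos G :=
    (Equiv.sum_comp (hw.dualVertex_involutive hG.2).toPerm fun i => l.count i).trans hsum
  have htwo : 2 * numPos G = Fintype.card I * (l.count j + l.count (dualVertex G j)) := by
    calc 2 * numPos G = ∑ i, (l.count i + l.count (dualVertex G i)) := by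
          rw [Finset.sum_add_distrib, hsum, hsum', two_mul]
      _ = ∑ _i : I, (l.count j + l.count (dualVertex G j)) :=
          Finset.sum_congr rfl fun i _ => count_add_count_dualVertex_eq hG hη hl hw hlen i j
      _ = _ := by rw [Finset.sum_const, Finset.card_univ, smul_eq_mul]
  rw [coxeterNumber, htwo, Nat.mul_div_cancel_left _ (Fintype.card_pos_iff.2 ⟨j⟩)]

theorem rootAt_count_add (hG : IsFiniteType G) (hη : IsHeight G η) (hl : IsFirable G η l)
    (hw : IsLongest G (wordProd G l)) (hlen : l.length = numPos G) (j : I) (d : ℕ) :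
    rootAt G (heightQuiver G η) j (l.count j + d) =
      -rootAt G (heightQuiver G η) (dualVertex G j) d := by
  induction d with
  | zero => exact rootAt_count_eq_neg_gammaRoot hG hη hl hw hlen j
  | succ d ih => rw [← add_assoc, rootAt_succ, ih, map_neg, ← rootAt_succ]

end Repetition

section Depth

variable {I : Type*}

/-- Depth below the height function identifies `I × ℕ` with `I^{≤ξ}`. -/
def prodEquivILE (ξ : I → ℤ) : I × ℕ ≃ ILE ξ where
  toFun y := atDepth ξ y.1 y.2
  invFun y := (y.1.1, depth y)
  left_inv y := by ext <;> simp [atDepth, depth]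
  right_inv y := by
    obtain ⟨⟨i, p⟩, d, hd⟩ := y
    obtain rfl : p = ξ i - 2 * d := hd
    simp [atDepth, depth]

theorem depth_atDepth (ξ : I → ℤ) (j : I) (d : ℕ) : depth (atDepth ξ j d) = d :=
  congrArg Prod.snd ((prodEquivILE ξ).left_inv (j, d))

theorem exists_forall_sub_lt [Finite I] (ξ : I → ℤ) (p : ℤ) : ∃ D : ℕ, ∀ j, ξ j - 2 * D < p := by
  obtain ⟨b, hb⟩ := Finite.bddAbove_range ξ
  refine ⟨(b - p).toNat + 1, fun j => ?_⟩
  have := hb ⟨j, rfl⟩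
  lia

end Depth

section Mesh

variable {I : Type*} [Fintype I] {G : SimpleGraph I} [DecidableRel G.Adj] {ξ : I → ℤ}

theorem IsMesh.map {M N : Type*} [AddCommGroup M] [AddCommGroup N] {B : I → ℕ → M}
    (hB : IsMesh G ξ B) (f : M →+ N) : IsMesh G ξ fun j d => f (B j d) := fun j d => by
  rw [← map_add, hB j d, map_sum]
  simp only [apply_ite f]

theorem IsMesh.unique {M : Type*} [AddCommGroup M] {B B' : I → ℕ → M} (hB : IsMesh G ξ B)
    (hB' : IsMesh G ξ B') (h : ∀ j, B j 0 = B' j 0) (j : I) (d : ℕ) : B j d = B' j d := by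
  induction d generalizing j with
  | zero => exact h j
  | succ d ih =>
    induction j using height_induction ξ with
    | h j ihj =>
      refine add_left_cancel (a := B j d) ?_
      rw [hB j d, ih j, hB' j d]
      refine Finset.sum_congr rfl fun k _ => ?_
      split_ifs with hk
      · exact ihj k hk
      · exact ih k

end Mesh

section Periodicity

variable {I : Type*} [Fintype I] [DecidableEq I] {G : SimpleGraph I} [DecidableRel G.Adj]
  {ξ : I → ℤ}

/-! ## The inverse quantum Cartan matrix -/

open Polynomial in
/-- The extension of `m ↦ C̃(m)`, `m ≥ 1`, to an odd function on all integers. It is a Chebyshev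
polynomial in the adjacency matrix `A`, as the quantum Cartan matrix is `z + z⁻¹ - A`. -/
def oddCTilde (G : SimpleGraph I) [DecidableRel G.Adj] (m : ℤ) : Matrix I I ℤ :=
  aeval (G.adjMatrix ℤ) (Chebyshev.S ℤ (m - 1))

theorem oddCTilde_zero : oddCTilde G 0 = 0 := by simp [oddCTilde]

theorem oddCTilde_one : oddCTilde G 1 = 1 := by simp [oddCTilde]

theorem oddCTilde_neg (m : ℤ) : oddCTilde G (-m) = -oddCTilde G m := by
  rw [oddCTilde, oddCTilde, Polynomial.Chebyshev.S_neg_sub_one, map_neg]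

theorem oddCTilde_add_one (m : ℤ) :
    oddCTilde G (m + 1) + oddCTilde G (m - 1) = G.adjMatrix ℤ * oddCTilde G m := by
  have h := Polynomial.Chebyshev.S_add_two ℤ (m - 2)
  rw [show m - 2 + 2 = m + 1 - 1 by ring, show m - 2 + 1 = m - 1 by ring,
    show m - 2 = m - 1 - 1 by ring] at h
  rw [oddCTilde, h]
  simp [oddCTilde]

theorem commute_adjMatrix_oddCTilde (m : ℤ) : Commute (G.adjMatrix ℤ) (oddCTilde G m) :=
  Algebra.commute_of_mem_adjoin_self (Polynomial.aeval_mem_adjoin_singleton ℤ _)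

theorem oddCTilde_apply_add_one (i j : I) (m : ℤ) :
    oddCTilde G (m + 1) i j + oddCTilde G (m - 1) i j =
      ∑ k ∈ G.neighborFinset j, oddCTilde G m i k := by
  rw [← Matrix.add_apply, oddCTilde_add_one, (commute_adjMatrix_oddCTilde m).eq,
    SimpleGraph.mul_adjMatrix_apply]

theorem isMesh_oddCTilde (hξ : IsHeight G ξ) (i : I) (c : ℤ) :
    IsMesh G ξ fun j d => oddCTilde G (ξ j - 2 * d - c) i j := fun j d => by
  have h := oddCTilde_apply_add_one (G := G) i j (ξ j - 2 * d - c - 1)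
  rw [sub_add_cancel] at h
  beta_reduce
  rw [show ξ j - 2 * (d + 1 : ℕ) - c = ξ j - 2 * d - c - 1 - 1 by push_cast; ring, h]
  refine Finset.sum_congr rfl fun k hk => ?_
  have hjk := hξ j k ((G.mem_neighborFinset j k).1 hk)
  split_ifs with hkj
  · rw [show ξ k - 2 * (d + 1 : ℕ) - c = ξ j - 2 * d - c - 1 by push_cast; lia]
  · rw [show ξ k - 2 * d - c = ξ j - 2 * d - c - 1 by lia]

theorem oddCTilde_apply_eq_zero (hξ : IsHeight G ξ) (i : I) (n : ℕ) (j : I)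
    (hn : n ≤ ξ i - ξ j) : oddCTilde G n i j = 0 := by
  induction n using Nat.twoStepInduction generalizing j with
  | zero => simp [oddCTilde_zero]
  | one =>
    have hij : i ≠ j := by
      rintro rfl
      simp at hn
    simp [oddCTilde_one, hij]
  | more n ih ih' =>
    have h := oddCTilde_apply_add_one (G := G) i j (n + 1 : ℕ)
    rw [Nat.cast_succ, add_sub_cancel_right, ih j (by lia), add_zero] at h
    rw [Nat.cast_succ, Nat.cast_succ, h]
    refine Finset.sum_eq_zero fun k hk => ?_
    have := hξ j k ((G.mem_neighborFinset j k).1 hk)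
    exact_mod_cast ih' k (by lia)

theorem coeff_quantumCartan_mul (X : Matrix I I (LaurentSeries ℤ)) (i j : I) (n : ℤ) :
    ((quantumCartan G * X) i j).coeff n =
      (X i j).coeff (n - 1) + (X i j).coeff (n + 1) -
        ∑ k ∈ G.neighborFinset i, (X k j).coeff n := by
  have hcartan : quantumCartan G =
      (HahnSeries.single 1 1 + HahnSeries.single (-1) 1 : LaurentSeries ℤ) • 1 -
        G.adjMatrix (LaurentSeries ℤ) := by
    ext1 a b
    rcases eq_or_ne a b with rfl | hab
    · simp [quantumCartan]
    · simp [quantumCartan, hab, SimpleGraph.adjMatrix_apply, neg_ite]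
  have hz := HahnSeries.coeff_single_mul_add (r := (1 : ℤ)) (x := X i j) (a := n - 1) (b := 1)
  have hz' := HahnSeries.coeff_single_mul_add (r := (1 : ℤ)) (x := X i j) (a := n + 1) (b := -1)
  rw [sub_add_cancel, one_mul] at hz
  rw [add_neg_cancel_right, one_mul] at hz'
  rw [hcartan, sub_mul, Matrix.smul_mul, one_mul, Matrix.sub_apply, Matrix.smul_apply,
    SimpleGraph.adjMatrix_mul_apply, smul_eq_mul, add_mul, HahnSeries.coeff_sub,
    HahnSeries.coeff_add, HahnSeries.coeff_sum, hz, hz']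

/-- The inverse of the quantum Cartan matrix. -/
def cTildeSeries (G : SimpleGraph I) [DecidableRel G.Adj] : Matrix I I (LaurentSeries ℤ) :=
  fun i j => HahnSeries.ofPowerSeries ℤ ℤ (PowerSeries.mk fun n => oddCTilde G n i j)

theorem coeff_cTildeSeries (i j : I) (n : ℤ) :
    (cTildeSeries G i j).coeff n = if 0 ≤ n then oddCTilde G n i j else 0 := by
  have h := PowerSeries.coeff_coe (R := ℤ) (PowerSeries.mk fun n => oddCTilde G n i j) n
  refine h.trans ?_
  rcases lt_or_ge n 0 with hn | hn
  · rw [if_pos hn, if_neg hn.not_ge]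
  · rw [if_neg hn.not_gt, if_pos hn, PowerSeries.coeff_mk, Int.natAbs_of_nonneg hn]

theorem quantumCartan_mul_cTildeSeries : quantumCartan G * cTildeSeries G = 1 := by
  ext i j n
  have hone : ((1 : Matrix I I (LaurentSeries ℤ)) i j).coeff n =
      if n = 0 then (1 : Matrix I I ℤ) i j else 0 := by
    rcases eq_or_ne i j with rfl | hij
    · simp [HahnSeries.coeff_one]
    · simp [hij]
  simp only [coeff_quantumCartan_mul, coeff_cTildeSeries, hone]
  rcases lt_trichotomy n 0 with hn | rfl | hn
  · rcases (show n + 1 ≤ 0 by lia).lt_or_eq with hn' | hn'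
    · simp [hn.not_ge, hn'.not_ge, hn.ne, show ¬ 1 ≤ n by lia]
    · simp [hn.not_ge, hn', hn.ne, show ¬ 1 ≤ n by lia, oddCTilde_zero]
  · simp [oddCTilde_one, oddCTilde_zero]
  · have h := congrFun (congrFun (oddCTilde_add_one (G := G) n) i) j
    rw [SimpleGraph.adjMatrix_mul_apply, Matrix.add_apply, add_comm] at h
    rw [if_pos (by lia), if_pos (by lia), if_neg hn.ne', h, sub_eq_zero]
    exact Finset.sum_congr rfl fun k _ => (if_pos hn.le).symm

theorem cTilde_of_nonpos (i j : I) {m : ℤ} (hm : m ≤ 0) : cTilde G i j m = 0 :=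
  if_neg (by lia)

theorem cTilde_of_pos (i j : I) {m : ℤ} (hm : 0 < m) : cTilde G i j m = oddCTilde G m i j := by
  rw [cTilde, if_pos (by lia), Matrix.inv_eq_right_inv quantumCartan_mul_cTildeSeries,
    coeff_cTildeSeries, if_pos hm.le]

theorem cTilde_eq_oddCTilde_apply (hξ : IsHeight G ξ) {i j : I} {m : ℤ} (hm : ξ j - ξ i ≤ m) :
    cTilde G i j m = oddCTilde G m i j := by
  rcases lt_or_ge 0 m with hpos | hnonpos
  · exact cTilde_of_pos i j hpos
  · obtain ⟨n, hn⟩ := Int.eq_ofNat_of_zero_le (neg_nonneg.2 hnonpos)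
    rw [cTilde_of_nonpos i j hnonpos, ← neg_neg m, oddCTilde_neg, Matrix.neg_apply, hn,
      oddCTilde_apply_eq_zero hξ i n j (by lia), neg_zero]

/-! ## Linear forms with prescribed values on the roots `τ_Q^d(γ_j)` -/

theorem exists_linearMap_rootAt (hG : IsFiniteType G) (hξ : IsHeight G ξ) {x : I → ℕ → ℤ}
    (hx : IsMesh G ξ x) :
    ∃ f : (I → ℤ) →ₗ[ℤ] ℤ, ∀ j d, f (rootAt G (heightQuiver G ξ) j d) = x j d := by
  set f : (I → ℤ) →ₗ[ℤ] ℤ :=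
    ∑ i, (x i 0 - ∑ k with (heightQuiver G ξ).Adj k i, x k 0) • LinearMap.proj i with hf
  have hsimple : ∀ j, f (simpleRoot j) = x j 0 - ∑ k with (heightQuiver G ξ).Adj k j, x k 0 :=
    fun j => by simp [hf, simpleRoot, Pi.single_apply]
  have hgamma : ∀ j, f (gammaRoot (heightQuiver G ξ) j) = x j 0 := fun j => by
    induction j using height_induction ξ with
    | h j ih =>
      rw [isRootFamily_gammaRoot hG hξ j, map_add, map_sum, LinearEquiv.coe_one, id, hsimple,
        Finset.sum_congr rfl fun k hk => ih k (by have := (Finset.mem_filter.1 hk).2.2; lia),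
        sub_add_cancel]
  exact ⟨f, ((isMesh_rootAt hG hξ).map f.toAddMonoidHom).unique hx hgamma⟩

/-! ## The positive roots `β_t` -/

theorem betaSeq_mem_positiveRoots (hG : IsFiniteType G) (hξ : IsHeight G ξ) (j : I) (d : ℕ) :
    betaSeq G (heightQuiver G ξ) j d ∈ positiveRoots G := by
  induction d with
  | zero => exact gammaRoot_mem_positiveRoots hG hξ j
  | succ d ih =>
    rw [betaSeq]
    split_ifs with h
    · exact h
    · exact (mem_positiveRoots_or_neg_mem hG
        (apply_mem_roots (coxeter_mem_weylGroup hξ) ih.1)).resolve_left h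

theorem betaSeq_eq_or_eq_neg_rootAt (Q : Digraph I) (j : I) (d : ℕ) :
    betaSeq G Q j d = rootAt G Q j d ∨ betaSeq G Q j d = -rootAt G Q j d := by
  induction d with
  | zero => exact .inl rfl
  | succ d ih =>
    rw [betaSeq, rootAt_succ]
    rcases ih with h | h <;> split_ifs <;> simp [h]

theorem betaSeq_eq_of_rootAt (hG : IsFiniteType G) (hξ : IsHeight G ξ) {j j' : I} {d d' : ℕ}
    (h : rootAt G (heightQuiver G ξ) j d = rootAt G (heightQuiver G ξ) j' d' ∨
      rootAt G (heightQuiver G ξ) j d = -rootAt G (heightQuiver G ξ) j' d') :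
    betaSeq G (heightQuiver G ξ) j d = betaSeq G (heightQuiver G ξ) j' d' := by
  have hpm : betaSeq G (heightQuiver G ξ) j d = betaSeq G (heightQuiver G ξ) j' d' ∨
      betaSeq G (heightQuiver G ξ) j d = -betaSeq G (heightQuiver G ξ) j' d' := by
    have hβ := betaSeq_eq_or_eq_neg_rootAt (G := G) (heightQuiver G ξ) j d
    have hβ' := betaSeq_eq_or_eq_neg_rootAt (G := G) (heightQuiver G ξ) j' d'
    grind
  refine hpm.resolve_right fun hneg => ?_
  exact neg_notMem_positiveRoots (betaSeq_mem_positiveRoots hG hξ j' d')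
    (hneg ▸ betaSeq_mem_positiveRoots hG hξ j d)

/-- The root `β_{φ(j, ξ(j) - 2d)}` as a unit of the field `ℂ(α_1, …, α_n)`. -/
def rootUnit (G : SimpleGraph I) [DecidableRel G.Adj] (Q : Digraph I) (j : I) (d : ℕ) :
    (RatField I)ˣ :=
  Units.mk0 (linForm (betaSeq G Q j d)) (linForm_ne_zero (betaSeq_ne_zero G Q j d))

theorem rootUnit_eq_of_rootAt (hG : IsFiniteType G) (hξ : IsHeight G ξ) {j j' : I} {d d' : ℕ}
    (h : rootAt G (heightQuiver G ξ) j d = rootAt G (heightQuiver G ξ) j' d' ∨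
      rootAt G (heightQuiver G ξ) j d = -rootAt G (heightQuiver G ξ) j' d') :
    rootUnit G (heightQuiver G ξ) j d = rootUnit G (heightQuiver G ξ) j' d' :=
  Units.ext (congrArg linForm (betaSeq_eq_of_rootAt hG hξ h))

variable {l : List I}

theorem rootUnit_add_coxeterNumber (hG : IsSimplyLacedDynkin G) (hξ : IsHeight G ξ)
    (hl : IsFirable G ξ l) (hw : IsLongest G (wordProd G l)) (hlen : l.length = numPos G) (j : I)
    (d : ℕ) :
    rootUnit G (heightQuiver G ξ) j (d + coxeterNumber G) = rootUnit G (heightQuiver G ξ) j d := by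
  refine rootUnit_eq_of_rootAt hG.2 hξ (.inl ?_)
  rw [← count_add_count_dualVertex hG hξ hl hw hlen j, add_comm d, add_assoc,
    rootAt_count_add hG.2 hξ hl hw hlen, rootAt_count_add hG.2 hξ hl hw hlen, neg_neg,
    hw.dualVertex_involutive hG.2]

/-- In the product over `0 ≤ d < h`, which runs over the positive roots and their opposites, the
factors of `β` and of `-β` cancel. -/
theorem prod_rootUnit_zpow_eq_one (hG : IsSimplyLacedDynkin G) (hξ : IsHeight G ξ)
    (hl : IsFirable G ξ l) (hw : IsLongest G (wordProd G l)) (hlen : l.length = numPos G)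
    (f : (I → ℤ) →ₗ[ℤ] ℤ) :
    ∏ j, ∏ d ∈ Finset.range (coxeterNumber G), rootUnit G (heightQuiver G ξ) j d ^
      f (rootAt G (heightQuiver G ξ) j d) = 1 := by
  set F : I → ℕ → (RatField I)ˣ := fun j d => rootUnit G (heightQuiver G ξ) j d ^
      f (rootAt G (heightQuiver G ξ) j d) with hF
  have hanti : ∀ j d, F j (l.count j + d) = (F (dualVertex G j) d)⁻¹ := fun j d => by
    have hroot := rootAt_count_add hG.2 hξ hl hw hlen j d
    simp only [hF, hroot, rootUnit_eq_of_rootAt hG.2 hξ (.inr hroot), map_neg, zpow_neg]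
  have hperm : ∏ j, ∏ d ∈ Finset.range (l.count (dualVertex G j)), F (dualVertex G j) d =
      ∏ j, ∏ d ∈ Finset.range (l.count j), F j d :=
    Equiv.prod_comp (hw.dualVertex_involutive hG.2).toPerm
      fun j => ∏ d ∈ Finset.range (l.count j), F j d
  calc ∏ j, ∏ d ∈ Finset.range (coxeterNumber G), F j d
      = ∏ j, ((∏ d ∈ Finset.range (l.count j), F j d) *
          (∏ d ∈ Finset.range (l.count (dualVertex G j)), F (dualVertex G j) d)⁻¹) := by
        refine Finset.prod_congr rfl fun j _ => ?_
        rw [← count_add_count_dualVertex hG hξ hl hw hlen j, Finset.prod_range_add]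
        simp only [hanti, Finset.prod_inv_distrib]
    _ = 1 := by rw [Finset.prod_mul_distrib, Finset.prod_inv_distrib, hperm, mul_inv_cancel]

/-! ## The product formula -/

theorem betaUnit_atDepth (Q : Digraph I) (ξ : I → ℤ) (j : I) (d : ℕ) :
    betaUnit G Q (atDepth ξ j d) = rootUnit G Q j d := by
  ext
  simp only [betaUnit, rootUnit, beta, depth_atDepth, Units.val_mk0]
  rfl

/-- The factor `β_{φ(j,s)} ^ C̃_{ij}(s - p + 1)`, with `s = ξ(j) - 2d`. -/
def rootFactor (G : SimpleGraph I) [DecidableRel G.Adj] (Q : Digraph I) (ξ : I → ℤ) (i : I)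
    (p : ℤ) (j : I) (d : ℕ) : (RatField I)ˣ :=
  rootUnit G Q j d ^ cTilde G i j (ξ j - 2 * d - p + 1)

theorem rootFactor_eq_one (Q : Digraph I) {i j : I} {p : ℤ} {d : ℕ} (h : ξ j - 2 * d < p) :
    rootFactor G Q ξ i p j d = 1 := by
  rw [rootFactor, cTilde_of_nonpos i j (by lia), zpow_zero]

theorem dTildeY_eq_prod_div (Q : Digraph I) (x : ILE ξ) {D : ℕ}
    (hD : ∀ j, ξ j - 2 * D < x.1.2) :
    dTildeY G Q ξ x = ∏ j, ∏ d ∈ Finset.range D,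
      rootFactor G Q ξ x.1.1 (x.1.2 + 2) j d / rootFactor G Q ξ x.1.1 x.1.2 j d := by
  have hfactor : ∀ y : I × ℕ, betaUnit G Q (prodEquivILE ξ y) ^
      (cTilde G x.1.1 (prodEquivILE ξ y).1.1 ((prodEquivILE ξ y).1.2 - x.1.2 - 1) -
        cTilde G x.1.1 (prodEquivILE ξ y).1.1 ((prodEquivILE ξ y).1.2 - x.1.2 + 1)) =
      rootFactor G Q ξ x.1.1 (x.1.2 + 2) y.1 y.2 / rootFactor G Q ξ x.1.1 x.1.2 y.1 y.2 :=
    fun ⟨j, d⟩ => by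
      rw [show prodEquivILE ξ (j, d) = atDepth ξ j d from rfl, betaUnit_atDepth, zpow_sub,
        ← div_eq_mul_inv, rootFactor, rootFactor,
        show ξ j - 2 * d - (x.1.2 + 2) + 1 = ξ j - 2 * d - x.1.2 - 1 by ring]
      rfl
  rw [dTildeY, ← finprod_comp_equiv (prodEquivILE ξ), finprod_congr hfactor,
    finprod_eq_prod_of_mulSupport_subset (s := Finset.univ ×ˢ Finset.range D),
    Finset.prod_product]
  rintro ⟨j, d⟩ h
  by_contra hmem
  have hd : D ≤ d := by simpa using hmem
  have := hD j
  exact h (by beta_reduce; rw [rootFactor_eq_one Q (by lia), rootFactor_eq_one Q (by lia), div_one])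

theorem prod_range_add_div {A : Type*} [CommGroup A] {F : ℕ → A} {D : ℕ} (h : ℕ)
    (hF : ∀ d, D ≤ d → F d = 1) :
    ∏ d ∈ Finset.range D, F (d + h) / F d = (∏ d ∈ Finset.range h, F d)⁻¹ := by
  have htail : (∏ d ∈ Finset.range h, F d) * ∏ d ∈ Finset.range D, F (d + h) =
      ∏ d ∈ Finset.range D, F d := by
    simp only [add_comm _ h]
    rw [← Finset.prod_range_add, add_comm, Finset.prod_range_add,
      Finset.prod_eq_one fun d _ => hF (D + d) (by lia), mul_one]
  rw [Finset.prod_div_distrib, ← htail, mul_comm, div_mul_cancel_left]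

theorem rootFactor_add_coxeterNumber (hG : IsSimplyLacedDynkin G) (hξ : IsHeight G ξ)
    (hl : IsFirable G ξ l) (hw : IsLongest G (wordProd G l)) (hlen : l.length = numPos G)
    (i : I) (p : ℤ) (j : I) (d : ℕ) :
    rootFactor G (heightQuiver G ξ) ξ i (p + 2 * coxeterNumber G) j d =
      rootFactor G (heightQuiver G ξ) ξ i p j (d + coxeterNumber G) := by
  rw [rootFactor, rootFactor, rootUnit_add_coxeterNumber hG hξ hl hw hlen]
  congr 2
  push_cast
  ring

theorem prod_rootFactor_eq_one (hG : IsSimplyLacedDynkin G) (hξ : IsHeight G ξ)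
    (hl : IsFirable G ξ l) (hw : IsLongest G (wordProd G l)) (hlen : l.length = numPos G)
    {i : I} {p : ℤ} (hp : p ≤ ξ i - 2 * coxeterNumber G + 2) :
    ∏ j, ∏ d ∈ Finset.range (coxeterNumber G),
      rootFactor G (heightQuiver G ξ) ξ i p j d = 1 := by
  obtain ⟨f, hf⟩ := exists_linearMap_rootAt hG.2 hξ (isMesh_oddCTilde hξ i (p - 1))
  rw [← prod_rootUnit_zpow_eq_one hG hξ hl hw hlen f]
  refine Finset.prod_congr rfl fun j _ => Finset.prod_congr rfl fun d hd => ?_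
  have := Finset.mem_range.1 hd
  rw [rootFactor, hf, cTilde_eq_oddCTilde_apply hξ (by lia), sub_sub_eq_add_sub,
    add_sub_right_comm]

theorem prod_dTildeY_eq_one (hG : IsSimplyLacedDynkin G) (hξ : IsHeight G ξ)
    (hl : IsFirable G ξ l) (hw : IsLongest G (wordProd G l)) (hlen : l.length = numPos G)
    {i : I} {p : ℤ} (hp : p ≤ ξ i - 2 * coxeterNumber G + 2) {x : Fin (coxeterNumber G) → ILE ξ}
    (hx : ∀ k, (x k).1 = (i, p + 2 * (k : ℕ))) :
    ∏ k, dTildeY G (heightQuiver G ξ) ξ (x k) = 1 := by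
  obtain ⟨D, hD⟩ := exists_forall_sub_lt ξ p
  set F := rootFactor G (heightQuiver G ξ) ξ i with hF
  calc ∏ k, dTildeY G (heightQuiver G ξ) ξ (x k)
      = ∏ k ∈ Finset.range (coxeterNumber G), ∏ j, ∏ d ∈ Finset.range D,
          F (p + 2 * (k + 1 : ℕ)) j d / F (p + 2 * k) j d := by
        rw [← Fin.prod_univ_eq_prod_range (fun k => ∏ j, ∏ d ∈ Finset.range D,
          F (p + 2 * (k + 1 : ℕ)) j d / F (p + 2 * k) j d)]
        refine Finset.prod_congr rfl fun k _ => ?_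
        rw [dTildeY_eq_prod_div (D := D) _ (x k) fun j => by rw [hx]; have := hD j; lia, hx,
          Nat.cast_succ, mul_add, mul_one, add_assoc]
    _ = ∏ j, ∏ d ∈ Finset.range D, F p j (d + coxeterNumber G) / F p j d := by
        rw [Finset.prod_comm]
        refine Finset.prod_congr rfl fun j _ => ?_
        rw [Finset.prod_comm]
        refine Finset.prod_congr rfl fun d _ => ?_
        rw [Finset.prod_range_div fun k : ℕ => F (p + 2 * k) j d, hF,
          rootFactor_add_coxeterNumber hG hξ hl hw hlen, Nat.cast_zero, mul_zero, add_zero]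
    _ = (∏ j, ∏ d ∈ Finset.range (coxeterNumber G), F p j d)⁻¹ := by
        rw [← Finset.prod_inv_distrib]
        refine Finset.prod_congr rfl fun j _ => prod_range_add_div _ fun d hd => ?_
        exact rootFactor_eq_one _ (by have := hD j; lia)
    _ = 1 := by rw [hF, prod_rootFactor_eq_one hG hξ hl hw hlen hp, inv_one]

end Periodicity

/-! ## Modules over the quantum affine algebra -/

section Relations

open Module

variable {I : Type*} [DecidableEq I] {G : SimpleGraph I} [DecidableRel G.Adj] {q : ℂˣ}
  {V : Type*} [AddCommGroup V] [Module ℂ V] [Module (QAff G q) V] [IsScalarTower ℂ (QAff G q) V]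

variable (G q V) in
/-- The action on `V` of noncommutative polynomials in the generators of the quantum affine
algebra; it turns Drinfeld's relations into relations between the operators `act`. -/
def freeAct : FreeAlgebra ℂ (Gen I) →ₐ[ℂ] End ℂ V :=
  (Algebra.lsmul ℂ ℂ V).comp (RingQuot.mkAlgHom ℂ (Rel G q))

theorem freeAct_ι (g : Gen I) : freeAct G q V (FreeAlgebra.ι ℂ g) = act G q V g := rfl

theorem freeAct_eq_of_rel {a b : FreeAlgebra ℂ (Gen I)} (h : Rel G q a b) :
    freeAct G q V a = freeAct G q V b := by
  simp only [freeAct, AlgHom.comp_apply, RingQuot.mkAlgHom_rel ℂ h]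

theorem act_k_mul_inv (ε : ℤˣ) (i : I) :
    act G q V (Gen.k ε i) * act G q V (Gen.k (-ε) i) = 1 := by
  simpa [freeAct_ι] using freeAct_eq_of_rel (V := V) (Rel.k_inv (G := G) (q := q) ε i)

theorem act_k_comm (ε ε' : ℤˣ) (i j : I) :
    Commute (act G q V (Gen.k ε i)) (act G q V (Gen.k ε' j)) := by
  simpa [freeAct_ι, commute_iff_eq] using
    freeAct_eq_of_rel (V := V) (Rel.k_comm (G := G) (q := q) ε ε' i j)

theorem act_h_zero (i : I) : act G q V (Gen.h i 0) = 0 := by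
  simpa [freeAct_ι] using freeAct_eq_of_rel (V := V) (Rel.h_zero (G := G) (q := q) i)

theorem act_k_h_comm (ε : ℤˣ) (i j : I) (r : ℤ) :
    Commute (act G q V (Gen.k ε i)) (act G q V (Gen.h j r)) := by
  simpa [freeAct_ι, commute_iff_eq] using
    freeAct_eq_of_rel (V := V) (Rel.k_h_comm (G := G) (q := q) ε i j r)

theorem act_h_comm (i j : I) (r s : ℤ) :
    Commute (act G q V (Gen.h i r)) (act G q V (Gen.h j s)) := by
  simpa [freeAct_ι, commute_iff_eq] using
    freeAct_eq_of_rel (V := V) (Rel.h_comm (G := G) (q := q) i j r s)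

theorem act_phi_vanish (ε : ℤˣ) (i : I) {r : ℤ} (hr : (ε : ℤ) * r < 0) :
    act G q V (Gen.φ ε i r) = 0 := by
  simpa [freeAct_ι] using freeAct_eq_of_rel (V := V) (Rel.φ_vanish (G := G) (q := q) ε i r hr)

theorem act_phi_zero (ε : ℤˣ) (i : I) :
    act G q V (Gen.φ ε i 0) = act G q V (Gen.k ε i) := by
  simpa [freeAct_ι] using freeAct_eq_of_rel (V := V) (Rel.φ_zero (G := G) (q := q) ε i)

theorem act_phi_succ (ε : ℤˣ) (i : I) (r : ℕ) (u : V) :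
    ((r : ℂ) + 1) • act G q V (Gen.φ ε i ((ε : ℤ) * (r + 1))) u =
      (((ε : ℤ) : ℂ) * ((q : ℂ) - ((q⁻¹ : ℂˣ) : ℂ))) • ∑ s ∈ Finset.range (r + 1),
        ((s : ℂ) + 1) • act G q V (Gen.h i ((ε : ℤ) * (s + 1)))
          (act G q V (Gen.φ ε i ((ε : ℤ) * ((r : ℤ) - s))) u) := by
  have h := freeAct_eq_of_rel (V := V) (Rel.φ_succ (G := G) (q := q) ε i r)
  simp only [map_smul, map_sum, map_mul, freeAct_ι] at h
  simpa [LinearMap.sum_apply] using LinearMap.congr_fun h u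

theorem act_k_x (ε ε' : ℤˣ) (i j : I) (r : ℤ) :
    act G q V (Gen.k ε i) * act G q V (Gen.x ε' j r) =
      ((q ^ ((ε : ℤ) * ε' * cartan G i j) : ℂˣ) : ℂ) •
        (act G q V (Gen.x ε' j r) * act G q V (Gen.k ε i)) := by
  simpa only [map_smul, map_mul, freeAct_ι] using
    freeAct_eq_of_rel (V := V) (Rel.k_x (G := G) (q := q) ε ε' i j r)

theorem act_k_x_apply (ε ε' : ℤˣ) (i j : I) (r : ℤ) (u : V) :
    act G q V (Gen.k ε i) (act G q V (Gen.x ε' j r) u) =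
      ((q ^ ((ε : ℤ) * ε' * cartan G i j) : ℂˣ) : ℂ) •
        act G q V (Gen.x ε' j r) (act G q V (Gen.k ε i) u) :=
  LinearMap.congr_fun (act_k_x ε ε' i j r) u

theorem lie_act_h_x (ε : ℤˣ) (i j : I) {r : ℤ} (s : ℤ) (hr : r ≠ 0) :
    ⁅act G q V (Gen.h i r), act G q V (Gen.x ε j s)⁆ =
      (((ε : ℤ) : ℂ) * (qInt q (r * cartan G i j) / (r : ℂ))) •
        act G q V (Gen.x ε j (r + s)) := by
  simpa only [map_smul, map_sub, map_mul, freeAct_ι, Ring.lie_def] using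
    freeAct_eq_of_rel (V := V) (Rel.h_x (G := G) (q := q) ε i j r s hr)

theorem act_h_x_apply (ε : ℤˣ) (i j : I) {r : ℤ} (s : ℤ) (hr : r ≠ 0) (u : V) :
    act G q V (Gen.h i r) (act G q V (Gen.x ε j s) u) =
      act G q V (Gen.x ε j s) (act G q V (Gen.h i r) u) +
        (((ε : ℤ) : ℂ) * (qInt q (r * cartan G i j) / (r : ℂ))) •
          act G q V (Gen.x ε j (r + s)) u :=
  sub_eq_iff_eq_add'.1 (LinearMap.congr_fun (lie_act_h_x ε i j s hr) u)

theorem act_xp_xm (i j : I) (r s : ℤ) (u : V) :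
    act G q V (Gen.x 1 i r) (act G q V (Gen.x (-1) j s) u) =
      act G q V (Gen.x (-1) j s) (act G q V (Gen.x 1 i r) u) +
      if i = j then ((q : ℂ) - ((q⁻¹ : ℂˣ) : ℂ))⁻¹ •
        (act G q V (Gen.φ 1 i (r + s)) u - act G q V (Gen.φ (-1) i (r + s)) u) else 0 := by
  have h := freeAct_eq_of_rel (V := V) (Rel.xp_xm (G := G) (q := q) i j r s)
  simp only [map_sub, map_mul, freeAct_ι, apply_ite (freeAct G q V), map_smul, map_zero] at h
  rw [← sub_eq_iff_eq_add']
  refine (LinearMap.congr_fun h u).trans ?_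
  split_ifs <;> rfl

theorem act_x_of_one_of_neg_one {p : End ℂ V → Prop}
    (h1 : ∀ j s, p (act G q V (Gen.x 1 j s))) (h2 : ∀ j s, p (act G q V (Gen.x (-1) j s)))
    (ε : ℤˣ) (j : I) (s : ℤ) : p (act G q V (Gen.x ε j s)) := by
  rcases Int.units_eq_one_or ε with rfl | rfl
  exacts [h1 j s, h2 j s]

/-- A subspace stable under the loop-Cartan subalgebra, generated by the `k_i^{±1}` and the
`h_{i,r}`. -/
structure IsCartanStable (S : Submodule ℂ V) : Prop where
  act_k_mem : ∀ ε i, ∀ u ∈ S, act G q V (Gen.k ε i) u ∈ S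
  act_h_mem : ∀ i r, ∀ u ∈ S, act G q V (Gen.h i r) u ∈ S

theorem IsCartanStable.inf {S T : Submodule ℂ V} (hS : IsCartanStable (G := G) (q := q) S)
    (hT : IsCartanStable (G := G) (q := q) T) : IsCartanStable (G := G) (q := q) (S ⊓ T) where
  act_k_mem ε i u hu := ⟨hS.act_k_mem ε i u hu.1, hT.act_k_mem ε i u hu.2⟩
  act_h_mem i r u hu := ⟨hS.act_h_mem i r u hu.1, hT.act_h_mem i r u hu.2⟩

theorem IsCartanStable.act_phi_mul_mem {S : Submodule ℂ V} (hS : IsCartanStable (G := G) (q := q) S)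
    (ε : ℤˣ) (i : I) {u : V} (hu : u ∈ S) (m : ℕ) :
    act G q V (Gen.φ ε i ((ε : ℤ) * m)) u ∈ S := by
  induction m using Nat.strong_induction_on with
  | _ m ih =>
    rcases m with _ | r
    · simpa [act_phi_zero] using hS.act_k_mem ε i u hu
    · have hr : ((r : ℂ) + 1) ≠ 0 := by exact_mod_cast r.succ_ne_zero
      push_cast
      rw [← Submodule.smul_mem_iff _ hr, act_phi_succ]
      refine S.smul_mem _ (S.sum_mem fun s hs => S.smul_mem _ (hS.act_h_mem _ _ _ ?_))
      rw [Finset.mem_range] at hs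
      have := ih (r - s) (by lia)
      rwa [Nat.cast_sub (by lia)] at this

theorem IsCartanStable.act_phi_mem {S : Submodule ℂ V} (hS : IsCartanStable (G := G) (q := q) S)
    (ε : ℤˣ) (i : I) (n : ℤ) {u : V} (hu : u ∈ S) : act G q V (Gen.φ ε i n) u ∈ S := by
  by_cases hn : (ε : ℤ) * n < 0
  · rw [act_phi_vanish ε i hn]
    exact S.zero_mem
  · obtain ⟨m, hm⟩ := Int.eq_ofNat_of_zero_le (not_lt.1 hn)
    have : n = (ε : ℤ) * m := by
      rw [← hm, ← mul_assoc, Int.units_coe_mul_self, one_mul]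
    exact this ▸ hS.act_phi_mul_mem ε i hu m

theorem eq_top_of_act_mem [hV : IsSimpleModule (QAff G q) V] {S : Submodule ℂ V}
    (hS : ∀ g, ∀ u ∈ S, act G q V g u ∈ S) (hne : S ≠ ⊥) : S = ⊤ := by
  have hfree (a : FreeAlgebra ℂ (Gen I)) : ∀ u ∈ S, freeAct G q V a u ∈ S := by
    induction a using FreeAlgebra.induction with
    | grade0 c => exact fun u hu => by simpa using S.smul_mem c hu
    | grade1 g => exact hS g
    | mul a b ha hb => exact fun u hu => by simpa using ha _ (hb u hu)
    | add a b ha hb => exact fun u hu => by simpa using S.add_mem (ha u hu) (hb u hu)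
  let T : Submodule (QAff G q) V :=
    { S with
      smul_mem' := fun a u hu => by
        obtain ⟨b, rfl⟩ := RingQuot.mkAlgHom_surjective ℂ (Rel G q) a
        exact hfree b u hu }
  rcases eq_bot_or_eq_top T with hT | hT
  · exact absurd (SetLike.ext fun u => SetLike.ext_iff.1 hT u : S = ⊥) hne
  · exact SetLike.ext fun u => SetLike.ext_iff.1 hT u

end Relations

section Lowering

open Module

variable {I : Type*} [DecidableEq I] {G : SimpleGraph I} [DecidableRel G.Adj] {q : ℂˣ}
  {V : Type*} [AddCommGroup V] [Module ℂ V] [Module (QAff G q) V] [IsScalarTower ℂ (QAff G q) V]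
  {S : Submodule ℂ V}

variable (G q) in
/-- The vectors obtained from those of `S` by applying lowering operators `x⁻_{j,r}`. -/
inductive IsLowered (S : Submodule ℂ V) : V → Prop
  | base {u : V} (hu : u ∈ S) : IsLowered S u
  | step (j : I) (r : ℤ) {u : V} (hu : IsLowered S u) :
      IsLowered S (act G q V (Gen.x (-1) j r) u)

variable (G q) in
/-- The subspace generated from `S` by the lowering operators `x⁻_{j,r}`. -/
def loweredSpan (S : Submodule ℂ V) : Submodule ℂ V := Submodule.span ℂ {u | IsLowered G q S u}

theorem IsLowered.mem_loweredSpan {u : V} (hu : IsLowered G q S u) : u ∈ loweredSpan G q S :=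
  Submodule.subset_span hu

theorem le_loweredSpan : S ≤ loweredSpan G q S := fun _ hu => (IsLowered.base hu).mem_loweredSpan

theorem map_mem_loweredSpan {f : End ℂ V}
    (hf : ∀ u, IsLowered G q S u → f u ∈ loweredSpan G q S) :
    ∀ u ∈ loweredSpan G q S, f u ∈ loweredSpan G q S := fun _ hu =>
  (Submodule.span_le.2 hf : loweredSpan G q S ≤ (loweredSpan G q S).comap f) hu

theorem act_lowering_mem_loweredSpan (j : I) (r : ℤ) :
    ∀ u ∈ loweredSpan G q S, act G q V (Gen.x (-1) j r) u ∈ loweredSpan G q S :=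
  map_mem_loweredSpan fun _ hu => (hu.step j r).mem_loweredSpan

theorem IsCartanStable.loweredSpan (hS : IsCartanStable (G := G) (q := q) S) :
    IsCartanStable (G := G) (q := q) (loweredSpan G q S) where
  act_k_mem ε i := map_mem_loweredSpan fun u hu => by
    induction hu with
    | base hu => exact le_loweredSpan (hS.act_k_mem ε i _ hu)
    | step j r _ ih =>
      rw [act_k_x_apply]
      exact Submodule.smul_mem _ _ (act_lowering_mem_loweredSpan j r _ ih)
  act_h_mem i r := map_mem_loweredSpan fun u hu => by
    rcases eq_or_ne r 0 with rfl | hr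
    · simp [act_h_zero]
    induction hu with
    | base hu => exact le_loweredSpan (hS.act_h_mem i r _ hu)
    | step j s hu ih =>
      rw [act_h_x_apply _ _ _ _ hr]
      exact Submodule.add_mem _ (act_lowering_mem_loweredSpan j s _ ih)
        (Submodule.smul_mem _ _ (hu.step j (r + s)).mem_loweredSpan)

theorem act_raising_mem_loweredSpan (hS : IsCartanStable (G := G) (q := q) S)
    (hx : ∀ i r, ∀ u ∈ S, act G q V (Gen.x 1 i r) u = 0) (i : I) (r : ℤ) :
    ∀ u ∈ loweredSpan G q S, act G q V (Gen.x 1 i r) u ∈ loweredSpan G q S :=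
  map_mem_loweredSpan fun u hu => by
    induction hu with
    | base hu =>
      rw [hx i r _ hu]
      exact Submodule.zero_mem _
    | step j s hu ih =>
      have hφ ε := hS.loweredSpan.act_phi_mem ε i (r + s) hu.mem_loweredSpan
      rw [act_xp_xm]
      refine Submodule.add_mem _ (act_lowering_mem_loweredSpan j s _ ih) ?_
      split_ifs
      exacts [Submodule.smul_mem _ _ (Submodule.sub_mem _ (hφ _) (hφ _)), Submodule.zero_mem _]

theorem loweredSpan_eq_top [IsSimpleModule (QAff G q) V] (hne : S ≠ ⊥)
    (hS : IsCartanStable (G := G) (q := q) S)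
    (hx : ∀ i r, ∀ u ∈ S, act G q V (Gen.x 1 i r) u = 0) : loweredSpan G q S = ⊤ := by
  refine eq_top_of_act_mem (G := G) (q := q) (fun g => ?_) (ne_bot_of_le_ne_bot hne le_loweredSpan)
  match g with
  | .x ε i r =>
    exact act_x_of_one_of_neg_one (p := fun f => ∀ u ∈ loweredSpan G q S, f u ∈ loweredSpan G q S)
      (act_raising_mem_loweredSpan hS hx) act_lowering_mem_loweredSpan ε i r
  | .k ε i => exact hS.loweredSpan.act_k_mem ε i
  | .h i r => exact hS.loweredSpan.act_h_mem i r
  | .φ ε i r => exact fun u hu => hS.loweredSpan.act_phi_mem ε i r hu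

end Lowering

section Monomials

variable {I : Type*} [DecidableEq I]

/-- The power sum `∑_a u_{i,a} a ^ r` of the monomial `∏ Y_{i,a}^{u_{i,a}}`. -/
def powerSum (i : I) (r : ℤ) : LMonomial I →+ ℂ :=
  Finsupp.liftAddHom fun y => if y.1 = i then
    (AddMonoidHom.mulRight ((y.2 ^ r : ℂˣ) : ℂ)).comp (Int.castAddHom ℂ) else 0

/-- The total exponent `∑_a u_{i,a}` of the monomial `∏ Y_{i,a}^{u_{i,a}}`. -/
def totalDegree (i : I) : LMonomial I →+ ℤ :=
  Finsupp.liftAddHom fun y => if y.1 = i then AddMonoidHom.id ℤ else 0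

theorem powerSum_single (i : I) (r : ℤ) (y : I × ℂˣ) (u : ℤ) :
    powerSum i r (Finsupp.single y u) = if y.1 = i then (u : ℂ) * ((y.2 ^ r : ℂˣ) : ℂ) else 0 := by
  rw [powerSum, Finsupp.liftAddHom_apply_single]
  split_ifs <;> simp

theorem totalDegree_single (i : I) (y : I × ℂˣ) (u : ℤ) :
    totalDegree i (Finsupp.single y u) = if y.1 = i then u else 0 := by
  rw [totalDegree, Finsupp.liftAddHom_apply_single]
  split_ifs <;> simp

theorem powerSum_zero (m : LMonomial I) (i : I) : powerSum i 0 m = (totalDegree i m : ℂ) := by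
  suffices powerSum i 0 = (Int.castAddHom ℂ).comp (totalDegree i) from DFunLike.congr_fun this m
  ext y
  simp only [AddMonoidHom.comp_apply, Finsupp.singleAddHom_apply, powerSum_single,
    totalDegree_single]
  split_ifs <;> simp

variable {q : ℂˣ}

theorem hValue_eq (m : LMonomial I) (i : I) (r : ℤ) :
    hValue q m i r = qInt q r / (r : ℂ) * powerSum i r m := by
  rw [hValue, powerSum, Finsupp.liftAddHom_apply]
  refine congrArg _ (Finsupp.sum_congr fun y _ => ?_)
  split_ifs <;> simp

theorem kValue_eq (m : LMonomial I) (i : I) :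
    kValue q m i = ((q ^ totalDegree i m : ℂˣ) : ℂ) := by
  rw [kValue, totalDegree, Finsupp.liftAddHom_apply]
  refine congrArg (fun n : ℤ => ((q ^ n : ℂˣ) : ℂ)) (Finsupp.sum_congr fun y _ => ?_)
  split_ifs <;> simp

theorem kValue_add (m m' : LMonomial I) (i : I) :
    kValue q (m + m') i = kValue q m i * kValue q m' i := by
  simp only [kValue_eq, map_add, zpow_add, Units.val_mul]

theorem hValue_add (m m' : LMonomial I) (i : I) (r : ℤ) :
    hValue q (m + m') i r = hValue q m i r + hValue q m' i r := by
  simp only [hValue_eq, map_add, mul_add]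

theorem qInt_zero : qInt q 0 = 0 := by simp [qInt]

theorem qInt_neg (n : ℤ) : qInt q (-n) = -qInt q n := by
  rw [qInt, qInt, neg_neg, ← neg_div, neg_sub]

theorem qInt_mul_two (r : ℤ) :
    qInt q (r * 2) = qInt q r * (((q ^ r : ℂˣ) : ℂ) + ((q ^ (-r) : ℂˣ) : ℂ)) := by
  rw [qInt, qInt, div_mul_eq_mul_div, mul_two, neg_add, zpow_add, zpow_add]
  push_cast
  ring

theorem sub_inv_ne_zero (hq : ¬IsOfFinOrder q) : (q : ℂ) - ((q⁻¹ : ℂˣ) : ℂ) ≠ 0 := fun h => by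
  have : q = q⁻¹ := Units.ext (sub_eq_zero.1 h)
  exact hq (isOfFinOrder_iff_pow_eq_one.2 ⟨2, two_pos, by rwa [pow_two, ← eq_inv_iff_mul_eq_one]⟩)

theorem qInt_ne_zero (hq : ¬IsOfFinOrder q) {r : ℤ} (hr : r ≠ 0) : qInt q r ≠ 0 := by
  refine div_ne_zero (fun h => hr ?_) (sub_inv_ne_zero hq)
  have := injective_zpow_iff_not_isOfFinOrder.2 hq (Units.ext (sub_eq_zero.1 h))
  lia

theorem powerSum_eq_sum_curry (m : LMonomial I) (i : I) (r : ℤ) :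
    powerSum i r m = (m.curry i).sum fun a u => (u : ℂ) * ((a ^ r : ℂˣ) : ℂ) := by
  let f (j : I) (a : ℂˣ) (u : ℤ) : ℂ := if j = i then (u : ℂ) * ((a ^ r : ℂˣ) : ℂ) else 0
  have hf : powerSum i r m = m.sum fun y u => f y.1 y.2 u := by
    rw [powerSum, Finsupp.liftAddHom_apply]
    refine Finsupp.sum_congr fun y _ => ?_
    by_cases h : y.1 = i <;> simp [f, h]
  rw [hf, ← Finsupp.sum_curry_index m f, Finsupp.sum_eq_single i]
  · simp [f]
  · exact fun j _ hj => Finset.sum_eq_zero fun a _ => if_neg hj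
  · exact fun _ => Finsupp.sum_zero_index

theorem eq_zero_of_powerSum_eq_zero {m : LMonomial I} (h : ∀ i r, powerSum i r m = 0) :
    m = 0 := by
  -- Dedekind: distinct characters `r ↦ a ^ r` of `ℤ` are linearly independent.
  have hinj : Function.Injective fun a : ℂˣ => (Units.coeHom ℂ).comp (zpowersHom ℂˣ a) :=
    fun a b hab => Units.ext (by simpa using DFunLike.congr_fun hab (Multiplicative.ofAdd 1))
  have hli := ((linearIndependent_monoidHom (Multiplicative ℤ) ℂ).comp _ hinj).restrict_scalars' ℤ
  ext ⟨i, a⟩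
  rw [← Finsupp.curry_apply, linearIndependent_iff.1 hli (m.curry i)]
  · rfl
  · ext r
    rw [Finsupp.linearCombination_apply, Finsupp.sum_apply']
    simpa [powerSum_eq_sum_curry] using h i r.toAdd

theorem eq_of_kValue_eq_of_hValue_eq (hq : ¬IsOfFinOrder q) {m m' : LMonomial I}
    (hk : ∀ i, kValue q m i = kValue q m' i)
    (hh : ∀ i r, r ≠ 0 → hValue q m i r = hValue q m' i r) : m = m' := by
  refine sub_eq_zero.1 (eq_zero_of_powerSum_eq_zero fun i r => ?_)
  rw [map_sub, sub_eq_zero]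
  rcases eq_or_ne r 0 with rfl | hr
  · have := hk i
    rw [kValue_eq, kValue_eq] at this
    rw [powerSum_zero, powerSum_zero,
      injective_zpow_iff_not_isOfFinOrder.2 hq (Units.ext this)]
  · have := hh i r hr
    rw [hValue_eq, hValue_eq] at this
    exact mul_left_cancel₀ (div_ne_zero (qInt_ne_zero hq hr) (by exact_mod_cast hr)) this

variable [Fintype I] {G : SimpleGraph I} [DecidableRel G.Adj]

/-- The monomial `A_{j,b}^{-1}`. -/
def aInv (G : SimpleGraph I) [DecidableRel G.Adj] (q : ℂˣ) (j : I) (b : ℂˣ) : LMonomial I :=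
  (∑ k, if G.Adj k j then Finsupp.single (k, b) 1 else 0) -
    (Finsupp.single (j, b * q) 1 + Finsupp.single (j, b * q⁻¹) 1)

theorem totalDegree_aInv (i j : I) (b : ℂˣ) :
    totalDegree i (aInv G q j b) = -cartan G i j := by
  have hadj : ∀ k, totalDegree i (if G.Adj k j then Finsupp.single (k, b) 1 else 0) =
      if k = i then (if G.Adj i j then 1 else 0) else 0 := fun k => by
    rcases eq_or_ne k i with rfl | hk <;> split_ifs <;> simp_all [totalDegree_single]
  simp only [aInv, map_sub, map_add, map_sum, hadj, totalDegree_single, Finset.sum_ite_eq',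
    Finset.mem_univ, if_true, cartan]
  rcases eq_or_ne i j with rfl | hij
  · simp
  · split_ifs <;> simp_all

theorem hValue_aInv (i j : I) (b : ℂˣ) (r : ℤ) :
    hValue q (aInv G q j b) i r =
      -(qInt q (r * cartan G i j) / (r : ℂ)) * ((b ^ r : ℂˣ) : ℂ) := by
  have hadj : ∀ k, powerSum i r (if G.Adj k j then Finsupp.single (k, b) 1 else 0) =
      if k = i then (if G.Adj i j then ((b ^ r : ℂˣ) : ℂ) else 0) else 0 := fun k => by
    rcases eq_or_ne k i with rfl | hk <;> split_ifs <;> simp_all [powerSum_single]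
  simp only [hValue_eq, aInv, map_sub, map_add, map_sum, hadj, powerSum_single,
    Finset.sum_ite_eq', Finset.mem_univ, if_true, cartan]
  rcases eq_or_ne i j with rfl | hij
  · simp only [SimpleGraph.irrefl, if_false, if_true, qInt_mul_two, mul_zpow, inv_zpow', zpow_neg]
    push_cast
    ring
  · simp only [hij, hij.symm, if_false]
    split_ifs
    · rw [mul_neg, mul_one, qInt_neg]
      ring
    · simp [qInt_zero]

theorem kValue_aInv (i j : I) (b : ℂˣ) :
    kValue q (aInv G q j b) i = ((q ^ (-cartan G i j) : ℂˣ) : ℂ) := by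
  rw [kValue_eq, totalDegree_aInv]

end Monomials

/-! ## Lowering operators and `l`-weights -/

section GeneralizedEigenspaces

open Module

attribute [local instance] LieRing.ofAssociativeRing

variable {R M N : Type*} [CommRing R] [AddCommGroup M] [Module R M] [AddCommGroup N] [Module R N]

theorem apply_mem_maxGenEigenspace_of_comp_eq {A : End R M} {B : End R N} {f : M →ₗ[R] N}
    (h : B ∘ₗ f = f ∘ₗ A) {c : R} {u : M} (hu : u ∈ A.maxGenEigenspace c) :
    f u ∈ B.maxGenEigenspace c := by
  obtain ⟨n, hn⟩ := (End.mem_maxGenEigenspace _ _ _).1 hu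
  have hsub : (B - c • 1) ∘ₗ f = f ∘ₗ (A - c • 1) := by
    rw [LinearMap.sub_comp, LinearMap.comp_sub, h, LinearMap.smul_comp, LinearMap.comp_smul,
      End.one_eq_id, End.one_eq_id, LinearMap.id_comp, LinearMap.comp_id]
  refine (End.mem_maxGenEigenspace _ _ _).2 ⟨n, ?_⟩
  rw [← LinearMap.comp_apply, End.commute_pow_left_of_commute hsub, LinearMap.comp_apply, hn,
    map_zero]

theorem maxGenEigenspace_le_of_sub_eq_mul {A B g : End R M} {a b : R}
    (hg : Commute g (A - a • 1)) (h : B - b • 1 = g * (A - a • 1)) :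
    A.maxGenEigenspace a ≤ B.maxGenEigenspace b := fun u hu => by
  obtain ⟨n, hn⟩ := (End.mem_maxGenEigenspace _ _ _).1 hu
  refine (End.mem_maxGenEigenspace _ _ _).2 ⟨n, ?_⟩
  rw [h, hg.mul_pow, End.mul_apply, hn, map_zero]

theorem maxGenEigenspace_le_smul (A : End R M) (a c : R) :
    A.maxGenEigenspace a ≤ (c • A).maxGenEigenspace (c * a) :=
  maxGenEigenspace_le_of_sub_eq_mul ((Commute.one_left _).smul_left c)
    (by rw [smul_mul_assoc, one_mul, smul_sub, smul_smul])

theorem maxGenEigenspace_le_pow (A : End R M) (a : R) (n : ℕ) :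
    A.maxGenEigenspace a ≤ (A ^ n).maxGenEigenspace (a ^ n) := by
  have hcomm : Commute A (a • 1) := (Commute.one_right A).smul_right a
  refine maxGenEigenspace_le_of_sub_eq_mul
    (g := ∑ k ∈ Finset.range n, A ^ k * (a • 1) ^ (n - 1 - k))
    (Commute.sum_left _ _ _ fun k _ => ?_) ?_
  · exact ((((Commute.refl A).sub_right hcomm).pow_left k).mul_left
      ((hcomm.symm.sub_right (Commute.refl _)).pow_left _))
  · rw [hcomm.geom_sum₂_mul, smul_pow, one_pow]

theorem maxGenEigenspace_le_inv (T : (End R M)ˣ) (b : Rˣ) :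
    (T : End R M).maxGenEigenspace (b : R) ≤
      ((T⁻¹ : (End R M)ˣ) : End R M).maxGenEigenspace ((b⁻¹ : Rˣ) : R) := by
  have hcomm : Commute ((T⁻¹ : (End R M)ˣ) : End R M) (T - (b : R) • 1) :=
    (Commute.refl (T : End R M)).units_inv_left.sub_right ((Commute.one_right _).smul_right _)
  refine maxGenEigenspace_le_of_sub_eq_mul (hcomm.smul_left (-((b⁻¹ : Rˣ) : R))) ?_
  rw [smul_mul_assoc, mul_sub, Units.inv_mul, mul_smul_comm, mul_one, smul_sub, smul_smul, neg_mul,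
    Units.inv_mul]
  module

theorem maxGenEigenspace_le_zpow (T : (End R M)ˣ) (b : Rˣ) (r : ℤ) :
    (T : End R M).maxGenEigenspace (b : R) ≤
      ((T ^ r : (End R M)ˣ) : End R M).maxGenEigenspace ((b ^ r : Rˣ) : R) := by
  have hpow (n : ℕ) : (T : End R M).maxGenEigenspace (b : R) ≤
      ((T ^ n : (End R M)ˣ) : End R M).maxGenEigenspace ((b ^ n : Rˣ) : R) := by
    simpa only [Units.val_pow_eq_pow_val] using maxGenEigenspace_le_pow (T : End R M) (b : R) n
  obtain ⟨n, rfl | rfl⟩ := r.eq_nat_or_neg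
  · simpa only [zpow_natCast] using hpow n
  · simpa only [zpow_neg, zpow_natCast] using
      (hpow n).trans (maxGenEigenspace_le_inv (T ^ n) (b ^ n))

theorem maxGenEigenspace_zero_eq_bot (T : (End R M)ˣ) :
    (T : End R M).maxGenEigenspace 0 = ⊥ := by
  refine (Submodule.eq_bot_iff _).2 fun u hu => ?_
  obtain ⟨n, hn⟩ := (End.mem_maxGenEigenspace _ _ _).1 hu
  rw [zero_smul, sub_zero, ← Units.val_pow_eq_pow_val] at hn
  rw [← End.one_apply (R := R) u, ← Units.inv_mul (T ^ n), End.mul_apply, hn, map_zero]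

theorem iSup_units_maxGenEigenspace_eq_top {K E : Type*} [Field K] [IsAlgClosed K]
    [AddCommGroup E] [Module K E] [FiniteDimensional K E] (T : (End K E)ˣ) :
    ⨆ b : Kˣ, (T : End K E).maxGenEigenspace (b : K) = ⊤ := by
  refine eq_top_iff.2 ((End.iSup_maxGenEigenspace_eq_top (T : End K E)).ge.trans ?_)
  refine iSup_le fun b => ?_
  rcases eq_or_ne b 0 with rfl | hb
  · rw [maxGenEigenspace_zero_eq_bot]
    exact bot_le
  · exact le_iSup (fun b : Kˣ => (T : End K E).maxGenEigenspace (b : K)) (Units.mk0 b hb)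

theorem apply_mem_maxGenEigenspace_add {H f : End R M} {a c : R} {u : M}
    (hf : f ∈ (LieAlgebra.ad R (End R M) H).maxGenEigenspace a)
    (hu : u ∈ H.maxGenEigenspace c) : f u ∈ H.maxGenEigenspace (a + c) := by
  have h := LieModule.lie_mem_maxGenEigenspace_toEnd (R := R) (L := End R M) (x := H) (m := u)
    (χ₂ := c) hf (by rwa [LieModule.toEnd_module_end, LieHom.id_apply])
  rwa [LieModule.toEnd_module_end, LieHom.id_apply] at h

end GeneralizedEigenspaces

section LWeights

open Module

variable {I : Type*} [DecidableEq I] {G : SimpleGraph I} [DecidableRel G.Adj] {q : ℂˣ}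
  {V : Type*} [AddCommGroup V] [Module ℂ V] [Module (QAff G q) V] [IsScalarTower ℂ (QAff G q) V]

theorem mem_lWeightSpace {m : LMonomial I} {u : V} : u ∈ lWeightSpace G q V m ↔
    (∀ i, u ∈ (act G q V (Gen.k 1 i)).maxGenEigenspace (kValue q m i)) ∧
      ∀ i r, r ≠ 0 → u ∈ (act G q V (Gen.h i r)).maxGenEigenspace (hValue q m i r) := by
  simp only [lWeightSpace, Submodule.mem_inf, Submodule.mem_iInf]

theorem apply_mem_lWeightSpace_of_commute {f : End ℂ V}
    (hk : ∀ i, Commute (act G q V (Gen.k 1 i)) f)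
    (hh : ∀ i r, Commute (act G q V (Gen.h i r)) f) {m : LMonomial I} {u : V}
    (hu : u ∈ lWeightSpace G q V m) : f u ∈ lWeightSpace G q V m :=
  mem_lWeightSpace.2
    ⟨fun i => End.mapsTo_maxGenEigenspace_of_comm (hk i) _ ((mem_lWeightSpace.1 hu).1 i),
      fun i r hr =>
        End.mapsTo_maxGenEigenspace_of_comm (hh i r) _ ((mem_lWeightSpace.1 hu).2 i r hr)⟩

theorem iSupIndep_lWeightSpace (hq : ¬IsOfFinOrder q) :
    iSupIndep fun m : LMonomial I => lWeightSpace G q V m := by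
  let F : I ⊕ I × ℤ → End ℂ V := Sum.elim (fun i => act G q V (Gen.k 1 i))
    fun y => act G q V (Gen.h y.1 y.2)
  let χ (m : LMonomial I) : I ⊕ I × ℤ → ℂ := Sum.elim (fun i => kValue q m i)
    fun y => hValue q m y.1 y.2
  have hcomm : ∀ a b, Commute (F a) (F b) := by
    rintro (i | ⟨i, r⟩) (j | ⟨j, s⟩)
    exacts [act_k_comm 1 1 i j, act_k_h_comm 1 i j s, (act_k_h_comm 1 j i r).symm,
      act_h_comm i j r s]
  have hχ : Function.Injective χ := fun m m' h =>
    eq_of_kValue_eq_of_hValue_eq hq (fun i => congrFun h (Sum.inl i))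
      fun i r _ => congrFun h (Sum.inr (i, r))
  refine ((End.independent_iInf_maxGenEigenspace_of_forall_mapsTo F fun a b φ =>
    End.mapsTo_maxGenEigenspace_of_comm (hcomm b a) φ).comp hχ).mono fun m u hu => ?_
  obtain ⟨hk, hh⟩ := mem_lWeightSpace.1 hu
  refine (Submodule.mem_iInf _).2 ?_
  rintro (i | ⟨i, r⟩)
  · exact hk i
  · rcases eq_or_ne r 0 with rfl | hr
    · exact (End.mem_maxGenEigenspace _ _ _).2 ⟨1, by simp [F, χ, act_h_zero, hValue, qInt_zero]⟩
    · exact hh i r hr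

end LWeights

section Shift

open Module

attribute [local instance] LieRing.ofAssociativeRing

variable {I : Type*} [DecidableEq I] {G : SimpleGraph I} [DecidableRel G.Adj] {q : ℂˣ}
  {V : Type*} [AddCommGroup V] [Module ℂ V] [Module (QAff G q) V] [IsScalarTower ℂ (QAff G q) V]

variable (G q V) in
/-- The span of the lowering operators `x⁻_{j,s}`, `s ∈ ℤ`. -/
def loweringOperators (j : I) : Submodule ℂ (End ℂ V) :=
  Submodule.span ℂ (Set.range fun s : ℤ => act G q V (Gen.x (-1) j s))

variable (G q V) in
/-- The lowering operator `x⁻_{j,s}` as an element of `loweringOperators G q V j`. -/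
def lowering (j : I) (s : ℤ) : loweringOperators G q V j :=
  ⟨act G q V (Gen.x (-1) j s), Submodule.subset_span ⟨s, rfl⟩⟩

theorem loweringOperators_hom_ext {N : Type*} [AddCommGroup N] [Module ℂ N] {j : I}
    {A B : loweringOperators G q V j →ₗ[ℂ] N}
    (h : ∀ s, A (lowering G q V j s) = B (lowering G q V j s)) : A = B :=
  LinearMap.ext_on Submodule.span_span_coe_preimage (by rintro ⟨_, _⟩ ⟨s, rfl⟩; exact h s)

theorem ad_h_lowering (i j : I) {r : ℤ} (hr : r ≠ 0) (s : ℤ) :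
    LieAlgebra.ad ℂ (End ℂ V) (act G q V (Gen.h i r)) (lowering G q V j s) =
      (-(qInt q (r * cartan G i j) / (r : ℂ))) • (lowering G q V j (s + r) : End ℂ V) := by
  refine (lie_act_h_x (V := V) (G := G) (q := q) (-1) i j s hr).trans ?_
  simp [lowering, add_comm r s]

theorem ad_h_mem_loweringOperators (i j : I) {r : ℤ} (hr : r ≠ 0) :
    ∀ f ∈ loweringOperators G q V j,
      LieAlgebra.ad ℂ (End ℂ V) (act G q V (Gen.h i r)) f ∈ loweringOperators G q V j := by
  refine fun f hf => (Submodule.span_le.2 ?_ : loweringOperators G q V j ≤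
    (loweringOperators G q V j).comap (LieAlgebra.ad ℂ (End ℂ V) (act G q V (Gen.h i r)))) hf
  rintro _ ⟨s, rfl⟩
  change LieAlgebra.ad ℂ (End ℂ V) (act G q V (Gen.h i r)) (lowering G q V j s) ∈
    loweringOperators G q V j
  rw [ad_h_lowering i j hr s]
  exact Submodule.smul_mem _ _ (Subtype.mem _)

/-- The translation by `r` of the currents is, up to a nonzero scalar, the commutator with
`h_{j,r}`. -/
theorem exists_end_lowering_add (hq : ¬IsOfFinOrder q) (j : I) {r : ℤ} (hr : r ≠ 0) :
    ∃ A : End ℂ (loweringOperators G q V j),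
      ∀ s, A (lowering G q V j s) = lowering G q V j (s + r) := by
  have hc : qInt q (r * cartan G j j) / (r : ℂ) ≠ 0 :=
    div_ne_zero (qInt_ne_zero hq (by simp [cartan, hr])) (by exact_mod_cast hr)
  refine ⟨(-(qInt q (r * cartan G j j) / (r : ℂ)))⁻¹ •
    (LieAlgebra.ad ℂ (End ℂ V) (act G q V (Gen.h j r))).restrict
      (ad_h_mem_loweringOperators j j hr),
    fun s => Subtype.ext ?_⟩
  rw [LinearMap.smul_apply, Submodule.coe_smul, LinearMap.coe_restrict_apply, ad_h_lowering j j hr,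
    inv_smul_smul₀ (neg_ne_zero.2 hc)]

theorem exists_unit_zpow_lowering (hq : ¬IsOfFinOrder q) (j : I) :
    ∃ T : (End ℂ (loweringOperators G q V j))ˣ, ∀ r s : ℤ,
      ((T ^ r : (End ℂ (loweringOperators G q V j))ˣ) : End ℂ (loweringOperators G q V j))
        (lowering G q V j s) = lowering G q V j (s + r) := by
  obtain ⟨A, hA⟩ := exists_end_lowering_add (G := G) (V := V) hq j one_ne_zero
  obtain ⟨B, hB⟩ := exists_end_lowering_add (G := G) (V := V) hq j (neg_ne_zero.2 one_ne_zero)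
  refine ⟨⟨A, B, loweringOperators_hom_ext fun s => by simp [End.mul_apply, hA, hB],
    loweringOperators_hom_ext fun s => by simp [End.mul_apply, hA, hB]⟩, fun r => ?_⟩
  induction r with
  | zero => simp
  | succ n ih =>
    intro s
    rw [zpow_add_one, Units.val_mul, End.mul_apply, Units.val_mk, hA, ih, add_right_comm, add_assoc]
  | pred n ih =>
    intro s
    rw [zpow_sub_one, Units.val_mul, End.mul_apply, Units.inv_mk, Units.val_mk, hB, ih]
    congr 1
    ring

theorem k_mul_of_mem_loweringOperators {j : I} {f : End ℂ V}
    (hf : f ∈ loweringOperators G q V j) (i : I) :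
    act G q V (Gen.k 1 i) * f =
      ((q ^ (-cartan G i j) : ℂˣ) : ℂ) • (f * act G q V (Gen.k 1 i)) := by
  suffices LinearMap.mulLeft ℂ (act G q V (Gen.k 1 i)) ∘ₗ (loweringOperators G q V j).subtype =
      ((q ^ (-cartan G i j) : ℂˣ) : ℂ) •
        LinearMap.mulRight ℂ (act G q V (Gen.k 1 i)) ∘ₗ (loweringOperators G q V j).subtype from
    LinearMap.congr_fun this ⟨f, hf⟩
  refine loweringOperators_hom_ext fun s => ?_
  simpa [lowering] using act_k_x (V := V) (G := G) (q := q) 1 (-1) i j s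

variable [Fintype I]

theorem apply_mem_lWeightSpace_add_aInv {j : I} {T : (End ℂ (loweringOperators G q V j))ˣ}
    (hT : ∀ r s : ℤ,
      ((T ^ r : (End ℂ (loweringOperators G q V j))ˣ) : End ℂ (loweringOperators G q V j))
        (lowering G q V j s) = lowering G q V j (s + r))
    {b : ℂˣ} {f : loweringOperators G q V j}
    (hf : f ∈ (T : End ℂ (loweringOperators G q V j)).maxGenEigenspace (b : ℂ))
    {m : LMonomial I} {u : V} (hu : u ∈ lWeightSpace G q V m) :
    (f : End ℂ V) u ∈ lWeightSpace G q V (m + aInv G q j b) := by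
  obtain ⟨huk, huh⟩ := mem_lWeightSpace.1 hu
  refine mem_lWeightSpace.2 ⟨fun i => ?_, fun i r hr => ?_⟩
  · rw [kValue_add, kValue_aInv, mul_comm]
    refine apply_mem_maxGenEigenspace_of_comp_eq ?_ (maxGenEigenspace_le_smul _ _ _ (huk i))
    rw [LinearMap.comp_smul]
    exact k_mul_of_mem_loweringOperators f.2 i
  · rw [hValue_add, hValue_aInv, add_comm]
    refine apply_mem_maxGenEigenspace_add ?_ (huh i r hr)
    refine apply_mem_maxGenEigenspace_of_comp_eq (f := (loweringOperators G q V j).subtype)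
      (loweringOperators_hom_ext fun s => ?_)
      (maxGenEigenspace_le_smul _ _ (-(qInt q (r * cartan G i j) / (r : ℂ)))
        (maxGenEigenspace_le_zpow T b r hf))
    simp only [LinearMap.comp_apply, LinearMap.smul_apply, hT, map_smul, Submodule.subtype_apply,
      ad_h_lowering i j hr]

/-- The translation `x⁻_{j,s} ↦ x⁻_{j,s+1}` of the currents has generalized eigenvectors; the one
of eigenvalue `b` shifts `l`-weights by `A_{j,b}^{-1}`. -/
theorem act_lowering_mem_iSup [FiniteDimensional ℂ V] (hq : ¬IsOfFinOrder q)
    {m : LMonomial I} (j : I) (s : ℤ) {u : V} (hu : u ∈ lWeightSpace G q V m) :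
    act G q V (Gen.x (-1) j s) u ∈ ⨆ b : ℂˣ, lWeightSpace G q V (m + aInv G q j b) := by
  obtain ⟨T, hT⟩ := exists_unit_zpow_lowering (G := G) (V := V) hq j
  have hle : (⨆ b : ℂˣ, (T : End ℂ (loweringOperators G q V j)).maxGenEigenspace (b : ℂ)) ≤
      (⨆ b : ℂˣ, lWeightSpace G q V (m + aInv G q j b)).comap
        (LinearMap.applyₗ u ∘ₗ (loweringOperators G q V j).subtype) :=
    iSup_le fun b _ hf => Submodule.mem_iSup_of_mem b (apply_mem_lWeightSpace_add_aInv hT hf hu)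
  rw [iSup_units_maxGenEigenspace_eq_top] at hle
  exact hle (Submodule.mem_top (x := lowering G q V j s))

end Shift

section Currents

variable {R : Type*} [CommRing R]

/-- The coefficients of the power series `κ (1 - β z) / (1 - α z)`, the eigenvalue of a
loop-Cartan current. -/
def currentCoeff (κ α β : R) : ℕ → R
  | 0 => κ
  | n + 1 => κ * (α - β) * α ^ n

/-- Indeed `∑ₛ (α ^ (s + 1) - β ^ (s + 1)) zˢ` is the logarithmic derivative of
`κ (1 - β z) / (1 - α z)`. -/
theorem sum_range_mul_currentCoeff (κ α β : R) (n : ℕ) :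
    ∑ s ∈ Finset.range (n + 1), (α ^ (s + 1) - β ^ (s + 1)) * currentCoeff κ α β (n - s) =
      (n + 1) * currentCoeff κ α β (n + 1) := by
  have hterm : ∀ s ∈ Finset.range n,
      (α ^ (s + 1) - β ^ (s + 1)) * currentCoeff κ α β (n - s) =
        κ * ((α - β) * α ^ n - β * (β ^ s * α ^ (n - 1 - s) * (α - β))) := fun s hs => by
    obtain ⟨d, rfl⟩ := Nat.exists_eq_add_of_lt (Finset.mem_range.1 hs)
    rw [show s + d + 1 - s = d + 1 by lia, show s + d + 1 - 1 - s = d by lia, currentCoeff]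
    ring
  have hgeom := geom_sum₂_mul β α n
  rw [Finset.sum_range_succ, Nat.sub_self, Finset.sum_congr rfl hterm, ← Finset.mul_sum,
    Finset.sum_sub_distrib, ← Finset.mul_sum, ← Finset.mul_sum, ← Finset.sum_mul,
    Finset.sum_const, Finset.card_range, nsmul_eq_mul, currentCoeff, currentCoeff]
  linear_combination κ * β * hgeom

theorem currentCoeff_succ_of_eq {κ α β : Rˣ} (h : α = κ ^ 2 * β) (n : ℕ) :
    currentCoeff (κ : R) α β (n + 1) = (α : R) ^ (n + 1) * (κ - (κ⁻¹ : Rˣ)) := by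
  subst h
  rw [currentCoeff]
  push_cast
  linear_combination ((κ * β * ((κ : R) ^ 2 * β) ^ n)) * κ.mul_inv

variable {I : Type*} [DecidableEq I] {G : SimpleGraph I} [DecidableRel G.Adj] {q : ℂˣ}
  {V : Type*} [AddCommGroup V] [Module ℂ V] [Module (QAff G q) V] [IsScalarTower ℂ (QAff G q) V]

theorem act_k_apply {v : V} {i : I} {κ : ℂˣ} (hk : act G q V (Gen.k 1 i) v = (κ : ℂ) • v)
    (ε : ℤˣ) : act G q V (Gen.k ε i) v = ((κ ^ (ε : ℤ) : ℂˣ) : ℂ) • v := by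
  rcases Int.units_eq_one_or ε with rfl | rfl
  · simpa using hk
  · have hinv := LinearMap.congr_fun (act_k_mul_inv (G := G) (q := q) (V := V) (-1) i) v
    rw [neg_neg, Module.End.mul_apply, hk, map_smul, Module.End.one_apply] at hinv
    simpa [eq_inv_smul_iff₀ κ.ne_zero] using hinv

/-- The current `φ^ε_i` is `k_i^ε` times the exponential of the generating series of the
`h_{i,εr}`; on an eigenvector it is determined by its logarithmic derivative. -/
theorem act_phi_apply (hq : ¬IsOfFinOrder q) {v : V} {i : I} {κ A B : ℂˣ}
    (hk : act G q V (Gen.k 1 i) v = (κ : ℂ) • v)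
    (hh : ∀ r : ℤ, r ≠ 0 → act G q V (Gen.h i r) v =
      ((((A ^ r : ℂˣ) : ℂ) - ((B ^ r : ℂˣ) : ℂ)) / (r * ((q : ℂ) - ((q⁻¹ : ℂˣ) : ℂ)))) • v)
    (ε : ℤˣ) (n : ℕ) : act G q V (Gen.φ ε i ((ε : ℤ) * n)) v =
      currentCoeff ((κ ^ (ε : ℤ) : ℂˣ) : ℂ) ((A ^ (ε : ℤ) : ℂˣ) : ℂ) ((B ^ (ε : ℤ) : ℂˣ) : ℂ) n •
        v := by
  have hqq := sub_inv_ne_zero hq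
  induction n using Nat.strong_induction_on with
  | _ n ih =>
    rcases n with _ | r
    · simpa [act_phi_zero, currentCoeff] using act_k_apply hk ε
    have hterm : ∀ s ∈ Finset.range (r + 1),
        (((ε : ℤ) : ℂ) * ((q : ℂ) - ((q⁻¹ : ℂˣ) : ℂ))) • ((s : ℂ) + 1) •
          act G q V (Gen.h i ((ε : ℤ) * (s + 1)))
            (act G q V (Gen.φ ε i ((ε : ℤ) * ((r : ℤ) - s))) v) =
        ((((A ^ (ε : ℤ) : ℂˣ) : ℂ) ^ (s + 1) - ((B ^ (ε : ℤ) : ℂˣ) : ℂ) ^ (s + 1)) *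
          currentCoeff ((κ ^ (ε : ℤ) : ℂˣ) : ℂ) ((A ^ (ε : ℤ) : ℂˣ) : ℂ)
            ((B ^ (ε : ℤ) : ℂˣ) : ℂ) (r - s)) • v := fun s hs => by
      have hsr : ((r : ℤ) - s) = ((r - s : ℕ) : ℤ) := by grind
      have hε : ((ε : ℤ) : ℂ) ≠ 0 := by exact_mod_cast ε.ne_zero
      have hs0 : ((s : ℂ) + 1) ≠ 0 := by exact_mod_cast s.succ_ne_zero
      have hpow (X : ℂˣ) : X ^ ((ε : ℤ) * (s + 1)) = (X ^ (ε : ℤ)) ^ (s + 1) := by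
        rw [zpow_mul]
        exact_mod_cast rfl
      rw [hsr, ih (r - s) (by lia), map_smul, hh _ (mul_ne_zero ε.ne_zero (by lia)), smul_smul,
        smul_smul, smul_smul, hpow, hpow]
      congr 1
      generalize (q : ℂ) - ((q⁻¹ : ℂˣ) : ℂ) = c at hqq
      push_cast
      field_simp
    have hr : (r : ℂ) + 1 ≠ 0 := by exact_mod_cast r.succ_ne_zero
    refine smul_right_injective V hr ?_
    have hsum := act_phi_succ (G := G) (q := q) ε i r v
    rw [Finset.smul_sum, Finset.sum_congr rfl hterm, ← Finset.sum_smul,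
      sum_range_mul_currentCoeff, mul_smul] at hsum
    exact_mod_cast hsum

theorem act_phi_sub_apply (hq : ¬IsOfFinOrder q) {v : V} {i : I} {κ A B : ℂˣ}
    (hAB : A = κ ^ 2 * B) (hk : act G q V (Gen.k 1 i) v = (κ : ℂ) • v)
    (hh : ∀ r : ℤ, r ≠ 0 → act G q V (Gen.h i r) v =
      ((((A ^ r : ℂˣ) : ℂ) - ((B ^ r : ℂˣ) : ℂ)) / (r * ((q : ℂ) - ((q⁻¹ : ℂˣ) : ℂ)))) • v)
    (n : ℤ) : act G q V (Gen.φ 1 i n) v - act G q V (Gen.φ (-1) i n) v =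
      (((A ^ n : ℂˣ) : ℂ) * ((κ : ℂ) - ((κ⁻¹ : ℂˣ) : ℂ))) • v := by
  have hplus (n : ℕ) := act_phi_apply hq hk hh 1 n
  have hminus (n : ℕ) := act_phi_apply hq hk hh (-1) n
  simp only [Units.val_one, one_mul, zpow_one] at hplus
  simp only [Units.val_neg, Units.val_one, neg_one_mul, zpow_neg, zpow_one] at hminus
  rcases lt_trichotomy n 0 with hn | rfl | hn
  · obtain ⟨m, rfl⟩ : ∃ m : ℕ, n = -((m + 1 : ℕ) : ℤ) := ⟨(-n - 1).toNat, by lia⟩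
    rw [act_phi_vanish 1 i (by simpa using hn), hminus, LinearMap.zero_apply, zero_sub, ← neg_smul,
      currentCoeff_succ_of_eq (by rw [hAB, mul_inv, inv_pow]), inv_inv, zpow_neg, zpow_natCast,
      ← inv_pow, Units.val_pow_eq_pow_val, ← mul_neg, neg_sub]
  · have hplus_zero := hplus 0
    have hminus_zero := hminus 0
    rw [Nat.cast_zero, currentCoeff] at hplus_zero
    rw [Nat.cast_zero, neg_zero, currentCoeff] at hminus_zero
    rw [hplus_zero, hminus_zero, ← sub_smul, zpow_zero, Units.val_one, one_mul]
  · obtain ⟨m, rfl⟩ : ∃ m : ℕ, n = ((m + 1 : ℕ) : ℤ) := ⟨(n - 1).toNat, by lia⟩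
    rw [act_phi_vanish (-1) i (by push_cast; lia), hplus, LinearMap.zero_apply, sub_zero,
      currentCoeff_succ_of_eq hAB, zpow_natCast, Units.val_pow_eq_pow_val]

end Currents

section LWeightSums

open Module

variable {I : Type*} [DecidableEq I] {G : SimpleGraph I} [DecidableRel G.Adj] {q : ℂˣ}
  {V : Type*} [AddCommGroup V] [Module ℂ V] [Module (QAff G q) V] [IsScalarTower ℂ (QAff G q) V]
  {M M' : Set (LMonomial I)} {m : LMonomial I}

variable (G q V) in
/-- The sum of the `l`-weight spaces attached to a set of monomials. -/
def lWeightSum (M : Set (LMonomial I)) : Submodule ℂ V := ⨆ m ∈ M, lWeightSpace G q V m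

theorem lWeightSpace_le_lWeightSum (hm : m ∈ M) : lWeightSpace G q V m ≤ lWeightSum G q V M :=
  le_iSup₂_of_le m hm le_rfl

theorem lWeightSum_mono (h : M ⊆ M') : lWeightSum G q V M ≤ lWeightSum G q V M' :=
  biSup_mono h

theorem disjoint_lWeightSum (hq : ¬IsOfFinOrder q) (hm : m ∉ M) :
    Disjoint (lWeightSpace G q V m) (lWeightSum G q V M) :=
  (iSupIndep_lWeightSpace hq).disjoint_biSup hm

theorem apply_mem_lWeightSum_of_commute {f : End ℂ V}
    (hk : ∀ i, Commute (act G q V (Gen.k 1 i)) f)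
    (hh : ∀ i r, Commute (act G q V (Gen.h i r)) f) :
    ∀ u ∈ lWeightSum G q V M, f u ∈ lWeightSum G q V M :=
  fun _ hu => (iSup₂_le fun _ hm _ hu =>
    lWeightSpace_le_lWeightSum hm (apply_mem_lWeightSpace_of_commute hk hh hu) :
    lWeightSum G q V M ≤ (lWeightSum G q V M).comap f) hu

theorem isCartanStable_lWeightSum (M : Set (LMonomial I)) :
    IsCartanStable (G := G) (q := q) (lWeightSum G q V M) where
  act_k_mem ε i := apply_mem_lWeightSum_of_commute (fun j => act_k_comm 1 ε j i)
    fun j r => (act_k_h_comm ε i j r).symm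
  act_h_mem i r := apply_mem_lWeightSum_of_commute (fun j => act_k_h_comm 1 j i r)
    fun j s => act_h_comm j i s r

variable (G q V) in
/-- The vectors killed by all the raising operators. -/
def singularVectors : Submodule ℂ V := ⨅ (i : I) (r : ℤ), LinearMap.ker (act G q V (Gen.x 1 i r))

theorem mem_singularVectors {u : V} :
    u ∈ singularVectors G q V ↔ ∀ i r, act G q V (Gen.x 1 i r) u = 0 := by
  simp only [singularVectors, Submodule.mem_iInf, LinearMap.mem_ker]

theorem isCartanStable_singularVectors :
    IsCartanStable (G := G) (q := q) (singularVectors G q V) where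
  act_k_mem ε i u hu := mem_singularVectors.2 fun j r => by
    have hkx := act_k_x_apply (G := G) (q := q) ε 1 i j r u
    rw [mem_singularVectors.1 hu, map_zero] at hkx
    exact (smul_eq_zero.1 hkx.symm).resolve_left (Units.ne_zero _)
  act_h_mem i r u hu := mem_singularVectors.2 fun j s => by
    rcases eq_or_ne r 0 with rfl | hr
    · rw [act_h_zero, LinearMap.zero_apply, map_zero]
    have hhx := act_h_x_apply (G := G) (q := q) 1 i j s hr u
    rwa [mem_singularVectors.1 hu, mem_singularVectors.1 hu, map_zero, smul_zero, add_zero,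
      eq_comm] at hhx

variable [Fintype I]

theorem act_lowering_mem_lWeightSum [FiniteDimensional ℂ V] (hq : ¬IsOfFinOrder q) {j : I}
    (h : ∀ m ∈ M, ∀ b, m + aInv G q j b ∈ M') (s : ℤ) {u : V} (hu : u ∈ lWeightSum G q V M) :
    act G q V (Gen.x (-1) j s) u ∈ lWeightSum G q V M' :=
  (iSup₂_le fun m hm _ hu => (iSup_le fun b => lWeightSpace_le_lWeightSum (h m hm b) :
    ⨆ b : ℂˣ, lWeightSpace G q V (m + aInv G q j b) ≤ lWeightSum G q V M')
      (act_lowering_mem_iSup hq j s hu) :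
    lWeightSum G q V M ≤ (lWeightSum G q V M').comap (act G q V (Gen.x (-1) j s))) hu

variable (G q) in
/-- A set of monomials stable under multiplication by the `A_{j,b}^{-1}`, that is, a lower set for
the Nakajima order. -/
def IsNakajimaLower (M : Set (LMonomial I)) : Prop := ∀ m ∈ M, ∀ j b, m + aInv G q j b ∈ M

theorem loweredSpan_le_lWeightSum [FiniteDimensional ℂ V] (hq : ¬IsOfFinOrder q)
    (hM : IsNakajimaLower G q M) {S : Submodule ℂ V} (hS : S ≤ lWeightSum G q V M) :
    loweredSpan G q S ≤ lWeightSum G q V M := by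
  refine Submodule.span_le.2 fun u hu => ?_
  induction hu with
  | base hu => exact hS hu
  | step j r _ ih => exact act_lowering_mem_lWeightSum hq (fun m hm b => hM m hm j b) r ih

/-- Otherwise `u` would generate a proper submodule, missing the `l`-weight `m`. -/
theorem eq_zero_of_mem_singularVectors [FiniteDimensional ℂ V] [IsSimpleModule (QAff G q) V]
    (hq : ¬IsOfFinOrder q) (hM : IsNakajimaLower G q M) (hmM : m ∉ M)
    (hm : lWeightSpace G q V m ≠ ⊥) {u : V} (hu : u ∈ lWeightSum G q V M)
    (hx : u ∈ singularVectors G q V) : u = 0 := by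
  by_contra hne
  let S := lWeightSum G q V M ⊓ singularVectors G q V
  have hS : IsCartanStable (G := G) (q := q) S :=
    (isCartanStable_lWeightSum M).inf isCartanStable_singularVectors
  have hle : loweredSpan G q S ≤ lWeightSum G q V M := loweredSpan_le_lWeightSum hq hM inf_le_left
  have htop : loweredSpan G q S = ⊤ := by
    refine loweredSpan_eq_top ((Submodule.ne_bot_iff _).2 ⟨u, ?_, hne⟩) hS ?_
    · exact ⟨hu, hx⟩
    · exact fun i r v hv => mem_singularVectors.1 hv.2 i r
  rw [htop, top_le_iff] at hle
  exact hm (disjoint_top.1 (hle ▸ disjoint_lWeightSum hq hmM))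

end LWeightSums

section NakajimaOrder

variable {I : Type*} {G : SimpleGraph I} [DecidableRel G.Adj] {q : ℂˣ}

theorem exists_maximal_zpow_mem (hq : ¬IsOfFinOrder q) {ξ : I → ℤ} {t : Multiset (I × ℂˣ)} {i : I}
    {p : ℤ} (hp : ξ i < p) (hi : (i, q ^ p) ∈ t) :
    ∃ j s, ξ j < s ∧ (j, q ^ s) ∈ t ∧ ∀ k r, ξ k < r → (k, q ^ r) ∈ t → r ≤ s := by
  let E : Set ℤ := {s | ∃ j, ξ j < s ∧ (j, q ^ s) ∈ t}
  have hfin : E.Finite := by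
    refine ((t.map Prod.snd).finite_toSet.preimage
      (injective_zpow_iff_not_isOfFinOrder.2 hq).injOn).subset ?_
    exact fun s ⟨_, _, hs⟩ => Multiset.mem_map_of_mem Prod.snd hs
  obtain ⟨s, ⟨j, hjs, hs⟩, hmax⟩ := E.exists_max_image id hfin ⟨p, i, hp, hi⟩
  exact ⟨j, s, hjs, hs, fun k r hr hk => hmax r ⟨k, hr, hk⟩⟩

variable [Fintype I]

variable (G q) in
/-- The product of the monomials `A_{j,b}^{-1}`, where `(j, b)` runs through `s`. -/
def aInvProd (s : Multiset (I × ℂˣ)) : LMonomial I := (s.map fun y => aInv G q y.1 y.2).sum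

theorem aInvProd_cons (y : I × ℂˣ) (s : Multiset (I × ℂˣ)) :
    aInvProd G q (y ::ₘ s) = aInv G q y.1 y.2 + aInvProd G q s := by
  rw [aInvProd, Multiset.map_cons, Multiset.sum_cons, aInvProd]

theorem aInvProd_apply (s : Multiset (I × ℂˣ)) (z : I × ℂˣ) :
    aInvProd G q s z = (s.map fun y => aInv G q y.1 y.2 z).sum := by
  rw [aInvProd, ← Finsupp.applyAddHom_apply, map_multiset_sum, Multiset.map_map]
  rfl

variable (G q) in
/-- The monomials obtained by multiplying `m` by a product of `A_{j,b}^{-1}` indexed by a multiset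
in `T`. -/
def monomialsBelow (m : LMonomial I) (T : Set (Multiset (I × ℂˣ))) : Set (LMonomial I) :=
  (fun s => m + aInvProd G q s) '' T

theorem add_aInv_mem_monomialsBelow (m : LMonomial I) {T : Set (Multiset (I × ℂˣ))}
    {y : I × ℂˣ} (hy : {y} ∈ T) : m + aInv G q y.1 y.2 ∈ monomialsBelow G q m T :=
  ⟨{y}, hy, by simp [aInvProd]⟩

theorem isNakajimaLower_monomialsBelow (m : LMonomial I) {T : Set (Multiset (I × ℂˣ))}
    (hT : IsUpperSet T) : IsNakajimaLower G q (monomialsBelow G q m T) := by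
  rintro _ ⟨s, hs, rfl⟩ j b
  refine ⟨(j, b) ::ₘ s, hT (Multiset.le_cons_self s _) hs, ?_⟩
  simp only [aInvProd_cons]
  abel

theorem aInv_apply [DecidableEq I] (j k : I) (a b : ℂˣ) : aInv G q k b (j, a) =
    (if G.Adj j k ∧ b = a then 1 else 0) - ((if k = j ∧ b * q = a then 1 else 0) +
      if k = j ∧ b * q⁻¹ = a then 1 else 0) := by
  have hadj (l : I) : (if G.Adj l k then Finsupp.single (l, b) (1 : ℤ) else 0) (j, a) =
      if l = j then (if G.Adj j k ∧ b = a then 1 else 0) else 0 := by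
    by_cases hl : l = j
    · subst hl
      by_cases hlk : G.Adj l k <;> simp [hlk, Finsupp.single_apply]
    · by_cases hlk : G.Adj l k <;> simp [hlk, hl]
  rw [aInv, Finsupp.sub_apply, Finsupp.add_apply, Finsupp.finsetSum_apply]
  simp only [hadj, Finset.sum_ite_eq', Finset.mem_univ, if_true, Finsupp.single_apply,
    Prod.mk.injEq]

/-- Choose `s` maximal among the `s > ξ(j)` with `(j, q ^ s) ∈ t`: then nothing compensates the
factor `Y_{j,q^{s+1}}^{-1}` of `A_{j,q^s}^{-1}`. -/
theorem exists_aInvProd_apply_neg (hq : ¬IsOfFinOrder q) {ξ : I → ℤ} (hξ : IsHeight G ξ)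
    {t : Multiset (I × ℂˣ)} {i : I} {p : ℤ} (hp : ξ i < p) (hi : (i, q ^ p) ∈ t) :
    ∃ j s, ξ j < s ∧ aInvProd G q t (j, q ^ s) < 0 := by
  classical
  obtain ⟨j, s, hjs, hs, hmax⟩ := exists_maximal_zpow_mem hq hp hi
  refine ⟨j, s + 1, by lia, ?_⟩
  have hnonpos : ∀ y ∈ t, aInv G q y.1 y.2 (j, q ^ (s + 1)) ≤ 0 := by
    rintro ⟨k, b⟩ hk
    have hadj : ¬(G.Adj j k ∧ b = q ^ (s + 1)) := by
      rintro ⟨hjk, rfl⟩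
      have := hξ j k hjk
      have := hmax k (s + 1) (by lia) hk
      lia
    rw [aInv_apply, if_neg hadj]
    split_ifs <;> simp
  have hneg : aInv G q j (q ^ s) (j, q ^ (s + 1)) < 0 := by
    rw [aInv_apply, if_neg (fun h => G.irrefl h.1), if_pos ⟨rfl, (zpow_add_one q s).symm⟩]
    split_ifs <;> simp
  rw [aInvProd_apply]
  simpa using Multiset.sum_lt_sum (g := fun _ => 0) hnonpos ⟨_, hs, hneg⟩

variable [DecidableEq I]

theorem totalDegree_aInvProd (s : Multiset (I × ℂˣ)) (i : I) :
    totalDegree i (aInvProd G q s) =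
      -((cartan G).mulVec (s.map fun y => simpleRoot y.1).sum) i := by
  induction s using Multiset.induction with
  | empty => simp [aInvProd]
  | cons y s ih =>
    rw [aInvProd_cons, map_add, ih, totalDegree_aInv, Multiset.map_cons, Multiset.sum_cons,
      Matrix.mulVec_add, simpleRoot, Matrix.mulVec_single_one, Pi.add_apply, Matrix.col_apply,
      neg_add]

theorem aInvProd_ne_zero (hG : IsFiniteType G) {s : Multiset (I × ℂˣ)} (hs : s ≠ 0) :
    aInvProd G q s ≠ 0 := fun h => by
  have hroots : (s.map fun y => simpleRoot y.1).sum = (0 : I → ℤ) := by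
    refine cartan_mulVec_injective hG (funext fun i => ?_)
    have hdeg := totalDegree_aInvProd (G := G) (q := q) s i
    rw [h, map_zero, zero_eq_neg] at hdeg
    simpa using hdeg
  obtain ⟨y, hy⟩ := Multiset.exists_mem_of_ne_zero hs
  have hle := Multiset.single_le_sum
    (Multiset.forall_mem_map_iff.2 fun z _ => simpleRoot_nonneg z.1) _
    (Multiset.mem_map_of_mem (fun z => simpleRoot z.1) hy)
  rw [hroots] at hle
  simpa [simpleRoot] using hle y.1

theorem notMem_monomialsBelow (hG : IsFiniteType G) (m : LMonomial I) :
    m ∉ monomialsBelow G q m {0}ᶜ := by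
  rintro ⟨s, hs, h⟩
  exact aInvProd_ne_zero hG hs (by simpa using h)

end NakajimaOrder

section HighestLWeightVectors

open Module

variable {I : Type*} [DecidableEq I] {G : SimpleGraph I} [DecidableRel G.Adj] {q : ℂˣ}
  {V : Type*} [AddCommGroup V] [Module ℂ V] [Module (QAff G q) V] [IsScalarTower ℂ (QAff G q) V]
  {m : LMonomial I} {v : V}

variable (G q) in
/-- The vector `v` is killed by the raising operators and is an eigenvector of the loop-Cartan
operators, with the eigenvalues attached to the monomial `m`. -/
structure IsHighestLWeightVector (m : LMonomial I) (v : V) : Prop where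
  act_x (i : I) (r : ℤ) : act G q V (Gen.x 1 i r) v = 0
  act_k (i : I) : act G q V (Gen.k 1 i) v = kValue q m i • v
  act_h (i : I) (r : ℤ) (hr : r ≠ 0) : act G q V (Gen.h i r) v = hValue q m i r • v

theorem IsSimpleOfHighestLWeight.exists_isHighestLWeightVector
    (h : IsSimpleOfHighestLWeight G q V m) : ∃ v : V, v ≠ 0 ∧ IsHighestLWeightVector G q m v :=
  let ⟨v, hne, hx, hk, hh⟩ := h.exists_highest
  ⟨v, hne, hx, hk, hh⟩

theorem mem_maxGenEigenspace_of_apply_eq_smul {f : End ℂ V} {c : ℂ} {u : V} (h : f u = c • u) :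
    u ∈ f.maxGenEigenspace c :=
  End.genEigenspace_le_maximal f c 1 (End.mem_eigenspace_iff.2 h)

namespace IsHighestLWeightVector

theorem mem_lWeightSpace (hv : IsHighestLWeightVector G q m v) : v ∈ lWeightSpace G q V m :=
  HernandezLeclerc.mem_lWeightSpace.2
    ⟨fun i => mem_maxGenEigenspace_of_apply_eq_smul (hv.act_k i),
      fun i r hr => mem_maxGenEigenspace_of_apply_eq_smul (hv.act_h i r hr)⟩

theorem isCartanStable_span (hv : IsHighestLWeightVector G q m v) :
    IsCartanStable (G := G) (q := q) (Submodule.span ℂ {v}) := by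
  suffices h : ∀ f : End ℂ V, f v ∈ Submodule.span ℂ {v} →
      ∀ u ∈ Submodule.span ℂ {v}, f u ∈ Submodule.span ℂ {v} by
    refine ⟨fun ε i => h _ ?_, fun i r => h _ ?_⟩
    · rw [act_k_apply (κ := q ^ totalDegree i m) (by rw [hv.act_k, kValue_eq])]
      exact Submodule.smul_mem _ _ (Submodule.mem_span_singleton_self v)
    · rcases eq_or_ne r 0 with rfl | hr
      · simp [act_h_zero]
      · rw [hv.act_h i r hr]
        exact Submodule.smul_mem _ _ (Submodule.mem_span_singleton_self v)
  exact fun f hf u hu => (Submodule.span_singleton_le_iff_mem v (_ : Submodule ℂ V)).2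
    (show v ∈ (Submodule.span ℂ {v}).comap f from hf) hu

theorem loweredSpan_span_eq_top [IsSimpleModule (QAff G q) V]
    (hv : IsHighestLWeightVector G q m v) (hne : v ≠ 0) :
    loweredSpan G q (Submodule.span ℂ {v}) = ⊤ := by
  refine loweredSpan_eq_top (by simpa using hne) hv.isCartanStable_span fun i r u hu => ?_
  obtain ⟨c, rfl⟩ := Submodule.mem_span_singleton.1 hu
  rw [map_smul, hv.act_x, smul_zero]

theorem act_raising_lowering (hv : IsHighestLWeightVector G q m v) (i j : I) (r s : ℤ) :
    act G q V (Gen.x 1 i r) (act G q V (Gen.x (-1) j s) v) =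
      if i = j then ((q : ℂ) - ((q⁻¹ : ℂˣ) : ℂ))⁻¹ •
        (act G q V (Gen.φ 1 i (r + s)) v - act G q V (Gen.φ (-1) i (r + s)) v) else 0 := by
  rw [act_xp_xm, hv.act_x, map_zero, zero_add]

variable [FiniteDimensional ℂ V]

section

variable [Fintype I]

theorem loweredSpan_span_le (hq : ¬IsOfFinOrder q) {M : Set (LMonomial I)}
    (hM : IsNakajimaLower G q M)
    (hlow : ∀ j s, act G q V (Gen.x (-1) j s) v ∈ lWeightSum G q V M) :
    loweredSpan G q (Submodule.span ℂ {v}) ≤ Submodule.span ℂ {v} ⊔ lWeightSum G q V M := by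
  refine Submodule.span_le.2 fun u hu => ?_
  induction hu with
  | base hu => exact Submodule.mem_sup_left hu
  | step j r _ ih =>
    obtain ⟨_, hcv, w, hw, rfl⟩ := Submodule.mem_sup.1 ih
    obtain ⟨c, rfl⟩ := Submodule.mem_span_singleton.1 hcv
    rw [map_add, map_smul]
    exact Submodule.mem_sup_right (Submodule.add_mem _ (Submodule.smul_mem _ _ (hlow j r))
      (act_lowering_mem_lWeightSum hq (fun m' hm' b => hM m' hm' j b) r hw))

theorem act_lowering_mem (hv : IsHighestLWeightVector G q m v) (hq : ¬IsOfFinOrder q) (j : I)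
    (s : ℤ) :
    act G q V (Gen.x (-1) j s) v ∈ lWeightSum G q V (monomialsBelow G q m {0}ᶜ) := by
  refine act_lowering_mem_lWeightSum (M := {m}) hq ?_ s
    (lWeightSpace_le_lWeightSum (Set.mem_singleton m) hv.mem_lWeightSpace)
  rintro _ rfl b
  exact add_aInv_mem_monomialsBelow (y := (j, b)) _ (by simp)

theorem eq_zero_of_mem_singularVectors [IsSimpleModule (QAff G q) V]
    (hv : IsHighestLWeightVector G q m v) (hne : v ≠ 0) (hG : IsFiniteType G)
    (hq : ¬IsOfFinOrder q) {u : V}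
    (hu : u ∈ lWeightSum G q V (monomialsBelow G q m {0}ᶜ)) (hx : u ∈ singularVectors G q V) :
    u = 0 := by
  have hupper : IsUpperSet ({0}ᶜ : Set (Multiset (I × ℂˣ))) := fun s t hle hs ht =>
    hs (Multiset.le_zero.1 (Set.mem_singleton_iff.1 ht ▸ hle))
  exact HernandezLeclerc.eq_zero_of_mem_singularVectors hq
    (isNakajimaLower_monomialsBelow m hupper) (notMem_monomialsBelow hG m)
    ((Submodule.ne_bot_iff _).2 ⟨v, hv.mem_lWeightSpace, hne⟩) hu hx

end

variable [IsSimpleModule (QAff G q) V]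

section

variable [Finite I]

theorem act_lowering_eq_zero (hv : IsHighestLWeightVector G q m v) (hne : v ≠ 0)
    (hG : IsFiniteType G) (hq : ¬IsOfFinOrder q) {j : I}
    (hφ : ∀ n, act G q V (Gen.φ 1 j n) v - act G q V (Gen.φ (-1) j n) v = 0) (s : ℤ) :
    act G q V (Gen.x (-1) j s) v = 0 := by
  have := Fintype.ofFinite I
  refine hv.eq_zero_of_mem_singularVectors hne hG hq (hv.act_lowering_mem hq j s)
    (mem_singularVectors.2 fun i r => ?_)
  rw [hv.act_raising_lowering]
  split_ifs with h
  · rw [h, hφ, smul_zero]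
  · rfl

theorem act_lowering_succ (hv : IsHighestLWeightVector G q m v) (hne : v ≠ 0)
    (hG : IsFiniteType G) (hq : ¬IsOfFinOrder q) {j : I} {a : ℂˣ} {c : ℂ}
    (hφ : ∀ n : ℤ, act G q V (Gen.φ 1 j n) v - act G q V (Gen.φ (-1) j n) v =
      (((a ^ n : ℂˣ) : ℂ) * c) • v) (s : ℤ) :
    act G q V (Gen.x (-1) j (s + 1)) v = (a : ℂ) • act G q V (Gen.x (-1) j s) v := by
  have := Fintype.ofFinite I
  have hlow := hv.act_lowering_mem hq j
  refine sub_eq_zero.1 (hv.eq_zero_of_mem_singularVectors hne hG hq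
    (Submodule.sub_mem _ (hlow _) (Submodule.smul_mem _ _ (hlow _)))
    (mem_singularVectors.2 fun i r => ?_))
  rw [map_sub, map_smul, hv.act_raising_lowering, hv.act_raising_lowering]
  split_ifs with h
  · rw [h, hφ, hφ, ← add_assoc, zpow_add_one, Units.val_mul]
    module
  · rw [smul_zero, sub_zero]

theorem act_lowering_eq_zpow_smul (hv : IsHighestLWeightVector G q m v) (hne : v ≠ 0)
    (hG : IsFiniteType G) (hq : ¬IsOfFinOrder q) {j : I} {a : ℂˣ} {c : ℂ}
    (hφ : ∀ n : ℤ, act G q V (Gen.φ 1 j n) v - act G q V (Gen.φ (-1) j n) v =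
      (((a ^ n : ℂˣ) : ℂ) * c) • v) (s : ℤ) :
    act G q V (Gen.x (-1) j s) v = ((a ^ s : ℂˣ) : ℂ) • act G q V (Gen.x (-1) j 0) v := by
  induction s with
  | zero => simp
  | succ n ih =>
    rw [hv.act_lowering_succ hne hG hq hφ, ih, smul_smul, zpow_add_one, Units.val_mul, mul_comm]
  | pred n ih =>
    have hsucc := hv.act_lowering_succ hne hG hq hφ (-(n : ℤ) - 1)
    rw [sub_add_cancel, ih] at hsucc
    rw [zpow_sub_one, Units.val_mul, mul_comm, ← smul_smul, hsucc, smul_smul, Units.inv_mul,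
      one_smul]

end

theorem act_lowering_zero_mem [Fintype I] (hv : IsHighestLWeightVector G q m v) (hne : v ≠ 0)
    (hG : IsFiniteType G) (hq : ¬IsOfFinOrder q) {j : I} {a : ℂˣ} {c : ℂ}
    (hφ : ∀ n : ℤ, act G q V (Gen.φ 1 j n) v - act G q V (Gen.φ (-1) j n) v =
      (((a ^ n : ℂˣ) : ℂ) * c) • v) :
    act G q V (Gen.x (-1) j 0) v ∈ lWeightSpace G q V (m + aInv G q j a) := by
  refine HernandezLeclerc.mem_lWeightSpace.2
    ⟨fun i => mem_maxGenEigenspace_of_apply_eq_smul ?_,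
      fun i r hr => mem_maxGenEigenspace_of_apply_eq_smul ?_⟩
  · rw [act_k_x_apply, hv.act_k, map_smul, smul_smul, kValue_add, kValue_aInv, mul_comm]
    simp
  · rw [act_h_x_apply _ _ _ _ hr, hv.act_h i r hr, map_smul, add_zero,
      hv.act_lowering_eq_zpow_smul hne hG hq hφ r, smul_smul, ← add_smul, hValue_add, hValue_aInv]
    simp

end IsHighestLWeightVector

end HighestLWeightVectors

/-! ## Kirillov–Reshetikhin modules -/

section KirillovReshetikhin

variable {I : Type*} {G : SimpleGraph I} [DecidableRel G.Adj] {q : ℂˣ} {ξ : I → ℤ}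

theorem toLMonomial_krMonomial (y : ILE ξ) :
    toLMonomial q (krMonomial y) = ∑ d ∈ Finset.range (depth y + 1),
      Finsupp.single (y.1.1, q ^ (ξ y.1.1 - 2 * (d : ℤ))) 1 := by
  rw [krMonomial, toLMonomial, Finsupp.mapDomain_finsetSum]
  exact Finset.sum_congr rfl fun d _ => Finsupp.mapDomain_single

theorem toLMonomial_injective (hq : ¬IsOfFinOrder q) (ξ : I → ℤ) :
    Function.Injective (toLMonomial q (ξ := ξ)) := by
  refine Finsupp.mapDomain_injective fun y y' h => ?_
  rw [Prod.mk.injEq] at h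
  exact Subtype.ext (Prod.ext h.1 (injective_zpow_iff_not_isOfFinOrder.2 hq h.2))

theorem toLMonomial_apply_of_lt (hq : ¬IsOfFinOrder q) (m : ILE ξ →₀ ℤ) {j : I} {s : ℤ}
    (hs : ξ j < s) : toLMonomial q m (j, q ^ s) = 0 := by
  refine Finsupp.mapDomain_of_notMem_range _ _ ?_
  rintro ⟨⟨⟨k, p⟩, d, hd⟩, h⟩
  simp only [Prod.mk.injEq] at h hd
  obtain ⟨rfl, hzpow⟩ := h
  have := injective_zpow_iff_not_isOfFinOrder.2 hq hzpow
  lia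

variable (G q) in
/-- The monomials below the highest `l`-weight of the Kirillov–Reshetikhin module `X_{i,p}`,
`y = (i, p)`, which involve the factor `A_{i,a}^{-1}` with `a = q ^ (ξ(i) + 1)`. -/
def krLowerMonomials [Fintype I] (y : ILE ξ) : Set (LMonomial I) :=
  monomialsBelow G q (toLMonomial q (krMonomial y)) {s | (y.1.1, q ^ (ξ y.1.1 + 1)) ∈ s}

theorem toLMonomial_notMem_krLowerMonomials [Fintype I] {y : ILE ξ} (hq : ¬IsOfFinOrder q)
    (hξ : IsHeight G ξ) (m : ILE ξ →₀ ℤ) : toLMonomial q m ∉ krLowerMonomials G q y := by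
  rintro ⟨t, ht, h⟩
  obtain ⟨j, s, hjs, hneg⟩ := exists_aInvProd_apply_neg hq hξ (lt_add_one (ξ y.1.1)) ht
  have happly := DFunLike.congr_fun h (j, q ^ s)
  simp only [Finsupp.add_apply, toLMonomial_apply_of_lt hq _ hjs, zero_add] at happly
  exact hneg.ne happly

variable [DecidableEq I]

theorem totalDegree_krMonomial (y : ILE ξ) (j : I) :
    totalDegree j (toLMonomial q (krMonomial y)) =
      if y.1.1 = j then (depth y : ℤ) + 1 else 0 := by
  rw [toLMonomial_krMonomial, map_sum]
  simp only [totalDegree_single]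
  split_ifs <;> simp

theorem hValue_krMonomial (y : ILE ξ) {r : ℤ} :
    hValue q (toLMonomial q (krMonomial y)) y.1.1 r =
      ((((q ^ (ξ y.1.1 + 1)) ^ r : ℂˣ) : ℂ) -
        (((q ^ (ξ y.1.1 + 1 - 2 * ((depth y : ℤ) + 1))) ^ r : ℂˣ) : ℂ)) /
          (r * ((q : ℂ) - ((q⁻¹ : ℂˣ) : ℂ))) := by
  have htele := Finset.sum_range_sub'
    (fun d : ℕ => (((q ^ (ξ y.1.1 + 1 - 2 * (d : ℤ))) ^ r : ℂˣ) : ℂ)) (depth y + 1)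
  simp only [Nat.cast_add, Nat.cast_one, Nat.cast_zero, mul_zero, sub_zero] at htele
  rw [hValue_eq, toLMonomial_krMonomial, map_sum]
  simp only [powerSum_single, if_true]
  rw [qInt, div_div, div_mul_eq_mul_div, mul_comm (_ - _) (r : ℂ), Finset.mul_sum, ← htele]
  congr 1
  refine Finset.sum_congr rfl fun d _ => ?_
  rw [Int.cast_one, one_mul, sub_mul, ← Units.val_mul, ← Units.val_mul, ← zpow_mul, ← zpow_mul,
    ← zpow_mul, ← zpow_add, ← zpow_add]
  congr 4 <;> ring

theorem hValue_krMonomial_of_ne (y : ILE ξ) {j : I} (hj : y.1.1 ≠ j) (r : ℤ) :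
    hValue q (toLMonomial q (krMonomial y)) j r = 0 := by
  rw [hValue_eq, toLMonomial_krMonomial, map_sum]
  simp [powerSum_single, hj]

variable {V : Type*} [AddCommGroup V] [Module ℂ V] [Module (QAff G q) V]
  [IsScalarTower ℂ (QAff G q) V] {y : ILE ξ} {v : V}

namespace IsHighestLWeightVector

theorem act_phi_sub_krMonomial (hq : ¬IsOfFinOrder q)
    (hv : IsHighestLWeightVector G q (toLMonomial q (krMonomial y)) v) (n : ℤ) :
    act G q V (Gen.φ 1 y.1.1 n) v - act G q V (Gen.φ (-1) y.1.1 n) v =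
      ((((q ^ (ξ y.1.1 + 1)) ^ n : ℂˣ) : ℂ) * (((q ^ ((depth y : ℤ) + 1) : ℂˣ) : ℂ) -
        (((q ^ ((depth y : ℤ) + 1))⁻¹ : ℂˣ) : ℂ))) • v := by
  refine act_phi_sub_apply (G := G) hq (B := q ^ (ξ y.1.1 + 1 - 2 * ((depth y : ℤ) + 1))) ?_ ?_
    (fun r hr => ?_) n
  · rw [← zpow_natCast, ← zpow_mul, ← zpow_add]
    congr 1
    push_cast
    ring
  · rw [hv.act_k, kValue_eq, totalDegree_krMonomial, if_pos rfl]
  · rw [hv.act_h _ r hr, hValue_krMonomial]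

theorem act_phi_sub_krMonomial_of_ne (hq : ¬IsOfFinOrder q)
    (hv : IsHighestLWeightVector G q (toLMonomial q (krMonomial y)) v) {j : I} (hj : y.1.1 ≠ j)
    (n : ℤ) : act G q V (Gen.φ 1 j n) v - act G q V (Gen.φ (-1) j n) v = 0 := by
  have hφ := act_phi_sub_apply (G := G) (V := V) (v := v) (i := j) (κ := 1) (A := 1) (B := 1) hq
    (by simp) ?_ (fun r hr => ?_) n
  · simpa using hφ
  · rw [hv.act_k, kValue_eq, totalDegree_krMonomial, if_neg hj, zpow_zero]
  · rw [hv.act_h j r hr, hValue_krMonomial_of_ne y hj]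
    simp

end IsHighestLWeightVector

theorem lWeightSpace_eq_span_singleton (hq : ¬IsOfFinOrder q) {M : Set (LMonomial I)}
    {m : LMonomial I} (hv : v ∈ lWeightSpace G q V m) (hm : m ∉ M)
    (htop : Submodule.span ℂ {v} ⊔ lWeightSum G q V M = ⊤) :
    lWeightSpace G q V m = Submodule.span ℂ {v} := by
  have hle : Submodule.span ℂ {v} ≤ lWeightSpace G q V m :=
    (Submodule.span_singleton_le_iff_mem v _).2 hv
  rw [← top_inf_eq (lWeightSpace G q V m), ← htop, sup_inf_assoc_of_le _ hle, inf_comm,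
    (disjoint_lWeightSum hq hm).eq_bot, sup_bot_eq]

theorem lWeightSpace_eq_bot (hq : ¬IsOfFinOrder q) {M : Set (LMonomial I)} {m m' : LMonomial I}
    (hv : v ∈ lWeightSpace G q V m) (hne : m' ≠ m) (hm : m' ∉ M)
    (htop : Submodule.span ℂ {v} ⊔ lWeightSum G q V M = ⊤) : lWeightSpace G q V m' = ⊥ := by
  have hle : (⊤ : Submodule ℂ V) ≤ lWeightSum G q V (insert m M) := by
    rw [← htop]
    refine sup_le ?_ (lWeightSum_mono (Set.subset_insert m M))
    exact (Submodule.span_singleton_le_iff_mem v _).2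
      (lWeightSpace_le_lWeightSum (Set.mem_insert m M) hv)
  have hdisj := disjoint_lWeightSum (G := G) (V := V) hq (M := insert m M) (m := m')
    (by simp [hne, hm])
  rwa [top_le_iff.1 hle, disjoint_top] at hdisj

/-- The vectors `x⁻_{i,s} v` are proportional to each other and of `l`-weight the highest one
times `A_{i,a}^{-1}`, while the `x⁻_{j,s} v`, `j ≠ i`, vanish. -/
theorem IsHighestLWeightVector.span_sup_lWeightSum_krLowerMonomials [Fintype I]
    [FiniteDimensional ℂ V] [IsSimpleModule (QAff G q) V] (hG : IsFiniteType G)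
    (hq : ¬IsOfFinOrder q) (hv : IsHighestLWeightVector G q (toLMonomial q (krMonomial y)) v)
    (hne : v ≠ 0) :
    Submodule.span ℂ {v} ⊔ lWeightSum G q V (krLowerMonomials G q y) = ⊤ := by
  rw [← top_le_iff, ← hv.loweredSpan_span_eq_top hne]
  refine loweredSpan_span_le hq (isNakajimaLower_monomialsBelow _ fun s t hle hs =>
    Multiset.mem_of_le hle hs) fun j s => ?_
  rcases eq_or_ne y.1.1 j with rfl | hj
  · rw [hv.act_lowering_eq_zpow_smul hne hG hq (hv.act_phi_sub_krMonomial hq)]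
    exact Submodule.smul_mem _ _ (lWeightSpace_le_lWeightSum
      (add_aInv_mem_monomialsBelow _ (Multiset.mem_singleton_self _))
      (hv.act_lowering_zero_mem hne hG hq (hv.act_phi_sub_krMonomial hq)))
  · rw [hv.act_lowering_eq_zero hne hG hq (hv.act_phi_sub_krMonomial_of_ne hq hj)]
    exact Submodule.zero_mem _

theorem IsKR.truncatedQChar_eq [Finite I] (hG : IsFiniteType G) (hq : ¬IsOfFinOrder q)
    (hξ : IsHeight G ξ) (hV : IsKR G q V y) :
    truncatedQChar G q V ξ = AddMonoidAlgebra.single (krMonomial y) 1 := by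
  have := Fintype.ofFinite I
  have := hV.finiteDimensional
  have := hV.simple
  obtain ⟨v, hne, hv⟩ := hV.exists_isHighestLWeightVector
  have htop := hv.span_sup_lWeightSum_krLowerMonomials hG hq hne
  have hnotMem (m : ILE ξ →₀ ℤ) := toLMonomial_notMem_krLowerMonomials (y := y) hq hξ m
  rw [truncatedQChar, finsum_eq_single _ (krMonomial y)]
  · rw [lWeightSpace_eq_span_singleton hq hv.mem_lWeightSpace (hnotMem _) htop,
      finrank_span_singleton hne, Nat.cast_one]
  · intro m hm
    rw [lWeightSpace_eq_bot hq hv.mem_lWeightSpace ((toLMonomial_injective hq ξ).ne hm) (hnotMem m)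
      htop, finrank_bot, Nat.cast_zero, AddMonoidAlgebra.single_zero]

end KirillovReshetikhin

/-! ## The bijection `φ` and the period `2N` -/

section DoublePeriod

variable {I : Type*} [Fintype I] [DecidableEq I] {G : SimpleGraph I} [DecidableRel G.Adj]
  {ξ : I → ℤ} {w : ℕ → I}

theorem hatWord_succ_of_lt {k : ℕ} (hk : k < numPos G) : hatWord G w (k + 1) = w (k + 1) := by
  simp [hatWord, Nat.div_eq_of_lt hk, Nat.mod_eq_of_lt hk]

theorem hatWord_numPos_add_succ {k : ℕ} (hk : k < numPos G) :
    hatWord G w (numPos G + k + 1) = dualVertex G (w (k + 1)) := by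
  simp [hatWord, Nat.add_div_left _ (Nat.zero_lt_of_lt hk), Nat.div_eq_of_lt hk,
    Nat.mod_eq_of_lt hk]

theorem hatWord_add_two_mul_numPos {t : ℕ} (ht : 1 ≤ t) :
    hatWord G w (t + 2 * numPos G) = hatWord G w t := by
  rcases Nat.eq_zero_or_pos (numPos G) with h0 | hpos
  · rw [h0, mul_zero, add_zero]
  · have hsub : t + 2 * numPos G - 1 = t - 1 + numPos G * 2 := by lia
    simp only [hatWord, hsub, Nat.add_mul_div_left _ _ hpos, Nat.add_mul_mod_self_left,
      Nat.even_add, even_two, iff_true]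

theorem count_hatWord_two_mul_numPos (hG : IsSimplyLacedDynkin G) (hξ : IsHeight G ξ)
    (hw : IsAdaptedReducedWord G (heightQuiver G ξ) w) (j : I) :
    Nat.count (fun k => hatWord G w (k + 1) = j) (2 * numPos G) = coxeterNumber G := by
  obtain ⟨hlong, hadapted⟩ := hw
  set l := (List.range (numPos G)).map fun k => w (k + 1) with hl
  have hcount (f : ℕ → I) :
      Nat.count (fun k => f k = j) (numPos G) = ((List.range (numPos G)).map f).count j := by
    simp [Nat.count, List.count, List.countP_map, Function.comp_def, beq_eq_decide]
  have hdual := hlong.dualVertex_involutive hG.2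
  have hfst : (List.range (numPos G)).map (fun k => hatWord G w (k + 1)) = l :=
    List.map_congr_left fun k hk => hatWord_succ_of_lt (List.mem_range.1 hk)
  have hsnd : (List.range (numPos G)).map (fun k => hatWord G w (numPos G + k + 1)) =
      l.map (dualVertex G) := by
    rw [hl, List.map_map]
    exact List.map_congr_left fun k hk => hatWord_numPos_add_succ (List.mem_range.1 hk)
  have hcount_dual : (l.map (dualVertex G)).count j = l.count (dualVertex G j) := by
    simpa only [hdual j] using l.count_map_of_injective _ hdual.injective (dualVertex G j)
  rw [two_mul, Nat.count_add, hcount, hcount, hfst, hsnd, hcount_dual]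
  exact count_add_count_dualVertex hG hξ ((isAdapted_heightQuiver_iff hξ).1 hadapted) hlong
    (by simp [hl]) j

theorem occurrences_eq_count (t : ℕ) :
    occurrences G w t = Nat.count (fun k => hatWord G w (k + 1) = hatWord G w t) t := by
  rw [occurrences, Nat.count_eq_card_filter_range, Finset.card_filter, Finset.card_filter,
    Finset.range_eq_Ico,
    Finset.sum_Ico_add' (fun k => if hatWord G w k = hatWord G w t then 1 else 0)]
  rfl

theorem occurrences_add_two_mul_numPos (hG : IsSimplyLacedDynkin G) (hξ : IsHeight G ξ)
    (hw : IsAdaptedReducedWord G (heightQuiver G ξ) w) {t : ℕ} (ht : 1 ≤ t) :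
    occurrences G w (t + 2 * numPos G) = occurrences G w t + coxeterNumber G := by
  have hperiod (k : ℕ) : hatWord G w (2 * numPos G + k + 1) = hatWord G w (k + 1) := by
    rw [← hatWord_add_two_mul_numPos (Nat.le_add_left 1 k)]
    congr 1
    ring
  simp only [occurrences_eq_count, hatWord_add_two_mul_numPos ht]
  rw [add_comm t, Nat.count_add, count_hatWord_two_mul_numPos hG hξ hw, add_comm]
  simp only [hperiod]

theorem phiInv_add_two_mul_numPos (hG : IsSimplyLacedDynkin G) (hξ : IsHeight G ξ)
    (hw : IsAdaptedReducedWord G (heightQuiver G ξ) w) {t : ℕ} (ht : 1 ≤ t) :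
    phiInv G ξ w (t + 2 * numPos G) =
      atDepth ξ (hatWord G w t) (occurrences G w t - 1 + coxeterNumber G) := by
  have hocc : 1 ≤ occurrences G w t := Finset.card_pos.2 ⟨t, by simp [ht]⟩
  rw [phiInv, hatWord_add_two_mul_numPos ht, occurrences_add_two_mul_numPos hG hξ hw ht,
    Nat.sub_add_comm hocc]

theorem dTilde_single_krMonomial (Q : Digraph I) (i : I) (d : ℕ) :
    dTilde G Q ξ (AddMonoidAlgebra.single (krMonomial (atDepth ξ i d)) 1) =
      ((∏ c ∈ Finset.range (d + 1), dTildeY G Q ξ (atDepth ξ i c) : (RatField I)ˣ) :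
        RatField I) := by
  have hprod : (AddMonoidAlgebra.single (krMonomial (atDepth ξ i d)) 1 : Torus ξ) =
      ∏ c ∈ Finset.range (d + 1), Y (atDepth ξ i c) := by
    simp only [krMonomial, depth_atDepth, Y, AddMonoidAlgebra.prod_single, Finset.prod_const_one]
    rfl
  simp only [hprod, map_prod, dTilde_Y, Units.coe_prod]

theorem prod_range_dTildeY_add_coxeterNumber (hG : IsSimplyLacedDynkin G) (hξ : IsHeight G ξ)
    (hw : IsAdaptedReducedWord G (heightQuiver G ξ) w) (i : I) (d : ℕ) :
    ∏ c ∈ Finset.range (d + coxeterNumber G + 1), dTildeY G (heightQuiver G ξ) ξ (atDepth ξ i c) =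
      ∏ c ∈ Finset.range (d + 1), dTildeY G (heightQuiver G ξ) ξ (atDepth ξ i c) := by
  rw [add_right_comm, Finset.prod_range_add, mul_eq_left, ← Finset.prod_range_reflect,
    ← Fin.prod_univ_eq_prod_range (fun k =>
      dTildeY G (heightQuiver G ξ) ξ (atDepth ξ i (d + 1 + (coxeterNumber G - 1 - k))))]
  refine prod_dTildeY_eq_one hG hξ ((isAdapted_heightQuiver_iff hξ).1 hw.2) hw.1 (by simp)
    (i := i) (p := ξ i - 2 * (d + coxeterNumber G : ℕ)) (by lia) fun k => ?_
  simp only [atDepth, Prod.mk.injEq, true_and]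
  omega

end DoublePeriod

end HernandezLeclerc

end

open HernandezLeclerc in
theorem proposition10p1 {I : Type*} [Fintype I] [DecidableEq I]
    (G : SimpleGraph I) [DecidableRel G.Adj] (hG : IsSimplyLacedDynkin G)
    (Q : Digraph I) (hQ : IsOrientation G Q)
    (ξ : I → ℤ) (hξ : ∀ i j, Q.Adj i j → ξ j = ξ i - 1)
    (q : ℂˣ) (hq : ∀ n : ℕ, 0 < n → q ^ n ≠ 1)
    (w : ℕ → I) (hw : IsAdaptedReducedWord G Q w) :
    (∀ (i : I) (p : ℤ) (hp : MemLE ξ i p) (hle : p ≤ ξ i - 2 * (coxeterNumber G : ℤ) + 2),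
      dTilde G Q ξ (∏ k : Fin (coxeterNumber G), Y ⟨(i, p + 2 * (k : ℕ)), hp.shift hle k.2⟩) = 1) ∧
    (∀ t : ℕ, 1 ≤ t →
      ∀ (V : Type*) [AddCommGroup V] [Module ℂ V] [Module (QAff G q) V]
        [IsScalarTower ℂ (QAff G q) V]
        (V' : Type*) [AddCommGroup V'] [Module ℂ V'] [Module (QAff G q) V']
        [IsScalarTower ℂ (QAff G q) V'],
        IsKR G q V (phiInv G ξ w t) →
        IsKR G q V' (phiInv G ξ w (t + 2 * numPos G)) →
        dTilde G Q ξ (truncatedQChar G q V' ξ) = dTilde G Q ξ (truncatedQChar G q V ξ)) := by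
  have hheight : IsHeight G ξ := isHeight_of_isOrientation hQ hξ
  have hqfin : ¬IsOfFinOrder q := by simpa [isOfFinOrder_iff_pow_eq_one] using hq
  obtain rfl := eq_heightQuiver hQ hξ
  refine ⟨fun i p hp hle => ?_, fun t ht V _ _ _ _ V' _ _ _ _ hV hV' => ?_⟩
  · have hfire := (isAdapted_heightQuiver_iff hheight).1 hw.2
    rw [map_prod]
    simp only [dTilde_Y]
    rw [← Units.coe_prod, prod_dTildeY_eq_one hG hheight hfire hw.1 (by simp) hle fun _ => rfl,
      Units.val_one]
  · rw [hV.truncatedQChar_eq hG.2 hqfin hheight, hV'.truncatedQChar_eq hG.2 hqfin hheight,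
      phiInv_add_two_mul_numPos hG hheight hw ht, phiInv, dTilde_single_krMonomial,
      dTilde_single_krMonomial, prod_range_dTildeY_add_coxeterNumber hG hheight hw]
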